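/- Let $n\ge 1$ and let $\Omega\subset\mathbb R^n$ be a bounded, open, connected set with Lipschitz boundary. Let $d_\Omega(x,y)$ be the geodesic distance in $\Omega$ (the infimum of the lengths of the curves in $\Omega$ joining $x$ and $y$), let $\operatorname{diam}(\Omega)=\sup_{x,y\in\Omega}d_\Omega(x,y)$ be the intrinsic diameter, and put $\Lambda_\infty=2/\operatorname{diam}(\Omega)$. For $1<p<\infty$ let $$\Lambda_p^p=\inf\left\{\frac{\int_\Omega|\nabla v|^p\,dx}{\int_\Omega|v|^p\,dx}:\ v\in W^{1,p}(\Omega),\ v\ne 0,\ \int_\Omega|v|^{p-2}v\,dx=0\right\}.$$ Let $p_k>1$, $p_k\to\infty$, and for each $k$ let $u_k$ be a function attaining this infimum for $p=p_k$, normalized by $\frac1{|\Omega|}\int_\Omega|u_k|^{p_k}dx=1$. Then $\Lambda_{p_k}\to\Lambda_\infty$, and there is a subsequence of $(u_k)$ whose members have representatives that are continuous on $\overline\Omega$ and converge uniformly on $\overline\Omega$ to a function $u_\infty$ that is a viscosity solution of the following problem with $\Lambda=\Lambda_\infty$: $$\begin{cases}\min\{|\nabla u|-\Lambda|u|,\,-\Delta_\infty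 u\}=0&\text{in }\{u>0\}\cap\Omega,\\ \max\{\Lambda|u|-|\nabla u|,\,-\Delta_\infty u\}=0&\text{in }\{u<0\}\cap\Omega,\\ -\Delta_\infty u=0&\text{in }\{u=0\}\cap\Omega,\\ \partial u/\partial\nu=0&\text{on }\partial\Omega,\end{cases}\qquad \Delta_\infty u=\sum_{i,j}u_{x_i}u_{x_ix_j}u_{x_j}.$$ Here viscosity solutions are understood as follows. For $\phi$ of class $C^2$ and $s\in\mathbb R$ let $E_s\phi$ be $\min\{|\nabla\phi|-\Lambda|\phi|,-\Delta_\infty\phi\}$, $\max\{\Lambda|\phi|-|\nabla\phi|,-\Delta_\infty\phi\}$ or $-\Delta_\infty\phi$ according as $s>0$, $s<0$ or $s=0$. A function $u$ continuous on $\overline\Omega$ is a viscosity solution if (i) for $x_0\in\Omega$ and $\phi\in C^2(\Omega)$ with $\phi(x_0)=u(x_0)$: if $\phi>u$ on $\Omega\setminus\{x_0\}$ then $E_{u(x_0)}\phi(x_0)\le0$, and if $\phi<u$ on $\Omega\setminus\{x_0\}$ then $E_{u(x_0)}\phi(x_0)\ge0$; (ii) for $x_0\in\partial\Omega$ and $\phi\in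 C^2(\overline\Omega)$ (the restriction to $\overline\Omega$ of a $C^2$ function on $\mathbb R^n$) with $\phi(x_0)=u(x_0)$: if $\phi>u$ on $\overline\Omega\setminus\{x_0\}$ then $\min\{E_{u(x_0)}\phi(x_0),\frac{\partial\phi}{\partial\nu}(x_0)\}\le0$, and if $\phi<u$ on $\overline\Omega\setminus\{x_0\}$ then $\max\{E_{u(x_0)}\phi(x_0),\frac{\partial\phi}{\partial\nu}(x_0)\}\ge0$, in each case for some exterior normal $\nu$ at $x_0$. The exterior normals at $x_0$ are the limits of classical exterior unit normals at boundary points tending to $x_0$; where $\partial\Omega$ is of class $C^1$ this is just the classical exterior normal. -/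

import Mathlib

open Set Filter Topology MeasureTheory
open scoped ENNReal NNReal ContDiff Gradient RealInnerProductSpace

namespace NeumannInfty

noncomputable section

/-! ### Lipschitz domains, exterior normals, intrinsic diameter -/

/-- `Ω` has Lipschitz boundary: near each of its boundary points, after a choice of a unit
direction `e`, it is the strict epigraph of a Lipschitz function on the hyperplane `eᗮ`. -/
def HasLipschitzBoundary {n : ℕ} (Ω : Set (EuclideanSpace ℝ (Fin n))) : Prop :=
  ∀ x₀ ∈ frontier Ω, ∃ (e : EuclideanSpace ℝ (Fin n)) (r : ℝ) (K : ℝ≥0)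
    (γ : (Submodule.span ℝ {e})ᗮ → ℝ),
    ‖e‖ = 1 ∧ 0 < r ∧ LipschitzWith K γ ∧
      ∀ y ∈ Metric.ball x₀ r,
        (y ∈ Ω ↔ γ ((Submodule.span ℝ {e})ᗮ.orthogonalProjectionOnto y) < ⟪e, y⟫)

/-- `ν` is the exterior unit normal of `Ω` at the boundary point `y`: to first order at `y`,
the set `Ω` is the half-space `{z | ⟪z - y, ν⟫ < 0}`. For a domain that is locally the epigraph of
a Lipschitz function, this says that the function is differentiable at the foot of `y` and that
`ν` is the usual exterior normal of its graph. -/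
def IsExteriorNormal {n : ℕ} (Ω : Set (EuclideanSpace ℝ (Fin n)))
    (y ν : EuclideanSpace ℝ (Fin n)) : Prop :=
  y ∈ frontier Ω ∧ ‖ν‖ = 1 ∧
    ∀ ε > 0, ∃ r > 0, ∀ z ∈ Metric.ball y r,
      (z ∈ Ω → ⟪z - y, ν⟫ ≤ ε * ‖z - y‖) ∧ (z ∉ Ω → -(ε * ‖z - y‖) ≤ ⟪z - y, ν⟫)

/-- The exterior normals at `x`: all limits of `ν k`, where `ν k` is the exterior normal at a
boundary point `y k` and `y k → x`. Where the boundary is of class `C¹` this is the singleton of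
the classical exterior normal; at a corner it contains the normals of all adjacent faces. -/
def normals {n : ℕ} (Ω : Set (EuclideanSpace ℝ (Fin n))) (x : EuclideanSpace ℝ (Fin n)) :
    Set (EuclideanSpace ℝ (Fin n)) :=
  {ν | ∃ y η : ℕ → EuclideanSpace ℝ (Fin n), (∀ k, IsExteriorNormal Ω (y k) (η k)) ∧
    Tendsto y atTop (𝓝 x) ∧ Tendsto η atTop (𝓝 ν)}

/-- Geodesic distance in `Ω`: infimum of the lengths of the curves in `Ω` from `x` to `y`. -/
def geodesicDist {n : ℕ} (Ω : Set (EuclideanSpace ℝ (Fin n)))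
    (x y : EuclideanSpace ℝ (Fin n)) : ℝ≥0∞ :=
  ⨅ (γ : Path x y) (_ : ∀ t, γ t ∈ Ω), eVariationOn γ univ

/-- The intrinsic diameter of `Ω`. -/
def intrinsicDiam {n : ℕ} (Ω : Set (EuclideanSpace ℝ (Fin n))) : ℝ≥0∞ :=
  ⨆ (x ∈ Ω) (y ∈ Ω), geodesicDist Ω x y

/-- `Λ_∞ = 2 / diam Ω`, with the intrinsic diameter. -/
def lambdaInfty {n : ℕ} (Ω : Set (EuclideanSpace ℝ (Fin n))) : ℝ :=
  (2 / intrinsicDiam Ω).toReal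

/-! ### The Sobolev space `W^{1,p}(Ω)` and the Neumann Rayleigh quotient -/

/-- `G` is the weak gradient of `v` in `Ω`. -/
def IsWeakGradient {n : ℕ} (Ω : Set (EuclideanSpace ℝ (Fin n)))
    (v : EuclideanSpace ℝ (Fin n) → ℝ)
    (G : EuclideanSpace ℝ (Fin n) → EuclideanSpace ℝ (Fin n)) : Prop :=
  LocallyIntegrableOn v Ω ∧ LocallyIntegrableOn G Ω ∧
    ∀ φ : EuclideanSpace ℝ (Fin n) → ℝ, ContDiff ℝ ∞ φ → HasCompactSupport φ →
      tsupport φ ⊆ Ω → ∫ x in Ω, v x • ∇ φ x = -∫ x in Ω, φ x • G x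

/-- `v ∈ W^{1,p}(Ω)` and `G` is its weak gradient. -/
def IsSobolevPair {n : ℕ} (Ω : Set (EuclideanSpace ℝ (Fin n))) (p : ℝ)
    (v : EuclideanSpace ℝ (Fin n) → ℝ)
    (G : EuclideanSpace ℝ (Fin n) → EuclideanSpace ℝ (Fin n)) : Prop :=
  MemLp v (ENNReal.ofReal p) (volume.restrict Ω) ∧
    MemLp G (ENNReal.ofReal p) (volume.restrict Ω) ∧ IsWeakGradient Ω v G

/-- The competitors in the Neumann eigenvalue problem: `v ∈ W^{1,p}(Ω)`, `v ≠ 0`, with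
`∫ |v|^(p-2) v = 0`. -/
def IsCompetitor {n : ℕ} (Ω : Set (EuclideanSpace ℝ (Fin n))) (p : ℝ)
    (v : EuclideanSpace ℝ (Fin n) → ℝ)
    (G : EuclideanSpace ℝ (Fin n) → EuclideanSpace ℝ (Fin n)) : Prop :=
  IsSobolevPair Ω p v G ∧ ∫ x in Ω, |v x| ^ (p - 2) * v x = 0 ∧ ∫ x in Ω, |v x| ^ p ≠ 0

/-- The Rayleigh quotient of `v` with weak gradient `G`. -/
def rayleigh {n : ℕ} (Ω : Set (EuclideanSpace ℝ (Fin n))) (p : ℝ)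
    (v : EuclideanSpace ℝ (Fin n) → ℝ)
    (G : EuclideanSpace ℝ (Fin n) → EuclideanSpace ℝ (Fin n)) : ℝ :=
  (∫ x in Ω, ‖G x‖ ^ p) / ∫ x in Ω, |v x| ^ p

/-- `Λ_p`, the `p`-th root of the infimum of the Rayleigh quotient. -/
def lambdaP {n : ℕ} (Ω : Set (EuclideanSpace ℝ (Fin n))) (p : ℝ) : ℝ :=
  (sInf {R | ∃ v G, IsCompetitor Ω p v G ∧ R = rayleigh Ω p v G}) ^ (1 / p)

/-- `u` minimizes the Rayleigh quotient, and `(1/|Ω|) ∫ |u|^p = 1`. -/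
def IsNormalizedMinimizer {n : ℕ} (Ω : Set (EuclideanSpace ℝ (Fin n))) (p : ℝ)
    (u : EuclideanSpace ℝ (Fin n) → ℝ) : Prop :=
  (∃ G, IsCompetitor Ω p u G ∧
    ∀ v G', IsCompetitor Ω p v G' → rayleigh Ω p u G ≤ rayleigh Ω p v G') ∧
  ⨍ x in Ω, |u x| ^ p = 1

/-! ### Viscosity solutions of the Neumann `∞`-eigenvalue problem -/

/-- `Δ_∞ φ = ∑ φ_{x_i} φ_{x_i x_j} φ_{x_j}`, the Hessian applied twice to the gradient. -/
def infLaplacian {n : ℕ} (φ : EuclideanSpace ℝ (Fin n) → ℝ)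
    (x : EuclideanSpace ℝ (Fin n)) : ℝ :=
  fderiv ℝ (fderiv ℝ φ) x (∇ φ x) (∇ φ x)

/-- The operator of the equation at a point where the solution has the value `s`: `F` for `s > 0`,
`G` for `s < 0`, `H` for `s = 0`. -/
def eigenOp {n : ℕ} (Λ s : ℝ) (φ : EuclideanSpace ℝ (Fin n) → ℝ)
    (x : EuclideanSpace ℝ (Fin n)) : ℝ :=
  if 0 < s then min (‖∇ φ x‖ - Λ * |φ x|) (-infLaplacian φ x)
  else if s < 0 then max (Λ * |φ x| - ‖∇ φ x‖) (-infLaplacian φ x)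
  else -infLaplacian φ x

/-- Viscosity subsolutions on `closure Ω`. On a Lipschitz domain the functions in `C²(closure Ω)`
are the restrictions of the `C²` functions on the whole space. -/
def IsViscositySubsolution {n : ℕ} (Ω : Set (EuclideanSpace ℝ (Fin n))) (Λ : ℝ)
    (u : EuclideanSpace ℝ (Fin n) → ℝ) : Prop :=
  UpperSemicontinuousOn u (closure Ω) ∧
  (∀ x₀ ∈ Ω, ∀ φ : EuclideanSpace ℝ (Fin n) → ℝ, ContDiffOn ℝ 2 φ Ω →
    u x₀ = φ x₀ → (∀ x ∈ Ω, x ≠ x₀ → u x < φ x) →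
      eigenOp Λ (u x₀) φ x₀ ≤ 0) ∧
  (∀ x₀ ∈ frontier Ω, ∀ φ : EuclideanSpace ℝ (Fin n) → ℝ, ContDiff ℝ 2 φ →
    u x₀ = φ x₀ → (∀ x ∈ closure Ω, x ≠ x₀ → u x < φ x) →
      ∃ ν ∈ normals Ω x₀, min (eigenOp Λ (u x₀) φ x₀) ⟪∇ φ x₀, ν⟫ ≤ 0)

/-- Viscosity supersolutions on `closure Ω`. -/
def IsViscositySupersolution {n : ℕ} (Ω : Set (EuclideanSpace ℝ (Fin n))) (Λ : ℝ)
    (u : EuclideanSpace ℝ (Fin n) → ℝ) : Prop :=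
  LowerSemicontinuousOn u (closure Ω) ∧
  (∀ x₀ ∈ Ω, ∀ φ : EuclideanSpace ℝ (Fin n) → ℝ, ContDiffOn ℝ 2 φ Ω →
    u x₀ = φ x₀ → (∀ x ∈ Ω, x ≠ x₀ → φ x < u x) →
      0 ≤ eigenOp Λ (u x₀) φ x₀) ∧
  (∀ x₀ ∈ frontier Ω, ∀ φ : EuclideanSpace ℝ (Fin n) → ℝ, ContDiff ℝ 2 φ →
    u x₀ = φ x₀ → (∀ x ∈ closure Ω, x ≠ x₀ → φ x < u x) →
      ∃ ν ∈ normals Ω x₀, 0 ≤ max (eigenOp Λ (u x₀) φ x₀) ⟪∇ φ x₀, ν⟫)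

/-- Viscosity solutions of the Neumann `∞`-eigenvalue problem. -/
def IsViscositySolution {n : ℕ} (Ω : Set (EuclideanSpace ℝ (Fin n))) (Λ : ℝ)
    (u : EuclideanSpace ℝ (Fin n) → ℝ) : Prop :=
  ContinuousOn u (closure Ω) ∧ IsViscositySubsolution Ω Λ u ∧ IsViscositySupersolution Ω Λ u

end

end NeumannInfty

open scoped Convolution

namespace NeumannInfty

noncomputable section

-- For large `p` the integrals in the Rayleigh quotient behave like sup norms. A normalized
-- minimizer satisfies `∫ |∇u|^p = Λ_p^p |Ω|`. As long as `Λ_p` stays bounded, the minimizers are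
-- therefore bounded in `W^{1,2n}`. Morrey's inequality gives a common Hölder-1/2 estimate on
-- interior balls, and chains of shrinking balls in Lipschitz charts turn it into a common modulus
-- of continuity up to the boundary (`exists_modulus`). Arzelà–Ascoli then gives uniform limits on
-- the closure (`exists_isMinimizerLimit`).
--
-- Eigenvalues from above: a truncated geodesic distance has gradient at most 1, and after
-- subtraction of its `p`-mean its modulus is almost `D/2` on a fixed ball around one of two points
-- at distance at least `D` (`exists_rayleigh_bound`). Eigenvalues from below: if `Λ_p ≤ a` along a
-- subsequence, a uniform limit of minimizers is `a`-Lipschitz for the geodesic distance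
-- (`abs_sub_le_of_uniform_limit`). The normalization forces its sup norm to be at least 1, and the
-- mean condition forces its positive and negative parts to be equally large, so it oscillates by at
-- least 2 (`exists_oscillation`). Hence `a` times the diameter is at least 2.
--
-- Viscosity: no viscosity property is derived for finite `p`; minimality is tested directly.
-- Suppose `φ` touches the limit from below at `x₀` with `E φ(x₀) < 0` and, if `x₀` lies on the
-- boundary, with `∂φ/∂ν < 0` for all exterior normals there. For large `k` a slightly lowered `φ`
-- is a strict subsolution of the `p_k`-equation near `x₀` (`isStrictNear_of_eigenOp_neg`). A
-- slightly raised copy `ψ = φ + m` exceeds `u_k` only near `x₀`. Minimality against `max ψ u_k`,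
-- with the convexity of `|·|^p`, gives `∫ (ψ - u_k)⁺ (Λ^p |u_k|^(p-2) u_k + Δ_p ψ) ≤ 0`
-- (`Minimizer.integral_test_nonpos`). But the integrand is nonnegative, and positive on a nonempty
-- open set.
--
-- The boundary term in the integration by parts is never computed. The condition `∂φ/∂ν < 0`
-- provides cutoff functions that increase in the direction `∇φ` (`Chart.hasCutoffs`), so the term
-- containing their gradient has a favourable sign. Subsolutions follow from supersolutions through
-- `u ↦ -u`.

local notation "𝔼" n => EuclideanSpace ℝ (Fin n)

/-! ### Mollification -/

section Mollify

variable {n : ℕ} {F : Type*} [NormedAddCommGroup F] [NormedSpace ℝ F]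

/-- A bump function at the origin whose support has radius `1 / (j + 1)`. -/
def bump (n j : ℕ) : ContDiffBump (0 : 𝔼 n) where
  rIn := 1 / (2 * (j + 1))
  rOut := 1 / (j + 1)
  rIn_pos := by positivity
  rIn_lt_rOut := by
    apply one_div_lt_one_div_of_lt <;> linarith [(by positivity : (0 : ℝ) < (j : ℝ) + 1)]

/-- The normalized bump function. -/
def mol (n j : ℕ) : (𝔼 n) → ℝ := (bump n j).normed volume

/-- Mollification of a function. -/
def mollify (j : ℕ) (g : (𝔼 n) → F) : (𝔼 n) → F :=
  mol n j ⋆[ContinuousLinearMap.lsmul ℝ ℝ, volume] g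

lemma bump_rOut_tendsto (n : ℕ) : Tendsto (fun j => (bump n j).rOut) atTop (𝓝 0) :=
  tendsto_one_div_add_atTop_nhds_zero_nat

lemma mol_nonneg (j : ℕ) (x : 𝔼 n) : 0 ≤ mol n j x := (bump n j).nonneg_normed x

lemma integral_mol (n j : ℕ) : ∫ x, mol n j x = 1 := (bump n j).integral_normed

lemma integrable_mol (n j : ℕ) : Integrable (mol n j) := (bump n j).integrable_normed

lemma contDiff_mol (n j : ℕ) : ContDiff ℝ ∞ (mol n j) := (bump n j).contDiff_normed

lemma hasCompactSupport_mol (n j : ℕ) : HasCompactSupport (mol n j) :=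
  (bump n j).hasCompactSupport_normed

lemma mol_eq_zero {j : ℕ} {x : 𝔼 n} (hx : 1 / ((j : ℝ) + 1) ≤ ‖x‖) : mol n j x = 0 := by
  by_contra h
  have : x ∈ Function.support (mol n j) := h
  rw [mol, (bump n j).support_normed_eq, mem_ball_zero_iff] at this
  exact absurd hx (not_le.2 this)

lemma mollify_apply (j : ℕ) (g : (𝔼 n) → F) (x : 𝔼 n) :
    mollify j g x = ∫ t, mol n j t • g (x - t) := rfl

lemma mollify_apply_swap (j : ℕ) (g : (𝔼 n) → F) (x : 𝔼 n) :
    mollify j g x = ∫ t, mol n j (x - t) • g t := by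
  rw [mollify, convolution_eq_swap]; rfl

lemma contDiff_mollify (j : ℕ) {g : (𝔼 n) → F} (hg : LocallyIntegrable g) :
    ContDiff ℝ ∞ (mollify j g) :=
  (hasCompactSupport_mol n j).contDiff_convolution_left _ (contDiff_mol n j) hg

lemma fderiv_mollify_apply (j : ℕ) {g : (𝔼 n) → ℝ} (hg : LocallyIntegrable g) (x h : 𝔼 n) :
    fderiv ℝ (mollify j g) x h = ∫ t, fderiv ℝ (mol n j) (x - t) h * g t := by
  have hd := (hasCompactSupport_mol n j).hasFDerivAt_convolution_left
    (ContinuousLinearMap.lsmul ℝ ℝ) ((contDiff_mol n j).of_le (by norm_cast)) hg x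
  have hc : Continuous (fderiv ℝ (mol n j)) :=
    (contDiff_mol n j).continuous_fderiv (by simp)
  rw [show fderiv ℝ (mollify j g) x = _ from hd.fderiv, convolution_eq_swap]
  have hinteg := ((hasCompactSupport_mol n j).fderiv ℝ).convolutionExists_left
    ((ContinuousLinearMap.lsmul ℝ ℝ : ℝ →L[ℝ] ℝ →L[ℝ] ℝ).precompL (𝔼 n)) hc hg x
  rw [ContinuousLinearMap.integral_apply]
  · rfl
  · exact hinteg.integrable_swap

lemma ae_tendsto_mollify [CompleteSpace F] {g : (𝔼 n) → F} (hg : LocallyIntegrable g) :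
    ∀ᵐ x, Tendsto (fun j => mollify j g x) atTop (𝓝 (g x)) := by
  -- Lebesgue differentiation needs outer radii bounded by a fixed multiple of the inner ones; here
  -- the factor is exactly 2.
  refine ContDiffBump.ae_convolution_tendsto_right_of_locallyIntegrable (K := 2)
    (bump_rOut_tendsto n) (Eventually.of_forall fun j => ?_) hg
  simp only [bump]
  apply le_of_eq
  field_simp

lemma norm_mollify_le (j : ℕ) (g : (𝔼 n) → F) (x : 𝔼 n) :
    ‖mollify j g x‖ ≤ mollify j (fun y => ‖g y‖) x := by
  rw [mollify_apply, mollify_apply]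
  refine (norm_integral_le_integral_norm _).trans (le_of_eq ?_)
  congr 1 with t
  rw [norm_smul, Real.norm_of_nonneg (mol_nonneg _ _), smul_eq_mul]

lemma integrable_mollify (j : ℕ) {g : (𝔼 n) → F} (hg : Integrable g) :
    Integrable (mollify j g) :=
  (integrable_mol n j).integrable_convolution _ hg

lemma integral_norm_mollify_le (j : ℕ) {g : (𝔼 n) → F} (hg : Integrable g) :
    ∫ x, ‖mollify j g x‖ ≤ ∫ x, ‖g x‖ := by
  calc ∫ x, ‖mollify j g x‖ ≤ ∫ x, mollify j (fun y => ‖g y‖) x :=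
        integral_mono (integrable_mollify j hg).norm (integrable_mollify j hg.norm)
          (norm_mollify_le j g)
    _ = ∫ x, ‖g x‖ := by
        rw [mollify, integral_convolution _ (integrable_mol n j) hg.norm, integral_mol]
        simp

lemma mollify_sub (j : ℕ) {f g : (𝔼 n) → F} (hf : LocallyIntegrable f) (hg : LocallyIntegrable g)
    (x : 𝔼 n) : mollify j (f - g) x = mollify j f x - mollify j g x := by
  simp only [mollify_apply, Pi.sub_apply, smul_sub]
  have key : ∀ g : (𝔼 n) → F, LocallyIntegrable g →
      Integrable (fun t => mol n j t • g (x - t)) := fun g hg =>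
    (hasCompactSupport_mol n j).convolutionExists_left (ContinuousLinearMap.lsmul ℝ ℝ)
      (contDiff_mol n j).continuous hg x
  exact integral_sub (key f hf) (key g hg)

lemma dist_mollify_le [CompleteSpace F] {j : ℕ} {g : (𝔼 n) → F} {x : 𝔼 n} {ε : ℝ}
    (hmg : AEStronglyMeasurable g volume)
    (hg : ∀ y ∈ Metric.ball x (1 / ((j : ℝ) + 1)), dist (g y) (g x) ≤ ε) :
    dist (mollify j g x) (g x) ≤ ε :=
  (bump n j).dist_normed_convolution_le hmg hg

/-- Continuous functions with compact support are dense in `L¹` and converge uniformly under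
mollification; the remainder is controlled because mollification is an `L¹` contraction. -/
lemma tendsto_integral_norm_mollify_sub [CompleteSpace F] {g : (𝔼 n) → F} (hg : Integrable g) :
    Tendsto (fun j => ∫ x, ‖mollify j g x - g x‖) atTop (𝓝 0) := by
  rw [Metric.tendsto_atTop]
  intro ε hε
  obtain ⟨h, hhc, hgh, hcont, hhi⟩ :=
    hg.exists_hasCompactSupport_integral_sub_le (ε := ε / 4) (by positivity)
  -- All mollification radii are at most 1, so `h` and its mollifications vanish off this compact
  -- set.
  set K : Set (𝔼 n) := Metric.cthickening 1 (tsupport h) with hK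
  have hKc : IsCompact K := hhc.isCompact.cthickening
  have hKm : MeasurableSet K := hKc.measurableSet
  set V := volume.real K
  have hV : 0 ≤ V := measureReal_nonneg
  set η := ε / (4 * (V + 1)) with hη
  have hη0 : 0 < η := by positivity
  obtain ⟨δ, hδ, hδh⟩ := Metric.uniformContinuous_iff.1
    (hhc.uniformContinuous_of_continuous hcont) η hη0
  obtain ⟨N, hN⟩ := (Metric.tendsto_atTop.1 (bump_rOut_tendsto n)) δ hδ
  refine ⟨N, fun j hj => ?_⟩
  have hjd : 1 / ((j : ℝ) + 1) < δ := by
    have := hN j hj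
    rw [Real.dist_0_eq_abs, abs_of_pos (bump n j).rOut_pos] at this
    exact this
  have h1 : ∫ x, ‖mollify j h x - h x‖ ≤ V * η := by
    have hz : ∀ x ∉ K, ‖mollify j h x - h x‖ = 0 := by
      intro x hx
      have hball : ∀ y ∈ Metric.ball x (1 / ((j : ℝ) + 1)), h y = 0 := by
        intro y hy
        by_contra hne
        apply hx
        refine Metric.mem_cthickening_of_dist_le x y 1 _ (subset_tsupport h hne) ?_
        rw [dist_comm]
        refine (Metric.mem_ball.1 hy).le.trans ?_
        rw [div_le_one (by positivity)]; simp
      have hx0 := hball x (Metric.mem_ball_self (by positivity))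
      have : dist (mollify j h x) (h x) ≤ 0 :=
        dist_mollify_le hcont.aestronglyMeasurable fun y hy => by simp [hball y hy, hx0]
      rw [← dist_eq_norm]
      exact le_antisymm this dist_nonneg
    rw [← setIntegral_eq_integral_of_forall_compl_eq_zero hz]
    have hb : ∀ x ∈ K, ‖(fun x => ‖mollify j h x - h x‖) x‖ ≤ η := by
      intro x _
      simp only [norm_norm]
      rw [← dist_eq_norm]
      refine dist_mollify_le hcont.aestronglyMeasurable fun y hy => (hδh ?_).le
      exact (Metric.mem_ball.1 hy).trans hjd
    calc _ ≤ ‖∫ x in K, ‖mollify j h x - h x‖‖ := le_abs_self _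
      _ ≤ η * V := norm_setIntegral_le_of_norm_le_const hKc.measure_lt_top hb
      _ = V * η := mul_comm _ _
  have h2 : ∫ x, ‖mollify j (g - h) x‖ ≤ ε / 4 :=
    (integral_norm_mollify_le j (hg.sub hhi)).trans hgh
  have hi1 := (integrable_mollify j (hg.sub hhi)).norm
  have hi2 : Integrable fun x => ‖mollify j h x - h x‖ := ((integrable_mollify j hhi).sub hhi).norm
  have hi3 : Integrable fun x => ‖g x - h x‖ := (hg.sub hhi).norm
  have h3 : ∫ x, ‖mollify j g x - g x‖ ≤
      ∫ x, (‖mollify j (g - h) x‖ + ‖mollify j h x - h x‖ + ‖g x - h x‖) := by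
    refine integral_mono ((integrable_mollify j hg).sub hg).norm ((hi1.add hi2).add hi3) fun x => ?_
    rw [mollify_sub j hg.locallyIntegrable hhi.locallyIntegrable]
    have : mollify j g x - g x = (mollify j g x - mollify j h x) + (mollify j h x - h x)
      - (g x - h x) := by abel
    dsimp only
    rw [this]
    exact (norm_sub_le _ _).trans (by gcongr; exact norm_add_le _ _)
  have h5 := integral_add (hi1.add hi2) hi3
  have h6 := integral_add hi1 hi2
  simp only [Pi.add_apply] at h5
  rw [h5, h6] at h3
  rw [Real.dist_0_eq_abs, abs_of_nonneg (integral_nonneg fun _ => norm_nonneg _)]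
  have h4 : V * η ≤ ε / 4 := by
    rw [hη]; field_simp; nlinarith
  linarith

end Mollify

/-! ### Weak gradients -/

section WeakGradient

variable {n : ℕ} {Ω : Set (𝔼 n)} {v w : (𝔼 n) → ℝ} {G H : (𝔼 n) → (𝔼 n)}

/-- `G` is the weak gradient of `v` in `Ω`, both being integrable over `Ω`. -/
def HasWeakGrad (Ω : Set (𝔼 n)) (v : (𝔼 n) → ℝ) (G : (𝔼 n) → (𝔼 n)) : Prop :=
  IntegrableOn v Ω ∧ IntegrableOn G Ω ∧
    ∀ f : (𝔼 n) → ℝ, ContDiff ℝ ∞ f → HasCompactSupport f → tsupport f ⊆ Ω → ∀ h,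
      ∫ x in Ω, v x * fderiv ℝ f x h = -∫ x in Ω, f x * ⟪G x, h⟫

lemma continuous_gradient {f : (𝔼 n) → ℝ} (hf : ContDiff ℝ 1 f) : Continuous (∇ f) :=
  (LinearIsometryEquiv.continuous _).comp (hf.continuous_fderiv one_ne_zero)

lemma HasCompactSupport.gradient {f : (𝔼 n) → ℝ} (hf : HasCompactSupport f) :
    HasCompactSupport (∇ f) :=
  (hf.fderiv ℝ).comp_left (map_zero (InnerProductSpace.toDual ℝ (𝔼 n)).symm)

lemma integrableOn_smul_gradient (hv : IntegrableOn v Ω) {f : (𝔼 n) → ℝ} (hf : ContDiff ℝ ∞ f)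
    (hfc : HasCompactSupport f) : IntegrableOn (fun x => v x • ∇ f x) Ω := by
  have hc := continuous_gradient (hf.of_le (by norm_cast))
  obtain ⟨C, hC⟩ := (HasCompactSupport.gradient hfc).exists_bound_of_continuous hc
  exact hv.smul_bdd C hc.aestronglyMeasurable (Eventually.of_forall hC)

lemma integrableOn_smul_of_test (hG : IntegrableOn G Ω) {f : (𝔼 n) → ℝ} (hf : Continuous f)
    (hfc : HasCompactSupport f) : IntegrableOn (fun x => f x • G x) Ω := by
  obtain ⟨C, hC⟩ := hfc.exists_bound_of_continuous hf
  exact hG.bdd_smul C hf.aestronglyMeasurable (Eventually.of_forall hC)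

/-- Pairing with an arbitrary fixed vector turns the vector identity into a family of scalar ones;
the scalar form is the one that is convenient for integration by parts. -/
lemma HasWeakGrad.isWeakGradient (h : HasWeakGrad Ω v G) : IsWeakGradient Ω v G := by
  refine ⟨h.1.locallyIntegrableOn, h.2.1.locallyIntegrableOn, fun f hf hfc hfs => ?_⟩
  refine ext_inner_left ℝ fun y => ?_
  rw [inner_neg_right, ← integral_inner (integrableOn_smul_gradient h.1 hf hfc),
    ← integral_inner (integrableOn_smul_of_test h.2.1 hf.continuous hfc)]
  have := h.2.2 f hf hfc hfs y
  simpa only [real_inner_comm _ y, real_inner_smul_left, inner_gradient_left] using this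

lemma IsWeakGradient.hasWeakGrad (h : IsWeakGradient Ω v G) (hv : IntegrableOn v Ω)
    (hG : IntegrableOn G Ω) : HasWeakGrad Ω v G := by
  refine ⟨hv, hG, fun f hf hfc hfs y => ?_⟩
  have := congrArg (fun z => ⟪y, z⟫) (h.2.2 f hf hfc hfs)
  rw [inner_neg_right, ← integral_inner (integrableOn_smul_gradient hv hf hfc),
    ← integral_inner (integrableOn_smul_of_test hG hf.continuous hfc)] at this
  simpa only [real_inner_comm _ y, real_inner_smul_left, inner_gradient_left] using this

lemma isFiniteMeasure_restrict (hb : Bornology.IsBounded Ω) :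
    IsFiniteMeasure (volume.restrict Ω) :=
  ⟨by rw [Measure.restrict_apply_univ]; exact hb.measure_lt_top⟩

lemma IsSobolevPair.hasWeakGrad (hb : Bornology.IsBounded Ω) {p : ℝ} (hp : 1 ≤ p)
    (h : IsSobolevPair Ω p v G) : HasWeakGrad Ω v G := by
  have := isFiniteMeasure_restrict hb
  have hp' : 1 ≤ ENNReal.ofReal p := by simpa using hp
  exact h.2.2.hasWeakGrad (h.1.integrable hp') (h.2.1.integrable hp')

lemma HasWeakGrad.congr (h : HasWeakGrad Ω v G) (hvw : v =ᵐ[volume.restrict Ω] w)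
    (hGH : G =ᵐ[volume.restrict Ω] H) : HasWeakGrad Ω w H := by
  refine ⟨h.1.congr hvw, h.2.1.congr hGH, fun f hf hfc hfs y => ?_⟩
  have h1 : (fun x => v x * fderiv ℝ f x y) =ᵐ[volume.restrict Ω] fun x => w x * fderiv ℝ f x y :=
    hvw.mono fun x hx => by simp only [hx]
  have h2 : (fun x => f x * ⟪G x, y⟫) =ᵐ[volume.restrict Ω] fun x => f x * ⟪H x, y⟫ :=
    hGH.mono fun x hx => by simp only [hx]
  rw [← integral_congr_ae h1, ← integral_congr_ae h2]
  exact h.2.2 f hf hfc hfs y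

lemma integrableOn_mul_fderiv (hv : IntegrableOn v Ω) {f : (𝔼 n) → ℝ} (hf : ContDiff ℝ ∞ f)
    (hfc : HasCompactSupport f) (y : 𝔼 n) :
    IntegrableOn (fun x => v x * fderiv ℝ f x y) Ω := by
  have := (integrableOn_smul_gradient hv hf hfc).inner_const (𝕜 := ℝ) y
  simpa only [IntegrableOn, real_inner_smul_left, inner_gradient_left] using this

lemma integrableOn_mul_inner (hG : IntegrableOn G Ω) {f : (𝔼 n) → ℝ} (hf : Continuous f)
    (hfc : HasCompactSupport f) (y : 𝔼 n) :
    IntegrableOn (fun x => f x * ⟪G x, y⟫) Ω := by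
  have := (integrableOn_smul_of_test hG hf hfc).inner_const (𝕜 := ℝ) y
  simpa only [IntegrableOn, real_inner_smul_left] using this

lemma HasWeakGrad.add (hv : HasWeakGrad Ω v G) (hw : HasWeakGrad Ω w H) :
    HasWeakGrad Ω (fun x => v x + w x) (fun x => G x + H x) := by
  refine ⟨hv.1.add hw.1, hv.2.1.add hw.2.1, fun f hf hfc hfs y => ?_⟩
  simp only [add_mul, inner_add_left, mul_add]
  rw [integral_add (integrableOn_mul_fderiv hv.1 hf hfc y) (integrableOn_mul_fderiv hw.1 hf hfc y),
    integral_add (integrableOn_mul_inner hv.2.1 hf.continuous hfc y)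
      (integrableOn_mul_inner hw.2.1 hf.continuous hfc y),
    hv.2.2 f hf hfc hfs y, hw.2.2 f hf hfc hfs y]
  ring

lemma HasWeakGrad.neg (hv : HasWeakGrad Ω v G) :
    HasWeakGrad Ω (fun x => -v x) (fun x => -G x) := by
  refine ⟨hv.1.neg, hv.2.1.neg, fun f hf hfc hfs y => ?_⟩
  simp only [neg_mul, inner_neg_left, mul_neg, integral_neg]
  rw [hv.2.2 f hf hfc hfs y]

lemma differentiable_mol (n j : ℕ) : Differentiable ℝ (mol n j) :=
  (contDiff_mol n j).differentiable (by simp)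

lemma hasFDerivAt_mol_sub (j : ℕ) (x t : 𝔼 n) :
    HasFDerivAt (fun t => mol n j (x - t)) (-fderiv ℝ (mol n j) (x - t)) t := by
  refine ((differentiable_mol n j (x - t)).hasFDerivAt.comp t
    ((hasFDerivAt_id t).const_sub x)).congr_fderiv ?_
  ext y
  simp

lemma contDiff_mol_sub (j : ℕ) (x : 𝔼 n) : ContDiff ℝ ∞ (fun t => mol n j (x - t)) :=
  (contDiff_mol n j).comp (contDiff_const.sub contDiff_id)

lemma tsupport_mol_sub (j : ℕ) (x : 𝔼 n) :
    tsupport (fun t => mol n j (x - t)) ⊆ Metric.closedBall x (1 / (j + 1)) := by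
  refine closure_minimal (fun t ht => ?_) Metric.isClosed_closedBall
  by_contra h
  rw [Metric.mem_closedBall, not_le, dist_comm, dist_eq_norm] at h
  exact ht (mol_eq_zero h.le)

lemma hasCompactSupport_mol_sub (j : ℕ) (x : 𝔼 n) :
    HasCompactSupport (fun t => mol n j (x - t)) :=
  (isCompact_closedBall x (1 / ((j : ℝ) + 1))).of_isClosed_subset isClosed_closure
    (tsupport_mol_sub j x)

lemma integrable_mollify_integrand {F : Type*} [NormedAddCommGroup F] [NormedSpace ℝ F] (j : ℕ)
    {g : (𝔼 n) → F} (hg : LocallyIntegrable g) (x : 𝔼 n) :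
    Integrable (fun t => mol n j (x - t) • g t) :=
  ((hasCompactSupport_mol n j).convolutionExists_left (ContinuousLinearMap.lsmul ℝ ℝ)
      (contDiff_mol n j).continuous hg x).integrable_swap

/-- Away from the boundary, mollification commutes with weak differentiation. -/
lemma HasWeakGrad.fderiv_mollify (hΩ : MeasurableSet Ω) (hv : HasWeakGrad Ω v G) {j : ℕ} {x : 𝔼 n}
    (hx : Metric.closedBall x (1 / ((j : ℝ) + 1)) ⊆ Ω) (h : 𝔼 n) :
    fderiv ℝ (mollify j (Ω.indicator v)) x h = ⟪mollify j (Ω.indicator G) x, h⟫ := by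
  have hvi : Integrable (Ω.indicator v) := hv.1.integrable_indicator hΩ
  have hGi : Integrable (Ω.indicator G) := hv.2.1.integrable_indicator hΩ
  rw [fderiv_mollify_apply j hvi.locallyIntegrable, mollify_apply_swap, real_inner_comm,
    ← integral_inner (integrable_mollify_integrand j hGi.locallyIntegrable x)]
  have key := hv.2.2 _ (contDiff_mol_sub j x) (hasCompactSupport_mol_sub j x)
    ((tsupport_mol_sub j x).trans hx) h
  rw [← integral_indicator hΩ, ← integral_indicator hΩ] at key
  have e1 : (fun t => fderiv ℝ (mol n j) (x - t) h * Ω.indicator v t) = fun t =>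
      -Ω.indicator (fun t => v t * fderiv ℝ (fun t => mol n j (x - t)) t h) t := by
    ext t
    by_cases ht : t ∈ Ω
    · simp only [indicator_of_mem ht, (hasFDerivAt_mol_sub j x t).fderiv]
      simp [mul_comm]
    · simp [ht]
  have e2 : (fun t => ⟪h, mol n j (x - t) • Ω.indicator G t⟫) =
      Ω.indicator (fun t => mol n j (x - t) * ⟪G t, h⟫) := by
    ext t
    by_cases ht : t ∈ Ω
    · simp only [indicator_of_mem ht, inner_smul_right, real_inner_comm]
    · simp [ht]
  rw [e1, e2, integral_neg, key, neg_neg]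

/-- Integration by parts is valid between two Lipschitz functions, one of compact support; it moves
the derivative from the kernel onto `f`. -/
lemma fderiv_mollify_of_lipschitz {f : (𝔼 n) → ℝ} {C : ℝ≥0} (hf : LipschitzWith C f) (j : ℕ)
    (x h : 𝔼 n) :
    fderiv ℝ (mollify j f) x h = mollify j (fun y => lineDeriv ℝ f y h) x := by
  rw [fderiv_mollify_apply j hf.continuous.locallyIntegrable, mollify_apply_swap]
  obtain ⟨D, hD⟩ := ((contDiff_mol_sub j x).of_le (by norm_cast)).lipschitzWith_of_hasCompactSupport
    (hasCompactSupport_mol_sub j x) one_ne_zero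
  have := hf.integral_lineDeriv_mul_eq (μ := volume) hD (hasCompactSupport_mol_sub j x) h
  simp only [smul_eq_mul]
  simp_rw [mul_comm (mol n j _)]
  rw [this]
  congr 1 with t
  rw [(hasFDerivAt_mol_sub j x t).differentiableAt.lineDeriv_eq_fderiv,
    (hasFDerivAt_mol_sub j x t).fderiv]
  simp

lemma tsupport_mollify_subset (j : ℕ) (f : (𝔼 n) → ℝ) :
    tsupport (mollify j f) ⊆ Metric.cthickening (1 / ((j : ℝ) + 1)) (tsupport f) := by
  refine closure_minimal (fun x hx => ?_) Metric.isClosed_cthickening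
  by_contra hne
  apply hx
  rw [mollify_apply_swap]
  refine integral_eq_zero_of_ae (Eventually.of_forall fun t => ?_)
  by_cases ht : t ∈ tsupport f
  · have : 1 / ((j : ℝ) + 1) ≤ ‖x - t‖ := by
      by_contra hlt
      exact hne (Metric.mem_cthickening_of_dist_le x t _ _ ht
        (by rw [dist_eq_norm]; exact (not_le.1 hlt).le))
    simp [mol_eq_zero this]
  · simp [image_eq_zero_of_notMem_tsupport ht]

lemma exists_mollify_radius_lt {δ : ℝ} (hδ : 0 < δ) : ∀ᶠ j : ℕ in atTop, 1 / ((j : ℝ) + 1) < δ :=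
  (tendsto_order.1 tendsto_one_div_add_atTop_nhds_zero_nat).2 δ hδ

lemma norm_mollify_le_const {g : (𝔼 n) → ℝ} {M : ℝ} (hgM : ∀ x, ‖g x‖ ≤ M) (j : ℕ) (x : 𝔼 n) :
    ‖mollify j g x‖ ≤ M := by
  rw [mollify_apply_swap]
  have h1 : ∫ t, mol n j (x - t) * M = M := by
    rw [integral_mul_const, integral_sub_left_eq_self (mol n j), integral_mol, one_mul]
  rw [← h1]
  refine norm_integral_le_of_norm_le (((integrable_mol n j).comp_sub_left x).mul_const M)
    (Eventually.of_forall fun t => ?_)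
  rw [norm_smul, Real.norm_of_nonneg (mol_nonneg _ _)]
  exact mul_le_mul_of_nonneg_left (hgM t) (mol_nonneg _ _)

/-- A weak gradient may be tested against Lipschitz functions. -/
lemma HasWeakGrad.integral_mul_lineDeriv (hΩ : IsOpen Ω) (hv : HasWeakGrad Ω v G) {f : (𝔼 n) → ℝ}
    {C : ℝ≥0} (hf : LipschitzWith C f) (hfc : HasCompactSupport f) (hfs : tsupport f ⊆ Ω)
    (h : 𝔼 n) :
    ∫ x in Ω, v x * lineDeriv ℝ f x h = -∫ x in Ω, f x * ⟪G x, h⟫ := by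
  obtain ⟨δ, hδ, hδΩ⟩ := hfc.isCompact.exists_cthickening_subset_open hΩ hfs
  have hfl : LocallyIntegrable f := hf.continuous.locallyIntegrable
  have hdl : LocallyIntegrable (fun y => lineDeriv ℝ f y h) := hf.locallyIntegrable_lineDeriv h
  -- Once the radius is below `δ`, the mollified `f` is an admissible smooth test function.
  have hev : ∀ᶠ j : ℕ in atTop,
      ∫ x in Ω, v x * mollify j (fun y => lineDeriv ℝ f y h) x =
        -∫ x in Ω, mollify j f x * ⟪G x, h⟫ := by
    filter_upwards [exists_mollify_radius_lt hδ] with j hj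
    have hs : tsupport (mollify j f) ⊆ Metric.cthickening δ (tsupport f) :=
      (tsupport_mollify_subset j f).trans (Metric.cthickening_mono hj.le _)
    have hcs : HasCompactSupport (mollify j f) :=
      hfc.isCompact.cthickening.of_isClosed_subset isClosed_closure hs
    rw [← hv.2.2 _ (contDiff_mollify j hfl) hcs (hs.trans hδΩ) h]
    simp only [fderiv_mollify_of_lipschitz hf]
  obtain ⟨M, hM⟩ := hfc.exists_bound_of_continuous hf.continuous
  -- The mollified line derivatives are bounded by `C ‖h‖` uniformly in `j`, so a multiple of `|v|`
  -- dominates.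
  have hL : Tendsto (fun j => ∫ x in Ω, v x * mollify j (fun y => lineDeriv ℝ f y h) x) atTop
      (𝓝 (∫ x in Ω, v x * lineDeriv ℝ f x h)) := by
    refine tendsto_integral_of_dominated_convergence (fun x => ‖v x‖ * (C * ‖h‖)) (fun j => ?_)
      (hv.1.norm.mul_const _) (fun j => Eventually.of_forall fun x => ?_) ?_
    · exact hv.1.aestronglyMeasurable.mul
        (contDiff_mollify j hdl).continuous.aestronglyMeasurable
    · rw [norm_mul]
      exact mul_le_mul_of_nonneg_left
        (norm_mollify_le_const (fun y => norm_lineDeriv_le_of_lipschitz ℝ hf) j x) (norm_nonneg _)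
    · filter_upwards [ae_restrict_of_ae (ae_tendsto_mollify hdl)] with x hx
      exact hx.const_mul _
  have hR : Tendsto (fun j => -∫ x in Ω, mollify j f x * ⟪G x, h⟫) atTop
      (𝓝 (-∫ x in Ω, f x * ⟪G x, h⟫)) := by
    refine (tendsto_integral_of_dominated_convergence (fun x => M * ‖⟪G x, h⟫‖) (fun j => ?_)
      ((hv.2.1.inner_const h).norm.const_mul _) (fun j => Eventually.of_forall fun x => ?_) ?_).neg
    · exact (contDiff_mollify j hfl).continuous.aestronglyMeasurable.mul
        (hv.2.1.inner_const h).aestronglyMeasurable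
    · rw [norm_mul]
      exact mul_le_mul_of_nonneg_right (norm_mollify_le_const hM j x) (norm_nonneg _)
    · filter_upwards [ae_restrict_of_ae (ae_tendsto_mollify hfl)] with x hx
      exact hx.mul_const _
  exact tendsto_nhds_unique_of_eventuallyEq hL hR hev

end WeakGradient

/-! ### Chain rule for the positive part; weak gradients of locally Lipschitz functions -/

section Calculus

variable {n : ℕ} {Ω : Set (𝔼 n)} {v w : (𝔼 n) → ℝ} {G H : (𝔼 n) → (𝔼 n)}

/-- Split `b j * a j` into `b j * a'`, handled by dominated convergence, and `b j * (a j - a')`,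
which is small in `L¹` since the `b j` are uniformly bounded. -/
lemma tendsto_integral_mul_of_tendsto_L1 {a b : ℕ → (𝔼 n) → ℝ} {a' b' : (𝔼 n) → ℝ} {C : ℝ}
    (ha : ∀ j, Integrable (a j)) (ha' : Integrable a')
    (hb : ∀ j, AEStronglyMeasurable (b j) volume) (hbC : ∀ j x, ‖b j x‖ ≤ C)
    (hbb : ∀ᵐ x, a' x ≠ 0 → Tendsto (fun j => b j x) atTop (𝓝 (b' x)))
    (haa : Tendsto (fun j => ∫ x, ‖a j x - a' x‖) atTop (𝓝 0)) :
    Tendsto (fun j => ∫ x, b j x * a j x) atTop (𝓝 (∫ x, b' x * a' x)) := by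
  have h1 : Tendsto (fun j => ∫ x, b j x * a' x) atTop (𝓝 (∫ x, b' x * a' x)) := by
    refine tendsto_integral_of_dominated_convergence (fun x => C * ‖a' x‖)
      (fun j => (hb j).mul ha'.aestronglyMeasurable) (ha'.norm.const_mul C)
      (fun j => Eventually.of_forall fun x => ?_) ?_
    · rw [norm_mul]
      exact mul_le_mul_of_nonneg_right (hbC j x) (norm_nonneg _)
    · filter_upwards [hbb] with x hx
      by_cases h0 : a' x = 0
      · simp [h0]
      · exact (hx h0).mul_const _
  have h2 : Tendsto (fun j => ∫ x, b j x * (a j x - a' x)) atTop (𝓝 0) := by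
    refine squeeze_zero_norm (a := fun j => C * ∫ x, ‖a j x - a' x‖) (fun j => ?_)
      (by simpa using haa.const_mul C)
    rw [← integral_const_mul]
    refine norm_integral_le_of_norm_le (((ha j).sub ha').norm.const_mul C)
      (Eventually.of_forall fun x => ?_)
    rw [norm_mul]
    exact mul_le_mul_of_nonneg_right (hbC j x) (norm_nonneg _)
  have h3 := h1.add h2
  rw [add_zero] at h3
  refine h3.congr fun j => ?_
  rw [← integral_add]
  · congr 1 with x; ring
  · exact ha'.bdd_mul (hb j) (Eventually.of_forall (hbC j))
  · exact ((ha j).sub ha').bdd_mul (hb j) (Eventually.of_forall (hbC j))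

lemma hasDerivAt_sq_max_zero (s : ℝ) : HasDerivAt (fun s : ℝ => max s 0 ^ 2) (2 * max s 0) s := by
  rcases lt_trichotomy s 0 with hs | rfl | hs
  · have : (fun s : ℝ => max s 0 ^ 2) =ᶠ[𝓝 s] fun _ => 0 := by
      filter_upwards [Iio_mem_nhds hs] with t ht
      rw [max_eq_right (le_of_lt ht)]; norm_num
    rw [max_eq_right hs.le, mul_zero]
    exact (hasDerivAt_const s (0 : ℝ)).congr_of_eventuallyEq this
  · rw [max_self, mul_zero, hasDerivAt_iff_isLittleO_nhds_zero]
    have h1 : (fun h : ℝ => max (0 + h) 0 ^ 2 - max 0 0 ^ 2 - h • (0 : ℝ)) =O[𝓝 0]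
        fun h => h ^ 2 := by
      refine Asymptotics.IsBigO.of_bound 1 (Eventually.of_forall fun h => ?_)
      simp only [zero_add, max_self, smul_zero, sub_zero, one_mul, norm_pow, Real.norm_eq_abs]
      rcases le_total h 0 with h0 | h0 <;> simp [h0, sq_nonneg]
    exact h1.trans_isLittleO (by simpa using Asymptotics.isLittleO_pow_id one_lt_two)
  · have : (fun s : ℝ => max s 0 ^ 2) =ᶠ[𝓝 s] fun s => s ^ 2 := by
      filter_upwards [Ioi_mem_nhds hs] with t ht
      rw [max_eq_left (le_of_lt ht)]
    rw [max_eq_left hs.le]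
    simpa using (hasDerivAt_pow 2 s).congr_of_eventuallyEq this

/-- A `C¹` approximation of the positive part. -/
def posApprox (ε s : ℝ) : ℝ := √(ε ^ 2 + max s 0 ^ 2) - ε

/-- The derivative of `posApprox`. -/
def posApproxDeriv (ε s : ℝ) : ℝ := max s 0 / √(ε ^ 2 + max s 0 ^ 2)

lemma sqrt_posApprox_pos {ε : ℝ} (hε : 0 < ε) (s : ℝ) : 0 < √(ε ^ 2 + max s 0 ^ 2) :=
  Real.sqrt_pos.2 (by positivity)

lemma hasDerivAt_posApprox {ε : ℝ} (hε : 0 < ε) (s : ℝ) :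
    HasDerivAt (posApprox ε) (posApproxDeriv ε s) s := by
  have h1 := (((hasDerivAt_sq_max_zero s).const_add (ε ^ 2)).sqrt (by positivity)).sub_const ε
  refine h1.congr_deriv ?_
  have := sqrt_posApprox_pos hε s
  rw [posApproxDeriv]
  field_simp

lemma continuous_posApproxDeriv {ε : ℝ} (hε : 0 < ε) : Continuous (posApproxDeriv ε) := by
  unfold posApproxDeriv
  exact (continuous_id.max continuous_const).div
    (by fun_prop) fun s => (sqrt_posApprox_pos hε s).ne'

lemma posApproxDeriv_nonneg (ε s : ℝ) : 0 ≤ posApproxDeriv ε s :=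
  div_nonneg (le_max_right _ _) (Real.sqrt_nonneg _)

lemma norm_posApproxDeriv_le {ε : ℝ} (hε : 0 < ε) (s : ℝ) : ‖posApproxDeriv ε s‖ ≤ 1 := by
  rw [Real.norm_of_nonneg (posApproxDeriv_nonneg _ _), posApproxDeriv,
    div_le_one (sqrt_posApprox_pos hε s)]
  exact Real.le_sqrt_of_sq_le (by nlinarith)

lemma abs_posApprox_sub_le {ε : ℝ} (hε : 0 < ε) (s t : ℝ) :
    |posApprox ε s - posApprox ε t| ≤ |s - t| := by
  have := convex_univ.norm_image_sub_le_of_norm_hasDerivWithin_le (C := 1)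
    (fun x _ => (hasDerivAt_posApprox hε x).hasDerivWithinAt)
    (fun x _ => norm_posApproxDeriv_le hε x) (mem_univ t) (mem_univ s)
  simpa using this

lemma continuous_posApprox {ε : ℝ} (hε : 0 < ε) : Continuous (posApprox ε) :=
  continuous_iff_continuousAt.2 fun s => (hasDerivAt_posApprox hε s).continuousAt

lemma tendsto_posApprox (s : ℝ) :
    Tendsto (fun j : ℕ => posApprox (1 / ((j : ℝ) + 1)) s) atTop (𝓝 (max s 0)) := by
  have h := tendsto_one_div_add_atTop_nhds_zero_nat (𝕜 := ℝ)
  have hc : Continuous fun ε : ℝ => posApprox ε s := by unfold posApprox; fun_prop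
  have := (hc.tendsto 0).comp h
  simpa [posApprox, Real.sqrt_sq (le_max_right s 0), Function.comp_def] using this

/-- The limit at `s = 0` is 0, which is why the gradient of a positive part is cut off to the strict
set `{0 < w}`. -/
lemma tendsto_posApproxDeriv (s : ℝ) :
    Tendsto (fun j : ℕ => posApproxDeriv (1 / ((j : ℝ) + 1)) s) atTop
      (𝓝 (if 0 < s then 1 else 0)) := by
  split_ifs with hs
  · have h := tendsto_one_div_add_atTop_nhds_zero_nat (𝕜 := ℝ)
    have hc : ContinuousAt (fun ε : ℝ => posApproxDeriv ε s) 0 := by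
      unfold posApproxDeriv
      refine ContinuousAt.div (by fun_prop) (by fun_prop) ?_
      rw [max_eq_left hs.le]
      simp [Real.sqrt_sq hs.le, hs.ne']
    have := hc.tendsto.comp h
    simpa [posApproxDeriv, max_eq_left hs.le, Real.sqrt_sq hs.le, hs.ne', Function.comp_def]
      using this
  · simp [posApproxDeriv, max_eq_right (not_lt.1 hs)]

lemma abs_posApprox_le {ε : ℝ} (hε : 0 < ε) (s : ℝ) : |posApprox ε s| ≤ |s| := by
  have := abs_posApprox_sub_le hε s 0
  simpa [posApprox, Real.sqrt_sq hε.le] using this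

/-- The chain rule for the `C¹` functions `posApprox`. -/
lemma HasWeakGrad.posApprox_comp (hΩ : IsOpen Ω) (hw : HasWeakGrad Ω w G) {ε : ℝ} (hε : 0 < ε)
    {f : (𝔼 n) → ℝ} (hf : ContDiff ℝ ∞ f) (hfc : HasCompactSupport f) (hfs : tsupport f ⊆ Ω)
    (h : 𝔼 n) :
    ∫ x in Ω, posApprox ε (w x) * fderiv ℝ f x h =
      -∫ x in Ω, f x * posApproxDeriv ε (w x) * ⟪G x, h⟫ := by
  have hΩm := hΩ.measurableSet
  have hwi : Integrable (Ω.indicator w) := hw.1.integrable_indicator hΩm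
  have hGi : Integrable (Ω.indicator G) := hw.2.1.integrable_indicator hΩm
  set g := Ω.indicator w with hg
  set γ := Ω.indicator G with hγ
  obtain ⟨δ, hδ, hδΩ⟩ := hfc.isCompact.exists_cthickening_subset_open hΩ hfs
  have hsm : ∀ j, ContDiff ℝ ∞ (mollify j g) := fun j => contDiff_mollify j hwi.locallyIntegrable
  have hcf' : Continuous fun x => fderiv ℝ f x h :=
    (hf.continuous_fderiv (by simp)).clm_apply continuous_const
  have hcsf' : HasCompactSupport fun x => fderiv ℝ f x h := hfc.fderiv_apply ℝ h
  have hdiff : ∀ j x, HasFDerivAt (fun x => posApprox ε (mollify j g x))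
      (posApproxDeriv ε (mollify j g x) • fderiv ℝ (mollify j g) x) x := fun j x =>
    (hasDerivAt_posApprox hε _).comp_hasFDerivAt x
      ((hsm j).differentiable (by simp) x).hasFDerivAt
  -- For the smooth mollifications this is classical integration by parts, and over the support of
  -- `f` their derivative is given by the mollified weak gradient.
  have hev : ∀ᶠ j : ℕ in atTop,
      ∫ x, fderiv ℝ f x h * posApprox ε (mollify j g x) =
        -∫ x, f x * posApproxDeriv ε (mollify j g x) * ⟪mollify j γ x, h⟫ := by
    filter_upwards [exists_mollify_radius_lt hδ] with j hj
    have hc1 : Continuous fun x => posApprox ε (mollify j g x) :=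
      (continuous_posApprox hε).comp (hsm j).continuous
    have hc2 : Continuous fun x => posApproxDeriv ε (mollify j g x) * fderiv ℝ (mollify j g) x h :=
      ((continuous_posApproxDeriv hε).comp (hsm j).continuous).mul
        (((hsm j).continuous_fderiv (by simp)).clm_apply continuous_const)
    have hfd : ∀ x, fderiv ℝ (fun x => posApprox ε (mollify j g x)) x h =
        posApproxDeriv ε (mollify j g x) * fderiv ℝ (mollify j g) x h := fun x => by
      rw [(hdiff j x).fderiv]; simp
    have := integral_mul_fderiv_eq_neg_fderiv_mul_of_integrable (μ := volume) (v := h)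
      (f := fun x => posApprox ε (mollify j g x)) (g := f) ?_ ?_ ?_
      (fun x _ => (hdiff j x).differentiableAt) (fun x _ => hf.differentiable (by simp) x)
    · simp only [hfd] at this
      simp_rw [mul_comm (fderiv ℝ f _ h)]
      rw [this]
      congr 2 with x
      by_cases hx : x ∈ tsupport f
      · have hxb : Metric.closedBall x (1 / ((j : ℝ) + 1)) ⊆ Ω := by
          refine (fun y hy => hδΩ ?_)
          exact Metric.mem_cthickening_of_dist_le y x δ _ hx
            ((Metric.mem_closedBall.1 hy).trans hj.le)
        rw [hw.fderiv_mollify hΩm hxb]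
        ring
      · simp [image_eq_zero_of_notMem_tsupport hx]
    · simp only [hfd]
      exact (hc2.mul hf.continuous).integrable_of_hasCompactSupport hfc.mul_left
    · exact (hc1.mul hcf').integrable_of_hasCompactSupport hcsf'.mul_left
    · exact (hc1.mul hf.continuous).integrable_of_hasCompactSupport hfc.mul_left
  obtain ⟨C, hC⟩ := hcsf'.exists_bound_of_continuous hcf'
  obtain ⟨M, hM⟩ := hfc.exists_bound_of_continuous hf.continuous
  have hpi : ∀ {u : (𝔼 n) → ℝ}, Integrable u → Integrable fun x => posApprox ε (u x) := fun hu =>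
    hu.norm.mono' ((continuous_posApprox hε).comp_aestronglyMeasurable hu.aestronglyMeasurable)
      (Eventually.of_forall fun x => abs_posApprox_le hε _)
  have hL : Tendsto (fun j => ∫ x, fderiv ℝ f x h * posApprox ε (mollify j g x)) atTop
      (𝓝 (∫ x, fderiv ℝ f x h * posApprox ε (g x))) := by
    refine tendsto_integral_mul_of_tendsto_L1 (C := C)
      (fun j => hpi (integrable_mollify j hwi)) (hpi hwi)
      (fun _ => hcf'.aestronglyMeasurable) (fun _ => hC)
      (Eventually.of_forall fun x _ => tendsto_const_nhds) ?_
    refine squeeze_zero (fun j => integral_nonneg fun x => norm_nonneg _) (fun j => ?_)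
      (tendsto_integral_norm_mollify_sub hwi)
    exact integral_mono ((hpi (integrable_mollify j hwi)).sub (hpi hwi)).norm
      ((integrable_mollify j hwi).sub hwi).norm fun x => abs_posApprox_sub_le hε _ _
  -- The factor `f * posApproxDeriv` is bounded and converges almost everywhere, while the mollified
  -- gradients converge only in `L¹`.
  have hR : Tendsto (fun j => -∫ x, f x * posApproxDeriv ε (mollify j g x) * ⟪mollify j γ x, h⟫)
      atTop (𝓝 (-∫ x, f x * posApproxDeriv ε (g x) * ⟪γ x, h⟫)) := by
    have hM0 : 0 ≤ M := (norm_nonneg _).trans (hM 0)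
    refine (tendsto_integral_mul_of_tendsto_L1 (C := M)
      (fun j => (integrable_mollify j hGi).inner_const (𝕜 := ℝ) h) (hGi.inner_const (𝕜 := ℝ) h)
      (fun j => (hf.continuous.mul ((continuous_posApproxDeriv hε).comp
        (hsm j).continuous)).aestronglyMeasurable) (fun j x => ?_) ?_ ?_).neg
    · rw [Pi.mul_apply, norm_mul]
      exact (mul_le_mul (hM x) (norm_posApproxDeriv_le hε _) (norm_nonneg _) hM0).trans_eq
        (mul_one M)
    · filter_upwards [ae_tendsto_mollify hwi.locallyIntegrable] with x hx _
      exact (((continuous_posApproxDeriv hε).tendsto _).comp hx).const_mul _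
    · refine squeeze_zero (fun j => integral_nonneg fun x => norm_nonneg _) (fun j => ?_)
        (by simpa using (tendsto_integral_norm_mollify_sub hGi).const_mul ‖h‖)
      rw [← integral_const_mul]
      refine integral_mono (((integrable_mollify j hGi).inner_const (𝕜 := ℝ) h).sub
        (hGi.inner_const (𝕜 := ℝ) h)).norm
        (((integrable_mollify j hGi).sub hGi).norm.const_mul _) fun x => ?_
      simp only [← inner_sub_left]
      rw [mul_comm]
      exact norm_inner_le_norm _ _
  have := tendsto_nhds_unique_of_eventuallyEq hL hR hev
  rw [← integral_indicator hΩm, ← integral_indicator hΩm]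
  have e1 : Ω.indicator (fun x => posApprox ε (w x) * fderiv ℝ f x h) =
      fun x => fderiv ℝ f x h * posApprox ε (g x) := by
    ext x
    by_cases hx : x ∈ Ω
    · simp only [indicator_of_mem hx, hg, mul_comm]
    · simp [hx, hg, posApprox, Real.sqrt_sq hε.le]
  have e2 : Ω.indicator (fun x => f x * posApproxDeriv ε (w x) * ⟪G x, h⟫) =
      fun x => f x * posApproxDeriv ε (g x) * ⟪γ x, h⟫ := by
    ext x
    by_cases hx : x ∈ Ω
    · simp only [indicator_of_mem hx, hg, hγ]
    · simp [hx, hγ]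
  rw [e1, e2, this]

/-- The weak gradient of the positive part. -/
lemma HasWeakGrad.posPart (hΩ : IsOpen Ω) (hw : HasWeakGrad Ω w G) :
    HasWeakGrad Ω (fun x => max (w x) 0) ({x | 0 < w x}.indicator G) := by
  have hm : NullMeasurableSet {x | 0 < w x} (volume.restrict Ω) :=
    nullMeasurableSet_lt aemeasurable_const hw.1.aestronglyMeasurable.aemeasurable
  refine ⟨hw.1.pos_part, hw.2.1.indicator₀ hm, fun f hf hfc hfs h => ?_⟩
  have hcf' : Continuous fun x => fderiv ℝ f x h :=
    (hf.continuous_fderiv (by simp)).clm_apply continuous_const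
  have hcsf' : HasCompactSupport fun x => fderiv ℝ f x h := hfc.fderiv_apply ℝ h
  obtain ⟨C, hC⟩ := hcsf'.exists_bound_of_continuous hcf'
  obtain ⟨M, hM⟩ := hfc.exists_bound_of_continuous hf.continuous
  have hε : ∀ j : ℕ, 0 < 1 / ((j : ℝ) + 1) := fun j => by positivity
  have hM0 : 0 ≤ M := (norm_nonneg _).trans (hM 0)
  have hL : Tendsto (fun j : ℕ => ∫ x in Ω, posApprox (1 / ((j : ℝ) + 1)) (w x) * fderiv ℝ f x h)
      atTop (𝓝 (∫ x in Ω, max (w x) 0 * fderiv ℝ f x h)) := by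
    refine tendsto_integral_of_dominated_convergence (fun x => ‖w x‖ * C) (fun j => ?_)
      (hw.1.norm.mul_const C) (fun j => Eventually.of_forall fun x => ?_)
      (Eventually.of_forall fun x => (tendsto_posApprox _).mul_const _)
    · exact ((continuous_posApprox (hε j)).comp_aestronglyMeasurable
        hw.1.aestronglyMeasurable).mul hcf'.aestronglyMeasurable
    · rw [norm_mul]
      exact mul_le_mul (abs_posApprox_le (hε j) _) (hC x) (norm_nonneg _) (norm_nonneg _)
  have hR : Tendsto (fun j : ℕ => -∫ x in Ω, f x * posApproxDeriv (1 / ((j : ℝ) + 1)) (w x) *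
      ⟪G x, h⟫) atTop (𝓝 (-∫ x in Ω, f x * ⟪{x | 0 < w x}.indicator G x, h⟫)) := by
    refine (tendsto_integral_of_dominated_convergence (fun x => M * ‖⟪G x, h⟫‖) (fun j => ?_)
      ((hw.2.1.inner_const h).norm.const_mul _) (fun j => Eventually.of_forall fun x => ?_)
      (Eventually.of_forall fun x => ?_)).neg
    · exact (hf.continuous.aestronglyMeasurable.mul
        ((continuous_posApproxDeriv (hε j)).comp_aestronglyMeasurable
        hw.1.aestronglyMeasurable)).mul (hw.2.1.inner_const h).aestronglyMeasurable
    · rw [norm_mul, norm_mul]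
      refine mul_le_mul_of_nonneg_right ?_ (norm_nonneg _)
      exact (mul_le_mul (hM x) (norm_posApproxDeriv_le (hε j) _) (norm_nonneg _) hM0).trans_eq
        (mul_one M)
    · have := ((tendsto_posApproxDeriv (w x)).const_mul (f x)).mul_const ⟪G x, h⟫
      by_cases hx : 0 < w x <;> simpa [hx] using this
  exact tendsto_nhds_unique_of_eventuallyEq hL hR
    (Eventually.of_forall fun j => hw.posApprox_comp hΩ (hε j) hf hfc hfs h)

/-- On a compact neighbourhood of the support of a test function, `v` agrees with a globally
Lipschitz function, for which integration by parts holds. Working on a neighbourhood, not just on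
the support, makes the derivatives agree as well, at almost every point by Rademacher's theorem. -/
lemma hasWeakGrad_of_locallyLipschitzOn (hΩ : IsOpen Ω) (hv : LocallyLipschitzOn Ω v)
    (hvi : IntegrableOn v Ω) (hgi : IntegrableOn (∇ v) Ω) : HasWeakGrad Ω v (∇ v) := by
  refine ⟨hvi, hgi, fun f hf hfc hfs h => ?_⟩
  obtain ⟨δ, hδ, hδΩ⟩ := hfc.isCompact.exists_cthickening_subset_open hΩ hfs
  obtain ⟨K, hK⟩ := LocallyLipschitzOn.exists_lipschitzOnWith_of_compact
    (hfc.isCompact.cthickening (r := δ)) (hv.mono hδΩ)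
  obtain ⟨g, hg, hgv⟩ := hK.extend_real
  obtain ⟨D, hD⟩ := (hf.of_le (by norm_cast)).lipschitzWith_of_hasCompactSupport hfc one_ne_zero
  have key := hg.integral_lineDeriv_mul_eq (μ := volume) hD hfc h
  have hsub : tsupport f ⊆ Metric.cthickening δ (tsupport f) := Metric.self_subset_cthickening _
  have hz : ∀ x ∉ tsupport f, fderiv ℝ f x h = 0 := fun x hx => by
    rw [image_eq_zero_of_notMem_tsupport (fun h' => hx (tsupport_fderiv_subset ℝ h'))]
    simp
  have e1 : ∫ x in Ω, v x * fderiv ℝ f x h = ∫ x, g x * fderiv ℝ f x h := by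
    rw [← setIntegral_eq_integral_of_forall_compl_eq_zero (s := Ω)
      (f := fun x => g x * fderiv ℝ f x h)]
    · refine setIntegral_congr_fun hΩ.measurableSet fun x _ => ?_
      by_cases hx : x ∈ tsupport f
      · simp only [hgv (hsub hx)]
      · simp only [hz x hx, mul_zero]
    · intro x hx
      rw [hz x fun h' => hx (hfs h'), mul_zero]
  have e2 : ∫ x in Ω, f x * ⟪∇ v x, h⟫ = ∫ x, lineDeriv ℝ g x h * f x := by
    rw [← setIntegral_eq_integral_of_forall_compl_eq_zero (s := Ω)
      (f := fun x => lineDeriv ℝ g x h * f x)]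
    · refine integral_congr_ae ?_
      filter_upwards [ae_restrict_of_ae hg.ae_differentiableAt] with x hx
      by_cases hxs : x ∈ tsupport f
      · have hev : g =ᶠ[𝓝 x] v := by
          have : Metric.ball x δ ∈ 𝓝 x := Metric.ball_mem_nhds x hδ
          filter_upwards [this] with y hy
          exact (hgv (Metric.mem_cthickening_of_dist_le y x δ _ hxs
            (Metric.mem_ball.1 hy).le)).symm
        rw [hx.lineDeriv_eq_fderiv, hev.fderiv_eq, inner_gradient_left, mul_comm]
      · simp [image_eq_zero_of_notMem_tsupport hxs]
    · intro x hx
      rw [image_eq_zero_of_notMem_tsupport fun h' => hx (hfs h'), mul_zero]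
  rw [e1, e2, key, ← integral_neg]
  congr 1 with x
  rw [(hf.differentiable (by simp) x).lineDeriv_eq_fderiv]
  simp [mul_comm]

lemma hasWeakGrad_of_contDiff (hΩ : IsOpen Ω) (hb : Bornology.IsBounded Ω)
    (hv : ContDiff ℝ 1 v) : HasWeakGrad Ω v (∇ v) := by
  have hc := hb.isCompact_closure
  refine hasWeakGrad_of_locallyLipschitzOn hΩ (hv.locallyLipschitz.locallyLipschitzOn) ?_ ?_
  · exact (hv.continuous.continuousOn.integrableOn_compact hc).mono_set subset_closure
  · exact ((continuous_gradient hv).continuousOn.integrableOn_compact hc).mono_set subset_closure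

end Calculus

/-! ### Morrey's inequality -/

section Morrey

variable {n : ℕ} {Ω : Set (𝔼 n)} {v w : (𝔼 n) → ℝ} {G H : (𝔼 n) → (𝔼 n)}

/-- The volume of the unit ball. -/
def unitVol (n : ℕ) : ℝ := volume.real (Metric.ball (0 : 𝔼 n) 1)

lemma unitVol_pos (n : ℕ) : 0 < unitVol n :=
  ENNReal.toReal_pos (Metric.measure_ball_pos _ _ one_pos).ne' measure_ball_lt_top.ne

lemma volume_real_ball (a : 𝔼 n) {τ : ℝ} (hτ : 0 < τ) :
    volume.real (Metric.ball a τ) = τ ^ n * unitVol n := by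
  have h := Measure.addHaar_ball_of_pos (volume : Measure (𝔼 n)) a hτ
  rw [Measure.real, h, ENNReal.toReal_mul, ENNReal.toReal_ofReal (by positivity), unitVol,
    Measure.real, finrank_euclideanSpace_fin]

lemma setIntegral_ball_homothety (g : (𝔼 n) → ℝ) (x z : 𝔼 n) {s t : ℝ} (ht : 0 < t) :
    ∫ y in Metric.ball z s, g (x + t • (y - x)) =
      (t ^ n)⁻¹ * ∫ y in Metric.ball (x + t • (z - x)) (t * s), g y := by
  set B' := Metric.ball (x + t • (z - x)) (t * s)
  have hmem : ∀ y, x + t • (y - x) ∈ B' ↔ y ∈ Metric.ball z s := by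
    intro y
    simp only [B', Metric.mem_ball, dist_eq_norm]
    rw [add_sub_add_left_eq_sub, ← smul_sub, sub_sub_sub_cancel_right, norm_smul,
      Real.norm_of_nonneg ht.le, mul_lt_mul_iff_right₀ ht]
  rw [← integral_indicator measurableSet_ball, ← integral_indicator measurableSet_ball]
  have e : (Metric.ball z s).indicator (fun y => g (x + t • (y - x))) =
      fun y => (fun u => B'.indicator g (x + t • u)) (y - x) := by
    ext y
    by_cases hy : y ∈ Metric.ball z s
    · simp only [indicator_of_mem hy, indicator_of_mem ((hmem y).2 hy)]
    · simp only [indicator_of_notMem hy, indicator_of_notMem (fun h => hy ((hmem y).1 h))]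
  rw [e, integral_sub_right_eq_self (fun u => B'.indicator g (x + t • u)),
    Measure.integral_comp_smul volume (fun u => B'.indicator g (x + u)),
    integral_add_left_eq_self (B'.indicator g)]
  rw [finrank_euclideanSpace_fin, abs_of_pos (inv_pos.2 (pow_pos ht n)), smul_eq_mul]

lemma ball_homothety_subset {x z : 𝔼 n} {s t : ℝ} (hx : x ∈ Metric.ball z s)
    (ht1 : t ≤ 1) : Metric.ball (x + t • (z - x)) (t * s) ⊆ Metric.ball z s := by
  intro y hy
  rw [Metric.mem_ball, dist_eq_norm] at *
  have : y - z = (y - (x + t • (z - x))) + (1 - t) • (x - z) := by module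
  rw [this]
  refine (norm_add_le _ _).trans_lt ?_
  rw [norm_smul, Real.norm_of_nonneg (by linarith)]
  nlinarith [mul_le_mul_of_nonneg_left hx.le (by linarith : 0 ≤ 1 - t)]

lemma abs_sub_le_integral_segment {f : (𝔼 n) → ℝ} (hf : ContDiff ℝ 1 f) (x y : 𝔼 n) :
    |f y - f x| ≤ ‖y - x‖ * ∫ t in Ioc (0 : ℝ) 1, ‖fderiv ℝ f (x + t • (y - x))‖ := by
  have hc : Continuous (fderiv ℝ f) := hf.continuous_fderiv one_ne_zero
  have hd : ∀ t : ℝ, HasDerivAt (fun t : ℝ => f (x + t • (y - x)))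
      (fderiv ℝ f (x + t • (y - x)) (y - x)) t := by
    intro t
    have h1 : HasDerivAt (fun t : ℝ => x + t • (y - x)) (y - x) t := by
      simpa using ((hasDerivAt_id t).smul_const (y - x)).const_add x
    exact ((hf.differentiable one_ne_zero _).hasFDerivAt.comp_hasDerivAt t h1)
  have hcl : Continuous fun t : ℝ => fderiv ℝ f (x + t • (y - x)) :=
    hc.comp (by fun_prop)
  have hcd : Continuous fun t : ℝ => fderiv ℝ f (x + t • (y - x)) (y - x) :=
    hcl.clm_apply continuous_const
  have := intervalIntegral.integral_eq_sub_of_hasDerivAt (fun t _ => hd t)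
    (hcd.intervalIntegrable 0 1)
  simp only [one_smul, zero_smul, add_zero, add_sub_cancel] at this
  rw [← this, ← Real.norm_eq_abs, ← intervalIntegral.integral_of_le zero_le_one,
    ← intervalIntegral.integral_const_mul]
  refine intervalIntegral.norm_integral_le_of_norm_le zero_le_one
    (Eventually.of_forall fun t _ => ?_) ((hcl.norm.const_mul _).intervalIntegrable 0 1)
  rw [mul_comm]
  exact ContinuousLinearMap.le_opNorm _ _

lemma integral_rpow_neg_half : ∫ t in Ioc (0 : ℝ) 1, t ^ (-(1 / 2) : ℝ) = 2 := by
  rw [← intervalIntegral.integral_of_le zero_le_one, integral_rpow (Or.inl (by norm_num))]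
  norm_num

lemma integrableOn_rpow_neg_half : IntegrableOn (fun t : ℝ => t ^ (-(1 / 2) : ℝ)) (Ioc 0 1) := by
  have := intervalIntegral.intervalIntegrable_rpow' (a := 0) (b := 1)
    (by norm_num : (-1 : ℝ) < -(1 / 2))
  rwa [intervalIntegrable_iff_integrableOn_Ioc_of_le zero_le_one] at this

/-- Integrate `∇f` along the segments from `x` to the points of the ball and exchange the integrals.
At parameter `t` the segments sweep a ball of radius `t * s`, so the growth hypothesis leaves `t ^
(-1/2)`, whose integral over `(0, 1]` is 2. The segments are shorter than `2 * s`; the two factors 2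
make up the constant 4. -/
lemma abs_sub_average_ball_le {f : (𝔼 n) → ℝ} (hf : ContDiff ℝ 1 f) {z : 𝔼 n} {s A : ℝ}
    (hs : 0 < s) (hA : ∀ a τ, 0 < τ → Metric.ball a τ ⊆ Metric.ball z s →
      ∫ y in Metric.ball a τ, ‖fderiv ℝ f y‖ ≤ A * τ ^ n / √τ)
    {x : 𝔼 n} (hx : x ∈ Metric.ball z s) :
    |f x - ⨍ y in Metric.ball z s, f y| ≤ 4 * A * √s / unitVol n := by
  have hc : Continuous (fderiv ℝ f) := hf.continuous_fderiv one_ne_zero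
  set B := Metric.ball z s with hB
  have hBfin : volume B < ⊤ := measure_ball_lt_top
  have : IsFiniteMeasure (volume.restrict B) := ⟨by rwa [Measure.restrict_apply_univ]⟩
  have hBv : volume.real B = s ^ n * unitVol n := volume_real_ball z hs
  have hBpos : 0 < volume.real B := by rw [hBv]; have := unitVol_pos n; positivity
  have hfi : IntegrableOn f B :=
    (hf.continuous.continuousOn.integrableOn_compact (isCompact_closedBall z s)).mono_set
      Metric.ball_subset_closedBall
  set Φ : (𝔼 n) → ℝ → ℝ := fun y t => ‖fderiv ℝ f (x + t • (y - x))‖ with hΦ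
  have hΦc : Continuous (Function.uncurry Φ) := by
    have : Continuous fun q : (𝔼 n) × ℝ => x + q.2 • (q.1 - x) := by fun_prop
    exact (hc.comp this).norm
  have hΦi : Integrable (Function.uncurry Φ)
      ((volume.restrict B).prod (volume.restrict (Ioc (0 : ℝ) 1))) := by
    rw [Measure.prod_restrict]
    refine (hΦc.continuousOn.integrableOn_compact
      ((isCompact_closedBall z s).prod (isCompact_Icc (a := (0 : ℝ)) (b := 1)))).mono_set ?_
    exact prod_mono Metric.ball_subset_closedBall Ioc_subset_Icc_self
  have hinner : ∀ t ∈ Ioc (0 : ℝ) 1, ∫ y in B, Φ y t ≤ A * s ^ n / √s * t ^ (-(1 / 2) : ℝ) := by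
    intro t ht
    have h1 := hA _ (t * s) (mul_pos ht.1 hs) (ball_homothety_subset hx ht.2)
    rw [hΦ, setIntegral_ball_homothety (fun w => ‖fderiv ℝ f w‖) x z ht.1]
    refine (mul_le_mul_of_nonneg_left h1 (by have := ht.1; positivity)).trans_eq ?_
    rw [Real.rpow_neg ht.1.le, ← Real.sqrt_eq_rpow, Real.sqrt_mul ht.1.le, mul_pow]
    have h3 := Real.sqrt_pos.2 ht.1
    have h4 := Real.sqrt_pos.2 hs
    have h5 := ht.1
    field_simp
  have h1 : ∫ y in B, |f y - f x| ≤ 2 * s * ∫ y in B, ∫ t in Ioc (0 : ℝ) 1, Φ y t := by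
    rw [← integral_const_mul]
    refine setIntegral_mono_on (hfi.sub (integrable_const _)).abs
      (hΦi.integral_prod_left.const_mul _) measurableSet_ball fun y hy => ?_
    refine (abs_sub_le_integral_segment hf x y).trans ?_
    refine mul_le_mul_of_nonneg_right ?_ (integral_nonneg fun t => norm_nonneg _)
    rw [← dist_eq_norm]
    have := dist_triangle_right y x z
    linarith [Metric.mem_ball.1 hx, Metric.mem_ball.1 hy]
  have h2 : ∫ y in B, ∫ t in Ioc (0 : ℝ) 1, Φ y t ≤ A * s ^ n / √s * 2 := by
    rw [integral_integral_swap hΦi, ← integral_rpow_neg_half, ← integral_const_mul]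
    exact setIntegral_mono_on hΦi.integral_prod_right (integrableOn_rpow_neg_half.const_mul _)
      measurableSet_Ioc hinner
  have h3 : |f x - ⨍ y in B, f y| ≤ (volume.real B)⁻¹ * ∫ y in B, |f y - f x| := by
    have : f x - ⨍ y in B, f y = (volume.real B)⁻¹ * ∫ y in B, (f x - f y) := by
      rw [integral_sub (integrable_const _) hfi, setAverage_eq]
      simp only [setIntegral_const, smul_eq_mul]
      field_simp
    rw [this, abs_mul, abs_of_pos (inv_pos.2 hBpos)]
    refine mul_le_mul_of_nonneg_left ?_ (inv_pos.2 hBpos).le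
    refine abs_integral_le_integral_abs.trans_eq ?_
    simp only [abs_sub_comm]
  refine h3.trans ((mul_le_mul_of_nonneg_left (h1.trans
    (mul_le_mul_of_nonneg_left h2 (by positivity))) (inv_pos.2 hBpos).le).trans_eq ?_)
  rw [hBv]
  have h6 := unitVol_pos n
  have h4 := Real.sqrt_pos.2 hs
  have h5 := Real.sq_sqrt hs.le
  field_simp
  rw [h5]
  ring

/-- Morrey's inequality for smooth functions, with the growth of the gradient on balls as
hypothesis. -/
lemma abs_sub_le_of_gradient_growth {f : (𝔼 n) → ℝ} (hf : ContDiff ℝ 1 f) {z : 𝔼 n} {s A : ℝ}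
    (hs : 0 < s) (hA : ∀ a τ, 0 < τ → Metric.ball a τ ⊆ Metric.ball z s →
      ∫ y in Metric.ball a τ, ‖fderiv ℝ f y‖ ≤ A * τ ^ n / √τ)
    {x y : 𝔼 n} (hx : x ∈ Metric.ball z s) (hy : y ∈ Metric.ball z s) :
    |f x - f y| ≤ 8 * A * √s / unitVol n := by
  have h1 := abs_sub_average_ball_le hf hs hA hx
  have h2 := abs_sub_average_ball_le hf hs hA hy
  rw [abs_sub_comm] at h2
  have h3 := abs_sub_le (f x) (⨍ y in Metric.ball z s, f y) (f y)
  refine h3.trans ((add_le_add h1 h2).trans_eq ?_)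
  ring

lemma norm_fderiv_mollify_le (hΩ : MeasurableSet Ω) (hv : HasWeakGrad Ω v G) {j : ℕ} {x : 𝔼 n}
    (hx : Metric.closedBall x (1 / ((j : ℝ) + 1)) ⊆ Ω) :
    ‖fderiv ℝ (mollify j (Ω.indicator v)) x‖ ≤ ‖mollify j (Ω.indicator G) x‖ := by
  refine ContinuousLinearMap.opNorm_le_bound _ (norm_nonneg _) fun h => ?_
  rw [hv.fderiv_mollify hΩ hx]
  exact norm_inner_le_norm _ _

/-- By Fubini, the integral of a mollification over a ball is at most an average of integrals over
slightly translated balls, so mollification inherits growth bounds on balls. -/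
lemma setIntegral_ball_norm_mollify_le {γ : (𝔼 n) → (𝔼 n)} (hγ : Integrable γ) {j : ℕ} {a : 𝔼 n}
    {τ b : ℝ} (hb : ∀ t : 𝔼 n, ‖t‖ < 1 / ((j : ℝ) + 1) →
      ∫ y in Metric.ball (a - t) τ, ‖γ y‖ ≤ b) :
    ∫ y in Metric.ball a τ, ‖mollify j γ y‖ ≤ b := by
  have hinteg := (integrable_mol n j).convolution_integrand
    (ContinuousLinearMap.lsmul ℝ ℝ : ℝ →L[ℝ] ℝ →L[ℝ] ℝ) hγ.norm
  have hinteg' : Integrable (Function.uncurry fun (y t : 𝔼 n) => mol n j t * ‖γ (y - t)‖)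
      ((volume.restrict (Metric.ball a τ)).prod volume) :=
    hinteg.mono_measure (Measure.prod_mono Measure.restrict_le_self le_rfl)
  calc ∫ y in Metric.ball a τ, ‖mollify j γ y‖
      ≤ ∫ y in Metric.ball a τ, ∫ t, mol n j t * ‖γ (y - t)‖ := by
        refine setIntegral_mono_on (integrable_mollify j hγ).norm.integrableOn
          hinteg'.integral_prod_left measurableSet_ball fun y _ => ?_
        exact norm_mollify_le j γ y
    _ = ∫ t, ∫ y in Metric.ball a τ, mol n j t * ‖γ (y - t)‖ := integral_integral_swap hinteg'
    _ ≤ ∫ t, mol n j t * b := by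
        refine integral_mono hinteg'.integral_prod_right ((integrable_mol n j).mul_const b)
          fun t => ?_
        dsimp only
        rw [integral_const_mul]
        by_cases ht : ‖t‖ < 1 / ((j : ℝ) + 1)
        · refine mul_le_mul_of_nonneg_left ?_ (mol_nonneg _ _)
          refine le_trans (le_of_eq ?_) (hb t ht)
          rw [← integral_indicator measurableSet_ball, ← integral_indicator measurableSet_ball,
            ← integral_sub_right_eq_self ((Metric.ball (a - t) τ).indicator fun y => ‖γ y‖) t]
          congr 1 with y
          have : y - t ∈ Metric.ball (a - t) τ ↔ y ∈ Metric.ball a τ := by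
            simp [Metric.mem_ball, dist_eq_norm]
          by_cases hy : y ∈ Metric.ball a τ
          · simp only [indicator_of_mem hy, indicator_of_mem (this.2 hy)]
          · simp only [indicator_of_notMem hy, indicator_of_notMem (fun h => hy (this.1 h))]
        · rw [mol_eq_zero (not_lt.1 ht)]; simp
    _ = b := by rw [integral_mul_const, integral_mol, one_mul]

/-- The points at which the mollifications converge. -/
def mollifyPoints (Ω : Set (𝔼 n)) (v : (𝔼 n) → ℝ) : Set (𝔼 n) :=
  {x ∈ Ω | Tendsto (fun j => mollify j (Ω.indicator v) x) atTop (𝓝 (v x))}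

lemma ae_mem_mollifyPoints (hΩ : MeasurableSet Ω) (hv : IntegrableOn v Ω) :
    ∀ᵐ x, x ∈ Ω → x ∈ mollifyPoints Ω v := by
  filter_upwards [ae_tendsto_mollify (hv.integrable_indicator hΩ).locallyIntegrable] with x hx hxΩ
  rw [indicator_of_mem hxΩ] at hx
  exact ⟨hxΩ, hx⟩

/-- Morrey's estimate holds for the mollifications with a constant independent of `j`, and passes to
the limit. The doubled ball leaves room for the translations and for the support of the kernel. -/
lemma abs_sub_le_of_mem_mollifyPoints (hΩ : MeasurableSet Ω) (hv : HasWeakGrad Ω v G) {A : ℝ}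
    (hA : ∀ a τ, 0 < τ → Metric.ball a τ ⊆ Ω →
      ∫ y in Metric.ball a τ, ‖G y‖ ≤ A * τ ^ n / √τ) {z : 𝔼 n} {s : ℝ} (hs : 0 < s)
    (hz : Metric.ball z (2 * s) ⊆ Ω) {x y : 𝔼 n} (hx : x ∈ Metric.ball z s)
    (hy : y ∈ Metric.ball z s) (hxS : x ∈ mollifyPoints Ω v) (hyS : y ∈ mollifyPoints Ω v) :
    |v x - v y| ≤ 8 * A * √s / unitVol n := by
  refine le_of_tendsto (hxS.2.sub hyS.2).abs ?_
  have hvi := hv.1.integrable_indicator hΩ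
  have hGi := hv.2.1.integrable_indicator hΩ
  filter_upwards [exists_mollify_radius_lt hs] with j hj
  refine abs_sub_le_of_gradient_growth ((contDiff_mollify j hvi.locallyIntegrable).of_le
    (by norm_cast)) hs (fun a τ hτ haτ => ?_) hx hy
  have hG' : ∫ y in Metric.ball a τ, ‖mollify j (Ω.indicator G) y‖ ≤ A * τ ^ n / √τ := by
    refine setIntegral_ball_norm_mollify_le hGi fun t ht => ?_
    have hsub : Metric.ball (a - t) τ ⊆ Ω := by
      intro y hy
      apply hz
      have h1 : y + t ∈ Metric.ball z s := by
        apply haτ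
        rw [Metric.mem_ball, dist_eq_norm] at hy ⊢
        rwa [show y + t - a = y - (a - t) by abel]
      rw [Metric.mem_ball, dist_eq_norm] at h1 ⊢
      have : y - z = (y + t - z) - t := by abel
      rw [this]
      refine (norm_sub_le _ _).trans_lt ?_
      linarith
    refine le_of_eq_of_le ?_ (hA (a - t) τ hτ hsub)
    refine setIntegral_congr_fun measurableSet_ball fun y hy => ?_
    simp only [indicator_of_mem (hsub hy)]
  refine le_trans ?_ hG'
  refine setIntegral_mono_on ?_ (integrable_mollify j hGi).norm.integrableOn measurableSet_ball
    fun y hy => ?_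
  · exact (((contDiff_mollify j hvi.locallyIntegrable).continuous_fderiv
      (by simp)).norm.continuousOn.integrableOn_compact (isCompact_closedBall a τ)).mono_set
      Metric.ball_subset_closedBall
  · refine norm_fderiv_mollify_le hΩ hv fun y' hy' => hz ?_
    have h1 := Metric.mem_ball.1 (haτ hy)
    have h2 := Metric.mem_closedBall.1 hy'
    have := dist_triangle y' y z
    rw [Metric.mem_ball]
    linarith

/-- `w` satisfies a Hölder estimate with exponent `1/2` on the balls well inside `Ω`. -/
def InteriorHolder (Ω : Set (𝔼 n)) (C : ℝ) (w : (𝔼 n) → ℝ) : Prop :=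
  ∀ z s, 0 < s → Metric.ball z (2 * s) ⊆ Ω →
    ∀ x ∈ Metric.ball z s, ∀ y ∈ Metric.ball z s, |w x - w y| ≤ C * √s

lemma exists_ball_of_interiorHolder (hΩ : IsOpen Ω) {x : 𝔼 n} (hx : x ∈ Ω) {C ε : ℝ} (hC : 0 ≤ C)
    (hε : 0 < ε) : ∃ s > 0, Metric.ball x (2 * s) ⊆ Ω ∧ C * √s < ε := by
  obtain ⟨r, hr, hrΩ⟩ := Metric.isOpen_iff.1 hΩ x hx
  -- The second entry gives `√s ≤ ε / (2 * (C + 1))`; the `+ 1` covers `C = 0`.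
  refine ⟨min (r / 2) ((ε / (C + 1)) ^ 2 / 4), by positivity,
    (Metric.ball_subset_ball ?_).trans hrΩ, ?_⟩
  · have := min_le_left (r / 2) ((ε / (C + 1)) ^ 2 / 4)
    linarith
  · have h1 : √(min (r / 2) ((ε / (C + 1)) ^ 2 / 4)) ≤ ε / (C + 1) / 2 := by
      rw [Real.sqrt_le_left (by positivity)]
      refine (min_le_right _ _).trans_eq (by ring)
    have h2 : C * (ε / (C + 1) / 2) < ε := by
      rw [div_div, mul_div_assoc', div_lt_iff₀ (by positivity)]
      nlinarith
    exact (mul_le_mul_of_nonneg_left h1 hC).trans_lt h2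

lemma InteriorHolder.continuousOn (hΩ : IsOpen Ω) {C : ℝ} (hC : 0 ≤ C)
    (hw : InteriorHolder Ω C w) : ContinuousOn w Ω := by
  intro x hx
  refine ContinuousAt.continuousWithinAt (Metric.continuousAt_iff.2 fun ε hε => ?_)
  obtain ⟨s, hs, hsΩ, hsε⟩ := exists_ball_of_interiorHolder hΩ hx hC hε
  exact ⟨s, hs, fun {y} hy => (hw x s hs hsΩ y hy x (Metric.mem_ball_self hs)).trans_lt hsε⟩

/-- The continuous representative in the interior. -/
lemma exists_interiorHolder_representative (hΩ : IsOpen Ω) (hv : HasWeakGrad Ω v G) {A : ℝ}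
    (hA0 : 0 ≤ A) (hA : ∀ a τ, 0 < τ → Metric.ball a τ ⊆ Ω →
      ∫ y in Metric.ball a τ, ‖G y‖ ≤ A * τ ^ n / √τ) :
    ∃ w, InteriorHolder Ω (8 * A / unitVol n) w ∧ v =ᵐ[volume.restrict Ω] w := by
  have hC : 0 ≤ 8 * A / unitVol n := by have := unitVol_pos n; positivity
  set C := 8 * A / unitVol n
  set S := mollifyPoints Ω v with hS
  have hest : ∀ z s, 0 < s → Metric.ball z (2 * s) ⊆ Ω → ∀ x ∈ Metric.ball z s, x ∈ S →
      ∀ y ∈ Metric.ball z s, y ∈ S → |v x - v y| ≤ C * √s := by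
    intro z s hs hz x hx hxS y hy hyS
    refine (abs_sub_le_of_mem_mollifyPoints hΩ.measurableSet hv hA hs hz hx hy hxS hyS).trans_eq ?_
    ring
  have hae := ae_mem_mollifyPoints hΩ.measurableSet hv.1
  -- The part of `Ω` outside `S` is null and so contains no ball.
  have hdense : Ω ⊆ closure S := by
    intro x hx
    rw [mem_closure_iff_nhds]
    intro t ht
    by_contra hne
    rw [not_nonempty_iff_eq_empty] at hne
    obtain ⟨r, hr, hrt⟩ := Metric.mem_nhds_iff.1 (inter_mem ht (hΩ.mem_nhds hx))
    have : volume (Metric.ball x r) = 0 := by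
      refine measure_mono_null (fun y hy => ?_) (ae_iff.1 hae)
      simp only [mem_ofPred_eq, Classical.not_imp]
      exact ⟨(hrt hy).2, fun hyS => by
        have : y ∈ t ∩ S := ⟨(hrt hy).1, hyS⟩
        simp [hne] at this⟩
    exact (Metric.measure_ball_pos volume x hr).ne' this
  -- The Hölder estimate on `S` makes `v` Cauchy along `S`, so `v` restricted to `S` extends
  -- continuously to `Ω`.
  have hlim : ∀ x ∈ Ω, Tendsto v (𝓝[S] x) (𝓝 (extendFrom S v x)) := by
    intro x hx
    refine tendsto_extendFrom ?_
    have hne : (𝓝[S] x).NeBot := mem_closure_iff_nhdsWithin_neBot.1 (hdense hx)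
    refine CompleteSpace.complete (Metric.cauchy_iff.2 ⟨hne.map v, fun ε hε => ?_⟩)
    obtain ⟨s, hs, hsΩ, hsε⟩ := exists_ball_of_interiorHolder hΩ hx hC hε
    refine ⟨v '' (Metric.ball x s ∩ S), image_mem_map (inter_mem
      (mem_nhdsWithin_of_mem_nhds (Metric.ball_mem_nhds x hs)) self_mem_nhdsWithin), ?_⟩
    rintro _ ⟨a, ha, rfl⟩ _ ⟨b, hb, rfl⟩
    exact (hest x s hs hsΩ a ha.1 ha.2 b hb.1 hb.2).trans_lt hsε
  refine ⟨extendFrom S v, fun z s hs hz x hx y hy => ?_, ?_⟩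
  · have hsub : Metric.ball z s ⊆ Ω :=
      (Metric.ball_subset_ball (by linarith)).trans hz
    have hnx : (𝓝[S] x).NeBot := mem_closure_iff_nhdsWithin_neBot.1 (hdense (hsub hx))
    have hny : (𝓝[S] y).NeBot := mem_closure_iff_nhdsWithin_neBot.1 (hdense (hsub hy))
    have ht : Tendsto (fun q : (𝔼 n) × (𝔼 n) => |v q.1 - v q.2|) (𝓝[S] x ×ˢ 𝓝[S] y)
        (𝓝 |extendFrom S v x - extendFrom S v y|) :=
      (((hlim x (hsub hx)).comp tendsto_fst).sub ((hlim y (hsub hy)).comp tendsto_snd)).abs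
    refine le_of_tendsto ht ?_
    have h1 : ∀ᶠ a in 𝓝[S] x, a ∈ Metric.ball z s ∧ a ∈ S :=
      inter_mem (mem_nhdsWithin_of_mem_nhds (Metric.isOpen_ball.mem_nhds hx))
        self_mem_nhdsWithin
    have h2 : ∀ᶠ a in 𝓝[S] y, a ∈ Metric.ball z s ∧ a ∈ S :=
      inter_mem (mem_nhdsWithin_of_mem_nhds (Metric.isOpen_ball.mem_nhds hy))
        self_mem_nhdsWithin
    filter_upwards [h1.prod_mk h2] with q hq
    exact hest z s hs hz q.1 hq.1.1 hq.1.2 q.2 hq.2.1 hq.2.2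
  · filter_upwards [ae_restrict_of_ae hae, ae_restrict_mem hΩ.measurableSet] with x hxS hx
    have hxS' := hxS hx
    have hne : (𝓝[S] x).NeBot := mem_closure_iff_nhdsWithin_neBot.1 (hdense hx)
    refine tendsto_nhds_unique (f := v) (l := 𝓝[S] x) ?_ (hlim x hx)
    refine Metric.tendsto_nhdsWithin_nhds.2 fun ε hε => ?_
    obtain ⟨s, hs, hsΩ, hsε⟩ := exists_ball_of_interiorHolder hΩ hx hC hε
    exact ⟨s, hs, fun {y} hyS hy => (hest x s hs hsΩ y hy hyS x
      (Metric.mem_ball_self hs) hxS').trans_lt hsε⟩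

/-- A pointwise inequality replaces Hölder's: `r ≤ τ ^ (-1/2) * (1 + τ ^ n * r ^ (2 * n))`, by
comparing `r * √τ` with 1. The exponent `2 * n` is what gives Hölder exponent `1 - n / (2 * n) = 1 /
2` in Morrey's estimate. -/
lemma setIntegral_ball_norm_le_of_integral_pow (hn : 0 < n) (hG : IntegrableOn G Ω) {M : ℝ}
    (hGi : IntegrableOn (fun x => ‖G x‖ ^ (2 * n)) Ω)
    (hM : ∫ x in Ω, ‖G x‖ ^ (2 * n) ≤ M) (a : 𝔼 n) {τ : ℝ} (hτ : 0 < τ)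
    (ha : Metric.ball a τ ⊆ Ω) :
    ∫ y in Metric.ball a τ, ‖G y‖ ≤ (unitVol n + M) * τ ^ n / √τ := by
  have hst := Real.sqrt_pos.2 hτ
  have hpt : ∀ r : ℝ, 0 ≤ r → r ≤ (√τ)⁻¹ * (1 + τ ^ n * r ^ (2 * n)) := by
    intro r hr
    rw [inv_mul_eq_div, le_div_iff₀ hst]
    have h1 : τ ^ n * r ^ (2 * n) = (r * √τ) ^ (2 * n) := by
      rw [mul_pow, pow_mul (√τ), Real.sq_sqrt hτ.le, mul_comm]
    rw [h1]
    have h0 : 0 ≤ r * √τ := by positivity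
    rcases le_total (r * √τ) 1 with h | h
    · have := pow_nonneg h0 (2 * n); linarith
    · have := le_self_pow₀ h (by omega : 2 * n ≠ 0); linarith
  have hi := hGi.mono_set ha
  have hfin : IsFiniteMeasure (volume.restrict (Metric.ball a τ)) :=
    ⟨by rw [Measure.restrict_apply_univ]; exact measure_ball_lt_top⟩
  calc ∫ y in Metric.ball a τ, ‖G y‖
      ≤ ∫ y in Metric.ball a τ, (√τ)⁻¹ * (1 + τ ^ n * ‖G y‖ ^ (2 * n)) :=
        integral_mono (hG.mono_set ha).norm
          (((integrable_const _).add (hi.const_mul _)).const_mul _) fun y => hpt _ (norm_nonneg _)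
    _ = (√τ)⁻¹ * (volume.real (Metric.ball a τ) +
          τ ^ n * ∫ y in Metric.ball a τ, ‖G y‖ ^ (2 * n)) := by
        rw [integral_const_mul, integral_add (integrable_const _) (hi.const_mul _),
          integral_const_mul]
        simp
    _ ≤ (√τ)⁻¹ * (τ ^ n * unitVol n + τ ^ n * M) := by
        rw [volume_real_ball a hτ]
        gcongr
        refine le_trans (setIntegral_mono_set hGi
          (Eventually.of_forall fun x => by positivity) ha.eventuallyLE) hM
    _ = (unitVol n + M) * τ ^ n / √τ := by ring

end Morrey

/-! ### Lipschitz charts and equicontinuity up to the boundary -/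

section Boundary

variable {n : ℕ} {Ω : Set (𝔼 n)} {w : (𝔼 n) → ℝ}

/-- Near `x₀`, the set `Ω` is the positivity set of a Lipschitz function which grows with unit speed
in the direction `e`. -/
structure Chart (Ω : Set (𝔼 n)) (x₀ : 𝔼 n) where
  /-- the direction pointing into `Ω` -/
  e : 𝔼 n
  /-- the radius of the chart -/
  r : ℝ
  /-- the Lipschitz constant -/
  L : ℝ≥0
  /-- the defining function -/
  g : (𝔼 n) → ℝ
  norm_e : ‖e‖ = 1
  r_pos : 0 < r
  lip : LipschitzWith L g
  g_add : ∀ y (t : ℝ), g (y + t • e) = g y + t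
  mem_iff : ∀ y ∈ Metric.ball x₀ r, (y ∈ Ω ↔ 0 < g y)

/-- The height above the graph, `⟪e, y⟫` minus `γ` at the projection of `y`, is Lipschitz on the
whole space and increases at unit speed along `e`. -/
lemma HasLipschitzBoundary.nonempty_chart (h : HasLipschitzBoundary Ω) {x₀ : 𝔼 n}
    (hx₀ : x₀ ∈ frontier Ω) : Nonempty (Chart Ω x₀) := by
  obtain ⟨e, r, K, γ, he, hr, hγ, hiff⟩ := h x₀ hx₀
  refine ⟨⟨e, r, 1 + K, fun y => ⟪e, y⟫ - γ ((Submodule.span ℝ {e})ᗮ.orthogonalProjectionOnto y),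
    he, hr, ?_, fun y t => ?_, fun y hy => by rw [hiff y hy, sub_pos]⟩⟩
  · have h1 : LipschitzWith 1 fun y : 𝔼 n => ⟪e, y⟫ := by
      refine LipschitzWith.of_dist_le_mul fun x y => ?_
      rw [Real.dist_eq, ← inner_sub_right, dist_eq_norm]
      refine (abs_real_inner_le_norm e (x - y)).trans ?_
      rw [he]; simp
    have h2 := hγ.comp (Submodule.lipschitzWith_orthogonalProjectionOnto
      (Submodule.span ℝ {e})ᗮ)
    rw [mul_one] at h2
    exact h1.sub h2
  · simp only [map_add, map_smul,
      Submodule.orthogonalProjectionOnto_orthogonalComplement_singleton_eq_zero, smul_zero,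
      add_zero, inner_add_right, inner_smul_right, real_inner_self_eq_norm_sq, he]
    ring

namespace Chart

variable {x₀ : 𝔼 n} (c : Chart Ω x₀)

lemma abs_g_sub_le (y z : 𝔼 n) : |c.g y - c.g z| ≤ c.L * ‖y - z‖ := by
  have := c.lip.dist_le_mul y z
  rwa [Real.dist_eq, dist_eq_norm] at this

lemma one_le_L : (1 : ℝ) ≤ c.L := by
  have h1 := c.abs_g_sub_le (0 + (1 : ℝ) • c.e) 0
  rw [c.g_add] at h1
  simpa [c.norm_e] using h1

lemma g_center (hΩ : IsOpen Ω) (hx₀ : x₀ ∈ frontier Ω) : c.g x₀ = 0 := by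
  have hmem : x₀ ∈ Metric.ball x₀ c.r := Metric.mem_ball_self c.r_pos
  refine le_antisymm ?_ ?_
  · by_contra hpos
    have : x₀ ∈ Ω := (c.mem_iff x₀ hmem).2 (not_le.1 hpos)
    exact (hΩ.frontier_eq ▸ hx₀ : x₀ ∈ closure Ω \ Ω).2 this
  · have hcl : x₀ ∈ closure (Ω ∩ Metric.ball x₀ c.r) :=
      mem_closure_iff_nhds.2 fun t ht => by
        obtain ⟨y, hy⟩ := mem_closure_iff_nhds.1 (frontier_subset_closure hx₀) _
          (inter_mem ht (Metric.ball_mem_nhds x₀ c.r_pos))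
        exact ⟨y, hy.1.1, hy.2, hy.1.2⟩
    exact closure_minimal (fun y hy => ((c.mem_iff y hy.2).1 hy.1).le)
      (isClosed_le continuous_const c.lip.continuous) hcl

/-- An interior cone condition: moving by `t • e` raises `g` by `t`, and the Lipschitz bound keeps
`g` positive on a ball of radius `t / L`. -/
lemma ball_subset {x : 𝔼 n} (hx : x ∈ Ω) (hxr : x ∈ Metric.ball x₀ (c.r / 2)) {t : ℝ}
    (ht : 0 < t) (htr : t ≤ c.r / 4) : Metric.ball (x + t • c.e) (t / c.L) ⊆ Ω := by
  have hL := c.one_le_L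
  intro z hz
  rw [Metric.mem_ball] at hz hxr
  have hle : t / c.L ≤ t := div_le_self ht.le hL
  have hd : dist (x + t • c.e) x = t := by
    rw [dist_eq_norm, add_sub_cancel_left, norm_smul, c.norm_e, Real.norm_of_nonneg ht.le, mul_one]
  have hzr : z ∈ Metric.ball x₀ c.r := by
    rw [Metric.mem_ball]
    have := dist_triangle4 z (x + t • c.e) x x₀
    linarith
  rw [c.mem_iff z hzr]
  have hxr' : x ∈ Metric.ball x₀ c.r := by rw [Metric.mem_ball]; linarith [c.r_pos]
  have hgx := (c.mem_iff x hxr').1 hx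
  have h1 := c.abs_g_sub_le z (x + t • c.e)
  rw [c.g_add, ← dist_eq_norm] at h1
  have h2 : c.L * dist z (x + t • c.e) < t := by
    rw [lt_div_iff₀ (by linarith)] at hz
    linarith
  have := neg_le_of_abs_le h1
  linarith

lemma abs_sub_step {C : ℝ} (hwC : InteriorHolder Ω C w) (hC : 0 ≤ C) {x : 𝔼 n}
    (hx : x ∈ Ω) (hxr : x ∈ Metric.ball x₀ (c.r / 2)) {t : ℝ} (ht : 0 < t) (htr : t ≤ c.r / 4)
    {y : 𝔼 n} (hy : dist y (x + t • c.e) < t / c.L / 2) :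
    |w (x + t • c.e) - w y| ≤ C * √t := by
  have hL := c.one_le_L
  have hs : 0 < t / c.L / 2 := by positivity
  refine (hwC (x + t • c.e) (t / c.L / 2) hs ?_ _ (Metric.mem_ball_self hs) y hy).trans ?_
  · rw [mul_div_cancel₀ _ two_ne_zero]
    exact c.ball_subset hx hxr ht htr
  · gcongr
    have : t / c.L ≤ t := div_le_self ht.le hL
    linarith

/-- The factor of the geometric sequence of steps towards the boundary. -/
def ratio : ℝ := 1 - 1 / (4 * c.L)

lemma ratio_pos : 0 < c.ratio := by
  have hL := c.one_le_L
  rw [ratio, sub_pos, div_lt_one (by linarith)]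
  linarith

lemma ratio_lt_one : c.ratio < 1 := by
  have hL := c.one_le_L
  rw [ratio]
  have : 0 < 1 / (4 * (c.L : ℝ)) := by positivity
  linarith

lemma sqrt_ratio_lt_one : √c.ratio < 1 := by
  rw [Real.sqrt_lt' one_pos]; simpa using c.ratio_lt_one

/-- Descend from `x + t • e` to `x` through points at heights `q ^ J * t`. Each step stays in a ball
on which the interior estimate applies, and the contributions form a geometric series of ratio `√q`.
The descent never touches the boundary since `x` itself lies in `Ω`; the constant does not depend on
the distance of `x` to the boundary. -/
lemma abs_sub_shift_le (hΩ : IsOpen Ω) {C : ℝ} (hwC : InteriorHolder Ω C w) (hC : 0 ≤ C)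
    {x : 𝔼 n} (hx : x ∈ Ω) (hxr : x ∈ Metric.ball x₀ (c.r / 2)) {t : ℝ} (ht : 0 < t)
    (htr : t ≤ c.r / 4) : |w (x + t • c.e) - w x| ≤ C / (1 - √c.ratio) * √t := by
  have hL := c.one_le_L
  set q := c.ratio with hq
  have hq0 : 0 < q := c.ratio_pos
  have hq1 : q < 1 := c.ratio_lt_one
  have hsq : 0 < 1 - √q := sub_pos.2 c.sqrt_ratio_lt_one
  have hstep : ∀ J : ℕ, |w (x + t • c.e) - w (x + (q ^ J * t) • c.e)| ≤
      C / (1 - √q) * (√t - √(q ^ J * t)) := by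
    intro J
    induction J with
    | zero => simp
    | succ J ih =>
      have hp : 0 < q ^ J * t := by positivity
      have hle : q ^ J * t ≤ c.r / 4 :=
        (mul_le_of_le_one_left ht.le (pow_le_one₀ hq0.le hq1.le)).trans htr
      have h1 : |w (x + (q ^ J * t) • c.e) - w (x + (q ^ (J + 1) * t) • c.e)| ≤
          C * √(q ^ J * t) := by
        refine c.abs_sub_step hwC hC hx hxr hp hle ?_
        rw [dist_eq_norm, add_sub_add_left_eq_sub, ← sub_smul, norm_smul, c.norm_e, mul_one,
          Real.norm_eq_abs, abs_sub_comm, abs_of_nonneg]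
        -- The choice of `ratio` makes the step a quarter of the radius `q ^ J * t / L` of the ball
        -- in `Ω`, hence half of the admissible distance.
        · have : q ^ J * t - q ^ (J + 1) * t = q ^ J * t / c.L / 4 := by
            rw [pow_succ, hq, ratio]; field_simp; ring
          rw [this]
          have : 0 < q ^ J * t / c.L := by positivity
          linarith
        · rw [sub_nonneg]
          have := pow_le_pow_of_le_one hq0.le hq1.le (Nat.le_succ J)
          gcongr
      have h2 : √(q ^ (J + 1) * t) = √q * √(q ^ J * t) := by
        rw [← Real.sqrt_mul hq0.le]; ring_nf
      refine (abs_sub_le _ (w (x + (q ^ J * t) • c.e)) _).trans ((add_le_add ih h1).trans_eq ?_)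
      rw [h2]
      field_simp
      ring
  have hlim : Tendsto (fun J : ℕ => x + (q ^ J * t) • c.e) atTop (𝓝 x) := by
    have h1 := ((tendsto_pow_atTop_nhds_zero_of_lt_one hq0.le hq1).mul_const t).smul_const c.e
    simpa using h1.const_add x
  have hcont : ContinuousAt w x := (hwC.continuousOn hΩ hC).continuousAt (hΩ.mem_nhds hx)
  have htend := (tendsto_const_nhds (x := w (x + t • c.e))).sub (hcont.tendsto.comp hlim)
  refine le_of_tendsto htend.abs (Eventually.of_forall fun J => (hstep J).trans ?_)
  have : 0 ≤ √(q ^ J * t) := Real.sqrt_nonneg _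
  gcongr
  linarith

/-- Equicontinuity near a boundary point. -/
lemma abs_sub_le (hΩ : IsOpen Ω) {C : ℝ} (hwC : InteriorHolder Ω C w) (hC : 0 ≤ C)
    {x y : 𝔼 n} (hx : x ∈ Ω) (hxr : x ∈ Metric.ball x₀ (c.r / 2)) (hy : y ∈ Ω)
    (hyr : y ∈ Metric.ball x₀ (c.r / 2)) {t : ℝ} (ht : 0 < t) (htr : t ≤ c.r / 4)
    (hxy : dist y x < t / c.L / 2) :
    |w x - w y| ≤ (2 * (C / (1 - √c.ratio)) + C) * √t := by
  -- Lift both points by `t • e`, compare them there inside one interior ball, and descend again.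
  have h1 := c.abs_sub_shift_le hΩ hwC hC hx hxr ht htr
  have h2 := c.abs_sub_shift_le hΩ hwC hC hy hyr ht htr
  have h3 := c.abs_sub_step hwC hC hx hxr ht htr (y := y + t • c.e) (by simpa using hxy)
  rw [abs_sub_comm] at h1
  have h4 := _root_.abs_sub_le (w x) (w (x + t • c.e)) (w y)
  have h5 := _root_.abs_sub_le (w (x + t • c.e)) (w (y + t • c.e)) (w y)
  linarith

end Chart

lemma exists_ball_abs_sub_le (hΩ : IsOpen Ω) (hlip : HasLipschitzBoundary Ω) {C ε : ℝ}
    (hC : 0 ≤ C) (hε : 0 < ε) {x₀ : 𝔼 n} (hx₀ : x₀ ∈ closure Ω) :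
    ∃ ρ > 0, ∀ w, InteriorHolder Ω C w → ∀ x ∈ Ω ∩ Metric.ball x₀ ρ, ∀ y ∈ Ω ∩ Metric.ball x₀ ρ,
      |w x - w y| < ε := by
  by_cases hmem : x₀ ∈ Ω
  · obtain ⟨s, hs, hsΩ, hsε⟩ := exists_ball_of_interiorHolder hΩ hmem hC hε
    exact ⟨s, hs, fun w hw x hx y hy => (hw x₀ s hs hsΩ x hx.2 y hy.2).trans_lt hsε⟩
  · have hfr : x₀ ∈ frontier Ω := by rw [hΩ.frontier_eq]; exact ⟨hx₀, hmem⟩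
    obtain ⟨c⟩ := hlip.nonempty_chart hfr
    have hL := c.one_le_L
    have hr := c.r_pos
    set B := 2 * (C / (1 - √c.ratio)) + C with hB
    have hB0 : 0 ≤ B := by
      have : 0 < 1 - √c.ratio := sub_pos.2 c.sqrt_ratio_lt_one
      positivity
    set t := min (c.r / 4) ((ε / (B + 1)) ^ 2 / 4) with ht
    have ht0 : 0 < t := by positivity
    have hst : B * √t < ε := by
      have h1 : √t ≤ ε / (B + 1) / 2 := by
        rw [Real.sqrt_le_left (by positivity)]
        refine (min_le_right _ _).trans_eq (by ring)
      have h2 : B * (ε / (B + 1) / 2) < ε := by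
        rw [div_div, mul_div_assoc', div_lt_iff₀ (by positivity)]
        nlinarith
      exact (mul_le_mul_of_nonneg_left h1 hB0).trans_lt h2
    -- Two points within `t / L / 4` of `x₀` are within the distance `t / L / 2` allowed by the
    -- boundary estimate.
    refine ⟨min (c.r / 2) (t / c.L / 4), by positivity, fun w hw x hx y hy => ?_⟩
    have hsub : ∀ z ∈ Metric.ball x₀ (min (c.r / 2) (t / c.L / 4)),
        z ∈ Metric.ball x₀ (c.r / 2) ∧ dist z x₀ < t / c.L / 4 := fun z hz =>
      ⟨Metric.ball_subset_ball (min_le_left _ _) hz,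
        (Metric.mem_ball.1 hz).trans_le (min_le_right _ _)⟩
    refine (c.abs_sub_le hΩ hw hC hx.1 (hsub x hx.2).1 hy.1 (hsub y hy.2).1 ht0 (min_le_left _ _)
      ?_).trans_lt hst
    have h1 := (hsub x hx.2).2
    have h2 := (hsub y hy.2).2
    have h3 := dist_triangle_right y x x₀
    linarith

/-- Functions with a common interior Hölder estimate are uniformly equicontinuous. -/
lemma exists_modulus (hΩ : IsOpen Ω) (hb : Bornology.IsBounded Ω) (hlip : HasLipschitzBoundary Ω)
    {C ε : ℝ} (hC : 0 ≤ C) (hε : 0 < ε) :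
    ∃ δ > 0, ∀ w, InteriorHolder Ω C w → ∀ x ∈ Ω, ∀ y ∈ Ω, dist x y < δ → |w x - w y| < ε := by
  choose! ρ hρ hρw using fun x₀ (hx₀ : x₀ ∈ closure Ω) =>
    exists_ball_abs_sub_le hΩ hlip hC hε hx₀
  -- A Lebesgue number of the cover of the compact closure makes the local estimates uniform; it is
  -- independent of `w`.
  obtain ⟨δ, hδ, hδb⟩ := lebesgue_number_lemma_of_metric (s := closure Ω)
    (c := fun x : closure Ω => Metric.ball (x : 𝔼 n) (ρ x)) hb.isCompact_closure
    (fun _ => Metric.isOpen_ball)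
    (fun x hx => mem_iUnion.2 ⟨⟨x, hx⟩, Metric.mem_ball_self (hρ x hx)⟩)
  refine ⟨δ, hδ, fun w hw x hx y hy hxy => ?_⟩
  obtain ⟨z, hz⟩ := hδb x (subset_closure hx)
  exact hρw z z.2 w hw x ⟨hx, hz (Metric.mem_ball_self hδ)⟩ y
    ⟨hy, hz (by rwa [Metric.mem_ball, dist_comm])⟩

lemma tendsto_extendFrom_of_modulus
    (hw : ∀ ε > 0, ∃ δ > 0, ∀ x ∈ Ω, ∀ y ∈ Ω, dist x y < δ → |w x - w y| < ε)
    {x : 𝔼 n} (hx : x ∈ closure Ω) : Tendsto w (𝓝[Ω] x) (𝓝 (extendFrom Ω w x)) := by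
  refine tendsto_extendFrom ?_
  have hne : (𝓝[Ω] x).NeBot := mem_closure_iff_nhdsWithin_neBot.1 hx
  refine CompleteSpace.complete (Metric.cauchy_iff.2 ⟨hne.map w, fun ε hε => ?_⟩)
  obtain ⟨δ, hδ, h⟩ := hw ε hε
  refine ⟨w '' (Metric.ball x (δ / 2) ∩ Ω), image_mem_map (inter_mem
    (mem_nhdsWithin_of_mem_nhds (Metric.ball_mem_nhds x (by positivity))) self_mem_nhdsWithin), ?_⟩
  rintro _ ⟨a, ha, rfl⟩ _ ⟨b, hb, rfl⟩
  refine h a ha.2 b hb.2 ?_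
  have := dist_triangle_right a b x
  linarith [Metric.mem_ball.1 ha.1, Metric.mem_ball.1 hb.1]

/-- Compactness: uniformly bounded functions with a common interior Hölder estimate have a
subsequence which extends to the closure and converges uniformly there. -/
lemma exists_uniform_limit (hΩ : IsOpen Ω) (hb : Bornology.IsBounded Ω)
    (hlip : HasLipschitzBoundary Ω) {C B : ℝ} (hC : 0 ≤ C) {w : ℕ → (𝔼 n) → ℝ}
    (hw : ∀ k, InteriorHolder Ω C (w k)) (hwB : ∀ k, ∀ x ∈ Ω, |w k x| ≤ B) :
    ∃ (σ : ℕ → ℕ) (W : ℕ → (𝔼 n) → ℝ) (W' : (𝔼 n) → ℝ), StrictMono σ ∧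
      (∀ k, ContinuousOn (W k) (closure Ω)) ∧ (∀ k, EqOn (W k) (w (σ k)) Ω) ∧
      TendstoUniformlyOn W W' atTop (closure Ω) ∧ ContinuousOn W' (closure Ω) := by
  have hmod : ∀ ε > 0, ∃ δ > 0, ∀ k, ∀ x ∈ Ω, ∀ y ∈ Ω, dist x y < δ → |w k x - w k y| < ε := by
    intro ε hε
    obtain ⟨δ, hδ, h⟩ := exists_modulus hΩ hb hlip hC hε
    exact ⟨δ, hδ, fun k => h (w k) (hw k)⟩
  set V : ℕ → (𝔼 n) → ℝ := fun k => extendFrom Ω (w k) with hV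
  have hlim : ∀ k, ∀ x ∈ closure Ω, Tendsto (w k) (𝓝[Ω] x) (𝓝 (V k x)) := fun k x hx =>
    tendsto_extendFrom_of_modulus (fun ε hε => (hmod ε hε).imp fun δ h => ⟨h.1, h.2 k⟩) hx
  have hVc : ∀ k, ContinuousOn (V k) (closure Ω) := fun k =>
    continuousOn_extendFrom le_rfl fun x hx => ⟨_, hlim k x hx⟩
  have hVeq : ∀ k, EqOn (V k) (w k) Ω := fun k x hx => by
    have hne : (𝓝[Ω] x).NeBot := mem_closure_iff_nhdsWithin_neBot.1 (subset_closure hx)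
    exact tendsto_nhds_unique (hlim k x (subset_closure hx)) ((hw k).continuousOn hΩ hC x hx)
  have hVmod : ∀ ε > 0, ∃ δ > 0, ∀ k, ∀ x ∈ closure Ω, ∀ y ∈ closure Ω, dist x y < δ →
      |V k x - V k y| ≤ ε := by
    intro ε hε
    obtain ⟨δ, hδ, h⟩ := hmod ε hε
    refine ⟨δ, hδ, fun k x hx y hy hxy => ?_⟩
    have hnx : (𝓝[Ω] x).NeBot := mem_closure_iff_nhdsWithin_neBot.1 hx
    have hny : (𝓝[Ω] y).NeBot := mem_closure_iff_nhdsWithin_neBot.1 hy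
    have ht : Tendsto (fun q : (𝔼 n) × (𝔼 n) => |w k q.1 - w k q.2|) (𝓝[Ω] x ×ˢ 𝓝[Ω] y)
        (𝓝 |V k x - V k y|) :=
      (((hlim k x hx).comp tendsto_fst).sub ((hlim k y hy).comp tendsto_snd)).abs
    refine le_of_tendsto ht ?_
    have hd : Tendsto (fun q : (𝔼 n) × (𝔼 n) => dist q.1 q.2) (𝓝[Ω] x ×ˢ 𝓝[Ω] y)
        (𝓝 (dist x y)) :=
      ((tendsto_id'.2 nhdsWithin_le_nhds).comp tendsto_fst).dist
        ((tendsto_id'.2 nhdsWithin_le_nhds).comp tendsto_snd)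
    have h1 : ∀ᶠ a in 𝓝[Ω] x, a ∈ Ω := self_mem_nhdsWithin
    have h2 : ∀ᶠ a in 𝓝[Ω] y, a ∈ Ω := self_mem_nhdsWithin
    filter_upwards [h1.prod_mk h2, hd.eventually_lt_const hxy] with q hq hqd
    exact (h k q.1 hq.1 q.2 hq.2 hqd).le
  have hVB : ∀ k, ∀ x ∈ closure Ω, |V k x| ≤ B := by
    intro k x hx
    have hnx : (𝓝[Ω] x).NeBot := mem_closure_iff_nhdsWithin_neBot.1 hx
    refine le_of_tendsto (hlim k x hx).abs ?_
    filter_upwards [self_mem_nhdsWithin] with a ha using hwB k a ha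
  have : CompactSpace (closure Ω) := isCompact_iff_compactSpace.1 hb.isCompact_closure
  let F : ℕ → BoundedContinuousFunction (closure Ω) ℝ := fun k =>
    BoundedContinuousFunction.mkOfCompact ⟨(closure Ω).domRestrict (V k), (hVc k).domRestrict⟩
  -- Arzelà–Ascoli, with the common modulus and the common bound carried over to the extensions.
  have hcomp : IsCompact (closure (range F)) := by
    refine BoundedContinuousFunction.arzela_ascoli (Metric.closedBall (0 : ℝ) B)
      (isCompact_closedBall _ _) (range F) ?_ ?_
    · rintro _ x ⟨k, rfl⟩
      rw [mem_closedBall_zero_iff]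
      exact hVB k x x.2
    · intro x
      rw [Metric.equicontinuousAt_iff_pair]
      intro ε hε
      obtain ⟨δ, hδ, h⟩ := hVmod (ε / 2) (by positivity)
      refine ⟨Metric.ball x (δ / 2), Metric.ball_mem_nhds _ (by positivity), ?_⟩
      rintro a ha b hb ⟨_, k, rfl⟩
      refine (h k a a.2 b b.2 ?_).trans_lt (by linarith)
      have := dist_triangle_right a b x
      rw [Metric.mem_ball] at ha hb
      exact this.trans_lt (by linarith)
  obtain ⟨f, -, σ, hσ, hlimF⟩ := hcomp.tendsto_subseq fun k => subset_closure (mem_range_self k)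
  have hunif : TendstoUniformlyOn (fun k => V (σ k))
      (Function.extend Subtype.val f 0) atTop (closure Ω) := by
    rw [Metric.tendstoUniformlyOn_iff]
    intro ε hε
    filter_upwards [(Metric.tendsto_nhds.1 hlimF) ε hε] with k hk x hx
    have h1 : Function.extend Subtype.val f 0 x = f ⟨x, hx⟩ :=
      Subtype.val_injective.extend_apply f 0 ⟨x, hx⟩
    rw [h1, dist_comm]
    exact (BoundedContinuousFunction.dist_coe_le_dist (f := F (σ k)) (g := f) ⟨x, hx⟩).trans_lt hk
  exact ⟨σ, fun k => V (σ k), _, hσ, fun k => hVc _, fun k => hVeq _, hunif,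
    hunif.continuousOn (Frequently.of_forall fun k => hVc _)⟩

end Boundary

/-! ### Minimizers of the Rayleigh quotient -/

section Minimizers

variable {n : ℕ} {Ω : Set (𝔼 n)} {u v : (𝔼 n) → ℝ} {G G' : (𝔼 n) → (𝔼 n)} {p Λ : ℝ}

/-- The odd power `|s|^(p-2) s`. -/
def oddPow (p s : ℝ) : ℝ := |s| ^ (p - 2) * s

lemma continuous_oddPow (hp : 2 < p) : Continuous (oddPow p) :=
  (continuous_abs.rpow_const fun _ => Or.inr (by linarith)).mul continuous_id

lemma oddPow_of_nonneg (hp : 2 < p) {s : ℝ} (hs : 0 ≤ s) : oddPow p s = s ^ (p - 1) := by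
  rw [oddPow, abs_of_nonneg hs]
  rcases hs.eq_or_lt with rfl | hs
  · rw [mul_zero, Real.zero_rpow (by linarith)]
  · rw [← Real.rpow_add_one hs.ne']; ring_nf

lemma oddPow_neg (p s : ℝ) : oddPow p (-s) = -oddPow p s := by simp [oddPow]

lemma monotone_oddPow (hp : 2 < p) : Monotone (oddPow p) := by
  have hpos : ∀ {s t : ℝ}, 0 ≤ s → s ≤ t → oddPow p s ≤ oddPow p t := fun hs hst => by
    rw [oddPow_of_nonneg hp hs, oddPow_of_nonneg hp (hs.trans hst)]
    exact Real.rpow_le_rpow hs hst (by linarith)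
  have hsign : ∀ {s : ℝ}, 0 ≤ s → 0 ≤ oddPow p s := fun hs =>
    mul_nonneg (Real.rpow_nonneg (abs_nonneg _) _) hs
  intro s t hst
  rcases le_total 0 s with hs | hs
  · exact hpos hs hst
  · have h1 := oddPow_neg p s
    rcases le_total 0 t with ht | ht
    · linarith [hsign ht, hsign (neg_nonneg.2 hs)]
    · have := hpos (neg_nonneg.2 ht) (neg_le_neg hst)
      rw [oddPow_neg, oddPow_neg] at this
      linarith

/-- The tangent inequality for the convex function `‖x‖ ^ p`. -/
lemma norm_rpow_add_le {E : Type*} [NormedAddCommGroup E] [InnerProductSpace ℝ E] (hp : 2 < p)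
    (a b : E) : ‖a‖ ^ p + p * (‖a‖ ^ (p - 2) * ⟪a, b - a⟫) ≤ ‖b‖ ^ p := by
  have hp0 : 0 < p := by linarith
  rcases eq_or_ne a 0 with rfl | ha
  · have : (0 : ℝ) ^ p = 0 := Real.zero_rpow (by linarith)
    simp only [norm_zero, this, inner_zero_left, mul_zero, add_zero]
    exact Real.rpow_nonneg (norm_nonneg _) _
  have hs : 0 < ‖a‖ := norm_pos_iff.2 ha
  have h1 : ⟪a, b - a⟫ ≤ ‖a‖ * (‖b‖ - ‖a‖) := by
    rw [inner_sub_right, real_inner_self_eq_norm_sq]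
    nlinarith [real_inner_le_norm a b]
  have h2 : ‖a‖ ^ p + p * (‖a‖ ^ (p - 2) * (‖a‖ * (‖b‖ - ‖a‖))) ≤ ‖b‖ ^ p := by
    -- After Cauchy–Schwarz only the norms matter, and the inequality is Bernoulli's for the ratio
    -- `‖b‖ / ‖a‖`.
    have hB := one_add_mul_self_le_rpow_one_add (s := ‖b‖ / ‖a‖ - 1) (p := p)
      (by have : 0 ≤ ‖b‖ / ‖a‖ := by positivity
          linarith) (by linarith)
    rw [add_sub_cancel, Real.div_rpow (norm_nonneg _) hs.le, le_div_iff₀ (by positivity)] at hB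
    refine le_trans (le_of_eq ?_) hB
    have e : ‖a‖ ^ p = ‖a‖ ^ (p - 2) * ‖a‖ ^ 2 := by
      rw [← Real.rpow_natCast ‖a‖ 2, ← Real.rpow_add hs]; norm_num
    rw [e]
    field_simp
  refine le_trans ?_ h2
  gcongr

lemma abs_rpow_add_le (hp : 2 < p) (s t : ℝ) :
    |s| ^ p + p * (oddPow p s * (t - s)) ≤ |t| ^ p := by
  have := norm_rpow_add_le hp s t
  simp only [Real.norm_eq_abs, RCLike.inner_apply, conj_trivial] at this
  refine le_trans (le_of_eq ?_) this
  rw [oddPow]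
  ring

/-- `u`, with weak gradient `G`, attains the infimum `Λ ^ p` of the Rayleigh quotient, and is
normalized. -/
structure Minimizer (Ω : Set (𝔼 n)) (p Λ : ℝ) (u : (𝔼 n) → ℝ) (G : (𝔼 n) → (𝔼 n)) : Prop where
  sobolev : IsSobolevPair Ω p u G
  integral_oddPow : ∫ x in Ω, oddPow p (u x) = 0
  integral_rpow : ∫ x in Ω, |u x| ^ p = volume.real Ω
  nonneg : 0 ≤ Λ
  integral_grad : ∫ x in Ω, ‖G x‖ ^ p = Λ ^ p * volume.real Ω
  le_rayleigh : ∀ v G', IsCompetitor Ω p v G' → Λ ^ p ≤ rayleigh Ω p v G'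

lemma volume_real_pos (hΩ : IsOpen Ω) (hb : Bornology.IsBounded Ω) (hne : Ω.Nonempty) :
    0 < volume.real Ω :=
  ENNReal.toReal_pos (hΩ.measure_pos volume hne).ne' hb.measure_lt_top.ne

/-- Since the infimum is attained, `lambdaP` raised to the power `p` is the quotient of `u`; the
normalization makes its denominator the volume of `Ω`. -/
lemma IsNormalizedMinimizer.exists_minimizer (hvol : 0 < volume.real Ω) (hp : 1 < p)
    (h : IsNormalizedMinimizer Ω p u) : ∃ G, Minimizer Ω p (lambdaP Ω p) u G := by
  obtain ⟨⟨G, hG, hmin⟩, havg⟩ := h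
  have hinteg : ∫ x in Ω, |u x| ^ p = volume.real Ω := by
    rw [setAverage_eq, smul_eq_mul, inv_mul_eq_iff_eq_mul₀ hvol.ne', mul_one] at havg
    exact havg
  have hR0 : 0 ≤ rayleigh Ω p u G :=
    div_nonneg (integral_nonneg fun _ => by positivity) (integral_nonneg fun _ => by positivity)
  have hsInf : sInf {R | ∃ v G, IsCompetitor Ω p v G ∧ R = rayleigh Ω p v G} =
      rayleigh Ω p u G := by
    refine IsLeast.csInf_eq ⟨⟨u, G, hG, rfl⟩, ?_⟩
    rintro _ ⟨v, G', hv, rfl⟩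
    exact hmin v G' hv
  have hpow : lambdaP Ω p ^ p = rayleigh Ω p u G := by
    rw [lambdaP, hsInf, ← Real.rpow_mul hR0, one_div, inv_mul_cancel₀ (by linarith),
      Real.rpow_one]
  refine ⟨G, hG.1, hG.2.1, hinteg, ?_, ?_, fun v G' hv => hpow ▸ hmin v G' hv⟩
  · rw [lambdaP, hsInf]; positivity
  · rw [hpow, rayleigh, hinteg, div_mul_cancel₀ _ hvol.ne']

lemma IsSobolevPair.congr (h : IsSobolevPair Ω p u G) (huv : u =ᵐ[volume.restrict Ω] v)
    (hb : Bornology.IsBounded Ω) (hp : 1 ≤ p) : IsSobolevPair Ω p v G :=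
  ⟨h.1.ae_eq huv, h.2.1, ((h.hasWeakGrad hb hp).congr huv ae_eq_rfl).isWeakGradient⟩

lemma Minimizer.congr (h : Minimizer Ω p Λ u G) (huv : u =ᵐ[volume.restrict Ω] v)
    (hb : Bornology.IsBounded Ω) (hp : 1 ≤ p) : Minimizer Ω p Λ v G := by
  refine ⟨h.sobolev.congr huv hb hp, ?_, ?_, h.nonneg, h.integral_grad, h.le_rayleigh⟩
  · rw [← h.integral_oddPow]
    exact integral_congr_ae (huv.mono fun x hx => by simp only [hx])
  · rw [← h.integral_rpow]
    exact integral_congr_ae (huv.mono fun x hx => by simp only [hx])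

lemma IsSobolevPair.neg (h : IsSobolevPair Ω p u G) (hb : Bornology.IsBounded Ω) (hp : 1 ≤ p) :
    IsSobolevPair Ω p (fun x => -u x) (fun x => -G x) :=
  ⟨h.1.neg, h.2.1.neg, (h.hasWeakGrad hb hp).neg.isWeakGradient⟩

lemma Minimizer.neg (h : Minimizer Ω p Λ u G) (hb : Bornology.IsBounded Ω) (hp : 1 ≤ p) :
    Minimizer Ω p Λ (fun x => -u x) (fun x => -G x) := by
  refine ⟨h.sobolev.neg hb hp, ?_, ?_, h.nonneg, ?_, h.le_rayleigh⟩
  · simp only [oddPow_neg, integral_neg, h.integral_oddPow, neg_zero]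
  · simpa only [abs_neg] using h.integral_rpow
  · simpa only [norm_neg] using h.integral_grad

lemma integrableOn_of_bounded (hb : Bornology.IsBounded Ω) (hΩ : IsOpen Ω) {f : (𝔼 n) → ℝ}
    (hf : AEStronglyMeasurable f (volume.restrict Ω)) {B : ℝ} (hB : ∀ x ∈ Ω, |f x| ≤ B) :
    IntegrableOn f Ω := by
  have := isFiniteMeasure_restrict hb
  refine Integrable.of_bound hf B ?_
  filter_upwards [ae_restrict_mem hΩ.measurableSet] with x hx using hB x hx

lemma integrableOn_comp_of_bounded (hb : Bornology.IsBounded Ω) (hΩ : IsOpen Ω) {f : (𝔼 n) → ℝ}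
    (hf : AEStronglyMeasurable f (volume.restrict Ω)) {B : ℝ} (hB : ∀ x ∈ Ω, |f x| ≤ B)
    {φ : ℝ → ℝ} (hφ : Continuous φ) : IntegrableOn (fun x => φ (f x)) Ω := by
  obtain ⟨D, hD⟩ := (isCompact_Icc (a := -B) (b := B)).exists_bound_of_continuousOn hφ.continuousOn
  exact integrableOn_of_bounded hb hΩ (hφ.comp_aestronglyMeasurable hf)
    fun x hx => hD _ (abs_le.1 (hB x hx))

/-- Every bounded function has a `p`-mean. -/
lemma exists_integral_oddPow_sub_eq_zero (hb : Bornology.IsBounded Ω) (hΩ : IsOpen Ω)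
    (hp : 2 < p) (hv : AEStronglyMeasurable v (volume.restrict Ω)) {B : ℝ}
    (hB : ∀ x ∈ Ω, |v x| ≤ B) : ∃ c, ∫ x in Ω, oddPow p (v x - c) = 0 := by
  rcases Ω.eq_empty_or_nonempty with rfl | ⟨x₁, hx₁⟩
  · exact ⟨0, by simp⟩
  have hB0 : 0 ≤ B := (abs_nonneg _).trans (hB x₁ hx₁)
  have := isFiniteMeasure_restrict hb
  obtain ⟨D, hD⟩ := (isCompact_Icc (a := -(2 * B)) (b := 2 * B)).exists_bound_of_continuousOn
    (continuous_oddPow hp).continuousOn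
  have hcont : ContinuousOn (fun c => ∫ x in Ω, oddPow p (v x - c)) (Icc (-B) B) := by
    refine continuousOn_of_dominated (bound := fun _ => D) (fun c _ => ?_) (fun c hc => ?_)
      (integrable_const D) (Eventually.of_forall fun x => ?_)
    · exact (continuous_oddPow hp).comp_aestronglyMeasurable (hv.sub aestronglyMeasurable_const)
    · filter_upwards [ae_restrict_mem hΩ.measurableSet] with x hx
      have h1 := abs_le.1 (hB x hx)
      exact hD _ ⟨by linarith [hc.2], by linarith [hc.1]⟩
    · exact ((continuous_oddPow hp).comp (continuous_const.sub continuous_id)).continuousOn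
  have hz : oddPow p 0 = 0 := by simp [oddPow]
  have hle : ∫ x in Ω, oddPow p (v x - B) ≤ 0 := by
    refine integral_nonpos_of_ae ?_
    filter_upwards [ae_restrict_mem hΩ.measurableSet] with x hx
    have h1 := abs_le.1 (hB x hx)
    exact (monotone_oddPow hp (by linarith : v x - B ≤ 0)).trans_eq hz
  have hge : 0 ≤ ∫ x in Ω, oddPow p (v x - -B) := by
    refine integral_nonneg_of_ae ?_
    filter_upwards [ae_restrict_mem hΩ.measurableSet] with x hx
    have h1 := abs_le.1 (hB x hx)
    exact hz.symm.trans_le (monotone_oddPow hp (by linarith : 0 ≤ v x - -B))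
  -- The mean of `oddPow p (v - c)` is continuous in `c` and changes sign between `-B` and `B`.
  obtain ⟨c, -, hc⟩ := intermediate_value_Icc' (by linarith : -B ≤ B) hcont ⟨hle, hge⟩
  exact ⟨c, hc⟩

lemma continuous_abs_rpow (hp : 0 < p) : Continuous fun s : ℝ => |s| ^ p :=
  continuous_abs.rpow_const fun _ => Or.inr hp.le

lemma IsSobolevPair.sub_const (h : IsSobolevPair Ω p v G) (hb : Bornology.IsBounded Ω)
    (hΩ : IsOpen Ω) (hp : 1 ≤ p) (c : ℝ) : IsSobolevPair Ω p (fun x => v x - c) G := by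
  have := isFiniteMeasure_restrict hb
  refine ⟨h.1.sub (memLp_const c), h.2.1, ?_⟩
  have hc := hasWeakGrad_of_contDiff hΩ hb (contDiff_const (c := -c))
  have := (h.hasWeakGrad hb hp).add hc
  refine (this.congr (Eventually.of_forall fun x => ?_)
    (Eventually.of_forall fun x => ?_)).isWeakGradient
  · simp only [sub_eq_add_neg]
  · have : ∇ (fun _ : 𝔼 n => -c) x = 0 := by simp [gradient]
    simp only [this, add_zero]

/-- Subtracting the `p`-mean turns any bounded Sobolev function into a competitor, unless the
difference vanishes, in which case there is nothing to prove. -/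
lemma Minimizer.exists_le_integral (h : Minimizer Ω p Λ u G) (hb : Bornology.IsBounded Ω)
    (hΩ : IsOpen Ω) (hp : 2 < p) (hv : IsSobolevPair Ω p v G') {B : ℝ}
    (hB : ∀ x ∈ Ω, |v x| ≤ B) :
    ∃ c, Λ ^ p * ∫ x in Ω, |v x - c| ^ p ≤ ∫ x in Ω, ‖G' x‖ ^ p := by
  obtain ⟨c, hc⟩ := exists_integral_oddPow_sub_eq_zero hb hΩ hp hv.1.1 hB
  refine ⟨c, ?_⟩
  by_cases h0 : ∫ x in Ω, |v x - c| ^ p = 0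
  · rw [h0, mul_zero]
    exact integral_nonneg fun _ => by positivity
  · have hcomp : IsCompetitor Ω p (fun x => v x - c) G' :=
      ⟨hv.sub_const hb hΩ (by linarith) c, hc, h0⟩
    have hpos : 0 < ∫ x in Ω, |v x - c| ^ p :=
      lt_of_le_of_ne (integral_nonneg fun _ => by positivity) (Ne.symm h0)
    exact (le_div_iff₀ hpos).1 (h.le_rayleigh _ _ hcomp)

/-- A minimizer satisfies a global form of the Euler-Lagrange equation. -/
lemma Minimizer.add_integral_le (h : Minimizer Ω p Λ u G) (hb : Bornology.IsBounded Ω)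
    (hΩ : IsOpen Ω) (hp : 2 < p) (hv : IsSobolevPair Ω p v G') {B : ℝ}
    (hu : ∀ x ∈ Ω, |u x| ≤ B) (hB : ∀ x ∈ Ω, |v x| ≤ B) :
    (∫ x in Ω, ‖G x‖ ^ p) + Λ ^ p * (p * ∫ x in Ω, oddPow p (u x) * (v x - u x)) ≤
      ∫ x in Ω, ‖G' x‖ ^ p := by
  obtain ⟨c, hc⟩ := h.exists_le_integral hb hΩ hp hv hB
  -- The tangent inequality at `u` bounds `|v - c| ^ p` from below, and the constant `c` drops out
  -- because `oddPow p u` has integral zero. The constraint thus leaves no trace in the conclusion.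
  refine le_trans ?_ hc
  rw [h.integral_grad, ← h.integral_rpow, ← mul_add]
  refine mul_le_mul_of_nonneg_left ?_ (Real.rpow_nonneg h.nonneg _)
  have hum := h.sobolev.1.1
  have hvm := hv.1.1
  have i1 : IntegrableOn (fun x => |u x| ^ p) Ω :=
    integrableOn_comp_of_bounded hb hΩ hum hu (continuous_abs_rpow (by linarith))
  have i2 : IntegrableOn (fun x => oddPow p (u x)) Ω :=
    integrableOn_comp_of_bounded hb hΩ hum hu (continuous_oddPow hp)
  have i3 : IntegrableOn (fun x => v x - u x) Ω :=
    (integrableOn_of_bounded hb hΩ hvm hB).sub (integrableOn_of_bounded hb hΩ hum hu)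
  have i4 : IntegrableOn (fun x => oddPow p (u x) * (v x - u x)) Ω := by
    refine Integrable.mul_bdd (c := B + B) i2 i3.aestronglyMeasurable ?_
    filter_upwards [ae_restrict_mem hΩ.measurableSet] with x hx
    exact (norm_sub_le _ _).trans (add_le_add (hB x hx) (hu x hx))
  have i5 : IntegrableOn (fun x => |v x - c| ^ p) Ω :=
    integrableOn_comp_of_bounded hb hΩ hvm hB (φ := fun s => |s - c| ^ p)
      ((continuous_abs_rpow (by linarith)).comp (continuous_id.sub continuous_const))
  have i6 : IntegrableOn (fun x => oddPow p (u x) * (v x - u x) - oddPow p (u x) * c) Ω :=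
    i4.sub (i2.mul_const c)
  calc (∫ x in Ω, |u x| ^ p) + p * ∫ x in Ω, oddPow p (u x) * (v x - u x)
      = (∫ x in Ω, |u x| ^ p) +
          p * ∫ x in Ω, (oddPow p (u x) * (v x - u x) - oddPow p (u x) * c) := by
        rw [integral_sub i4 (i2.mul_const c), integral_mul_const, h.integral_oddPow]
        ring
    _ = ∫ x in Ω, (|u x| ^ p +
          p * (oddPow p (u x) * (v x - u x) - oddPow p (u x) * c)) := by
        rw [integral_add i1 (i6.const_mul p), integral_const_mul]
    _ ≤ ∫ x in Ω, |v x - c| ^ p := by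
        refine integral_mono (i1.add (i6.const_mul p)) i5 fun x => ?_
        have := abs_rpow_add_le hp (u x) (v x - c)
        refine le_trans (le_of_eq ?_) this
        ring

lemma Minimizer.integrableOn_grad (h : Minimizer Ω p Λ u G) (hp : 0 < p) :
    IntegrableOn (fun x => ‖G x‖ ^ p) Ω := by
  have := h.sobolev.2.1.integrable_norm_rpow (by simpa using hp) (by simp)
  simpa only [IntegrableOn, ENNReal.toReal_ofReal hp.le] using this

lemma Minimizer.integral_grad_div_le (h : Minimizer Ω p Λ u G) {a : ℝ} (ha : 0 < a)
    (hΛ : Λ ≤ a) (hp : 0 < p) : ∫ x in Ω, (‖G x‖ / a) ^ p ≤ volume.real Ω := by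
  simp only [Real.div_rpow (norm_nonneg _) ha.le]
  rw [integral_div, h.integral_grad, div_le_iff₀ (by positivity), mul_comm]
  gcongr
  exact h.nonneg

lemma Minimizer.integrableOn_grad_div (h : Minimizer Ω p Λ u G) {a : ℝ} (ha : 0 < a)
    (hp : 0 < p) : IntegrableOn (fun x => (‖G x‖ / a) ^ p) Ω := by
  simp only [Real.div_rpow (norm_nonneg _) ha.le]
  exact (h.integrableOn_grad hp).div_const _

/-- Apply `r ^ m ≤ 1 + r ^ p` to `r = ‖G‖ / a`, whose `p`-th power has integral at most the volume
of `Ω`. The bound does not involve `p`, which gives uniformity along the sequence. -/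
lemma Minimizer.integral_grad_pow (h : Minimizer Ω p Λ u G) (hb : Bornology.IsBounded Ω)
    {a : ℝ} (ha : 0 < a) (hΛ : Λ ≤ a) {m : ℕ} (hm : 0 < m) (hmp : (m : ℝ) ≤ p) :
    IntegrableOn (fun x => ‖G x‖ ^ m) Ω ∧
      ∫ x in Ω, ‖G x‖ ^ m ≤ a ^ m * (2 * volume.real Ω) := by
  have := isFiniteMeasure_restrict hb
  have hp : 0 < p := lt_of_lt_of_le (by exact_mod_cast hm) hmp
  have hpt : ∀ r : ℝ, 0 ≤ r → r ^ m ≤ 1 + r ^ p := by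
    intro r hr
    rcases le_total r 1 with h1 | h1
    · have := Real.rpow_nonneg hr p
      linarith [pow_le_one₀ (n := m) hr h1]
    · rw [← Real.rpow_natCast]
      linarith [Real.rpow_le_rpow_of_exponent_le h1 hmp]
  have hid := h.integrableOn_grad_div ha hp
  have hinteg : IntegrableOn (fun x => a ^ m * (1 + (‖G x‖ / a) ^ p)) Ω :=
    ((integrable_const _).add hid).const_mul _
  have hle : ∀ x, ‖G x‖ ^ m ≤ a ^ m * (1 + (‖G x‖ / a) ^ p) := by
    intro x
    have := hpt (‖G x‖ / a) (by positivity)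
    rw [div_pow, div_le_iff₀ (by positivity)] at this
    linarith
  have hi : IntegrableOn (fun x => ‖G x‖ ^ m) Ω :=
    Integrable.mono' hinteg (h.sobolev.2.1.1.norm.pow m)
      (Eventually.of_forall fun x => by
        rw [Real.norm_of_nonneg (by positivity)]; exact hle x)
  refine ⟨hi, (integral_mono hi hinteg hle).trans ?_⟩
  rw [integral_const_mul, integral_add (integrable_const _) hid]
  gcongr
  have := h.integral_grad_div_le ha hΛ hp
  simp only [integral_const, MeasurableSet.univ, measureReal_restrict_apply, univ_inter,
    smul_eq_mul, mul_one]
  linarith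

/-- Continuous representatives of minimizers, with a uniform interior Hölder estimate. -/
lemma Minimizer.exists_representative (hn : 0 < n) (h : Minimizer Ω p Λ u G)
    (hb : Bornology.IsBounded Ω) (hΩ : IsOpen Ω) {a : ℝ} (ha : 0 < a) (hΛ : Λ ≤ a)
    (hp : (2 * n : ℝ) ≤ p) :
    ∃ w, InteriorHolder Ω
      (8 * (unitVol n + a ^ (2 * n) * (2 * volume.real Ω)) / unitVol n) w ∧
      u =ᵐ[volume.restrict Ω] w := by
  have hn' : (1 : ℝ) ≤ n := by exact_mod_cast hn
  have hw := h.sobolev.hasWeakGrad hb (by linarith)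
  obtain ⟨h1, h2⟩ := h.integral_grad_pow hb ha hΛ (m := 2 * n) (by omega) (by exact_mod_cast hp)
  have hu := unitVol_pos n
  exact exists_interiorHolder_representative hΩ hw
    (by have : 0 ≤ volume.real Ω := measureReal_nonneg
        positivity)
    fun z τ hτ hz => setIntegral_ball_norm_le_of_integral_pow hn hw.2.1 h1 h2 z hτ hz

/-- Uniform bound for normalized functions with a common interior Hölder estimate. -/
lemma exists_uniform_bound (hΩ : IsOpen Ω) (hb : Bornology.IsBounded Ω)
    (hlip : HasLipschitzBoundary Ω) {C : ℝ} (hC : 0 ≤ C) :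
    ∃ B, ∀ (w : (𝔼 n) → ℝ) (p : ℝ), 1 ≤ p → InteriorHolder Ω C w →
      IntegrableOn (fun x => |w x| ^ p) Ω → ∫ x in Ω, |w x| ^ p = volume.real Ω →
      ∀ x ∈ Ω, |w x| ≤ B := by
  obtain ⟨δ, hδ, hmod⟩ := exists_modulus hΩ hb hlip hC one_pos
  obtain ⟨t, -, htf, htΩ⟩ := hb.isCompact_closure.finite_cover_balls (half_pos hδ)
  -- If `|w| > K y` held throughout the piece around `y`, the integral of `|w| ^ p` there would be
  -- at least the volume of the piece plus that of `Ω`, against the normalization. So each piece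
  -- that meets `Ω` has a point with `|w| ≤ K y`, and the modulus adds at most 1.
  set K : (𝔼 n) → ℝ := fun y => 1 + volume.real Ω / volume.real (Ω ∩ Metric.ball y (δ / 2)) with hK
  have hK1 : ∀ y, 1 ≤ K y := fun y => by
    have : 0 ≤ volume.real Ω / volume.real (Ω ∩ Metric.ball y (δ / 2)) := by positivity
    simp only [hK]; linarith
  refine ⟨1 + ∑ y ∈ htf.toFinset, K y, fun w p hp hw hinteg hnorm x hx => ?_⟩
  obtain ⟨y, hyt, hxy⟩ := mem_iUnion₂.1 (htΩ (subset_closure hx))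
  set S := Ω ∩ Metric.ball y (δ / 2) with hS
  have hSo : IsOpen S := hΩ.inter Metric.isOpen_ball
  have hSpos : 0 < volume.real S :=
    volume_real_pos hSo (hb.subset inter_subset_left) ⟨x, hx, hxy⟩
  have hle : K y ≤ ∑ y ∈ htf.toFinset, K y :=
    Finset.single_le_sum (f := K) (fun z _ => (zero_le_one.trans (hK1 z)))
      (htf.mem_toFinset.2 hyt)
  obtain ⟨z, hzS, hz⟩ : ∃ z ∈ S, |w z| ≤ K y := by
    by_contra hcon
    push Not at hcon
    have hfin : volume S < ⊤ := (hb.subset inter_subset_left).measure_lt_top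
    have h1 : K y * volume.real S ≤ ∫ x in S, |w x| ^ p := by
      have : ∫ x in S, K y = K y * volume.real S := by simp [mul_comm]
      rw [← this]
      refine setIntegral_mono_on (integrableOn_const hfin.ne) (hinteg.mono_set inter_subset_left)
        hSo.measurableSet fun z hz => ?_
      have h2 := (hcon z hz).le
      calc K y ≤ |w z| := h2
        _ = |w z| ^ (1 : ℝ) := (Real.rpow_one _).symm
        _ ≤ |w z| ^ p := Real.rpow_le_rpow_of_exponent_le ((hK1 y).trans h2) hp
    have h2 : ∫ x in S, |w x| ^ p ≤ volume.real Ω := by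
      rw [← hnorm]
      exact setIntegral_mono_set hinteg (Eventually.of_forall fun x => by positivity)
        (inter_subset_left : S ⊆ Ω).eventuallyLE
    have h3 : K y * volume.real S = volume.real S + volume.real Ω := by
      simp only [hK, ← hS]; field_simp
    linarith
  have hxz : dist x z < δ := by
    have := dist_triangle_right x z y
    linarith [Metric.mem_ball.1 hxy, Metric.mem_ball.1 hzS.2]
  have := hmod w hw x hx z hzS.1 hxz
  have h4 := abs_sub_abs_le_abs_sub (w x) (w z)
  linarith

end Minimizers

/-! ### The geodesic distance -/

section Geodesic

variable {n : ℕ} {Ω : Set (𝔼 n)}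

/-- Split the interval at 1/2; on each half the concatenation is a monotone reparametrization of one
path, which cannot increase the variation. -/
lemma eVariationOn_trans_le {x y z : 𝔼 n} (γ : Path x y) (γ' : Path y z) :
    eVariationOn (γ.trans γ') univ ≤ eVariationOn γ univ + eVariationOn γ' univ := by
  set h : unitInterval := ⟨1 / 2, by constructor <;> norm_num⟩ with hh
  have e := eVariationOn.Icc_add_Icc (γ.trans γ') (s := univ) (a := 0) (b := h) (c := 1)
    h.2.1 h.2.2 (mem_univ _)
  simp only [univ_inter] at e
  have hu : Icc (0 : unitInterval) 1 = univ := eq_univ_of_forall fun t => ⟨t.2.1, t.2.2⟩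
  rw [hu] at e
  rw [← e]
  refine add_le_add ?_ ?_
  · have h1 : EqOn (γ.trans γ')
        (γ ∘ fun t : unitInterval => projIcc (0 : ℝ) 1 zero_le_one (2 * (t : ℝ))) (Icc 0 h) := by
      intro t ht
      have ht' : (t : ℝ) ≤ 1 / 2 := ht.2
      have hm : 2 * (t : ℝ) ∈ Icc (0 : ℝ) 1 := ⟨by linarith [t.2.1], by linarith⟩
      rw [Path.trans_apply, dif_pos ht', Function.comp_apply, projIcc_of_mem _ hm]
    rw [eVariationOn.eq_of_eqOn h1]
    refine eVariationOn.comp_le_of_monotoneOn _ _ (fun s _ t _ hst => ?_) (mapsTo_univ _ _)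
    exact monotone_projIcc _ (by have : (s : ℝ) ≤ t := hst; linarith)
  · have h1 : EqOn (γ.trans γ')
        (γ' ∘ fun t : unitInterval => projIcc (0 : ℝ) 1 zero_le_one (2 * (t : ℝ) - 1))
        (Icc h 1) := by
      intro t ht
      have ht' : 1 / 2 ≤ (t : ℝ) := ht.1
      have hm : 2 * (t : ℝ) - 1 ∈ Icc (0 : ℝ) 1 := ⟨by linarith, by linarith [t.2.2]⟩
      rw [Path.trans_apply, Function.comp_apply, projIcc_of_mem _ hm]
      split_ifs with hle
      · have hte : (t : ℝ) = 1 / 2 := le_antisymm hle ht'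
        have e1 : (⟨2 * (t : ℝ), by constructor <;> linarith⟩ : unitInterval) = 1 :=
          Subtype.ext (by simp [hte])
        have e2 : (⟨2 * (t : ℝ) - 1, hm⟩ : unitInterval) = 0 := Subtype.ext (by simp [hte])
        rw [e2, γ'.source]
        exact (congrArg γ e1).trans γ.target
      · rfl
    rw [eVariationOn.eq_of_eqOn h1]
    refine eVariationOn.comp_le_of_monotoneOn _ _ (fun s _ t _ hst => ?_) (mapsTo_univ _ _)
    exact monotone_projIcc _ (by have : (s : ℝ) ≤ t := hst; linarith)

lemma eVariationOn_segment_le (x y : 𝔼 n) : eVariationOn (Path.segment x y) univ ≤ edist x y := by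
  have hl : LipschitzOnWith (nndist x y) (fun t : ℝ => AffineMap.lineMap x y t) univ :=
    (lipschitzWith_lineMap x y).lipschitzOnWith
  have h1 := hl.comp_eVariationOn_le (g := ((↑) : unitInterval → ℝ)) (s := univ) (mapsTo_univ _ _)
  have hm : MonotoneOn ((↑) : unitInterval → ℝ) univ := fun s _ t _ h => h
  have h2 := hm.eVariationOn_eq (mem_univ (0 : unitInterval)) (mem_univ (1 : unitInterval))
  have hu : Icc (0 : unitInterval) 1 = univ := eq_univ_of_forall fun t => ⟨t.2.1, t.2.2⟩
  rw [hu, univ_inter] at h2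
  rw [h2] at h1
  simp only [Icc.coe_one, Icc.coe_zero, sub_zero, ENNReal.ofReal_one,
    mul_one] at h1
  rw [edist_nndist]
  exact h1

/-- Append to any curve ending at `x` the segment from `x` to `y`, which stays in the ball. So the
geodesic distance is 1-Lipschitz on balls in `Ω`, with respect to the Euclidean distance. -/
lemma geodesicDist_le_add_edist {x₀ x y z : 𝔼 n} {s : ℝ} (hz : Metric.ball z s ⊆ Ω)
    (hx : x ∈ Metric.ball z s) (hy : y ∈ Metric.ball z s) :
    geodesicDist Ω x₀ y ≤ geodesicDist Ω x₀ x + edist x y := by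
  rw [geodesicDist, geodesicDist, ENNReal.iInf_add]
  refine le_iInf fun γ => ?_
  by_cases hγ : ∀ t, γ t ∈ Ω
  · rw [iInf_pos hγ]
    refine (iInf_le _ (γ.trans (Path.segment x y))).trans ?_
    rw [iInf_pos]
    · exact (eVariationOn_trans_le _ _).trans (by gcongr; exact eVariationOn_segment_le x y)
    · intro t
      have hr : (γ.trans (Path.segment x y)) t ∈ range (γ.trans (Path.segment x y)) :=
        mem_range_self t
      rw [Path.trans_range] at hr
      rcases hr with ⟨t', ht'⟩ | ⟨t', ht'⟩
      · rw [← ht']; exact hγ t'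
      · rw [← ht']
        exact hz ((convex_ball z s).lineMap_mem hx hy t'.2)
  · rw [iInf_neg hγ]; simp

lemma geodesicDist_self {x : 𝔼 n} (hx : x ∈ Ω) : geodesicDist Ω x x = 0 := by
  refine le_antisymm ((iInf₂_le (Path.refl x) fun t => hx).trans ?_) zero_le
  refine (eVariationOn.constant_on ?_).le
  rintro _ ⟨_, _, rfl⟩ _ ⟨_, _, rfl⟩
  rfl

lemma edist_le_geodesicDist (x y : 𝔼 n) : edist x y ≤ geodesicDist Ω x y := by
  refine le_iInf₂ fun γ _ => ?_
  have := eVariationOn.edist_le γ (mem_univ (0 : unitInterval)) (mem_univ (1 : unitInterval))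
  rwa [γ.source, γ.target] at this

/-- A function which is `a`-Lipschitz on small balls is `a`-Lipschitz along curves. -/
lemma edist_le_mul_eVariationOn {w : (𝔼 n) → ℝ} {a : ℝ≥0}
    (hw : ∀ z ∈ Ω, ∃ s > 0, LipschitzOnWith a w (Metric.ball z s)) {x y : 𝔼 n} (γ : Path x y)
    (hγ : ∀ t, γ t ∈ Ω) : edist (w x) (w y) ≤ a * eVariationOn γ univ := by
  choose! s hs hsw using hw
  -- By compactness the curve splits into finitely many arcs, each inside one ball on which `w` is
  -- Lipschitz; the variations add up.
  obtain ⟨t, ht0, htm, ⟨N, hN⟩, htc⟩ := exists_monotone_Icc_subset_open_cover_unitInterval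
    (c := fun τ : unitInterval => γ ⁻¹' Metric.ball (γ τ) (s (γ τ)))
    (fun τ => Metric.isOpen_ball.preimage γ.continuous)
    (fun τ _ => mem_iUnion.2 ⟨τ, Metric.mem_ball_self (hs _ (hγ τ))⟩)
  have key : ∀ m, edist (w x) (w (γ (t m))) ≤ a * eVariationOn γ (univ ∩ Icc 0 (t m)) := by
    intro m
    induction m with
    | zero => simp [ht0]
    | succ m ih =>
      obtain ⟨τ, hτ⟩ := htc m
      have hle := htm (Nat.le_succ m)
      have h1 : edist (w (γ (t m))) (w (γ (t (m + 1)))) ≤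
          a * eVariationOn γ (univ ∩ Icc (t m) (t (m + 1))) := by
        refine (hsw _ (hγ τ) (hτ ⟨le_rfl, hle⟩) (hτ ⟨hle, le_rfl⟩)).trans ?_
        gcongr
        exact eVariationOn.edist_le γ ⟨mem_univ _, le_rfl, hle⟩ ⟨mem_univ _, hle, le_rfl⟩
      refine (edist_triangle _ (w (γ (t m))) _).trans ((add_le_add ih h1).trans_eq ?_)
      rw [← mul_add, eVariationOn.Icc_add_Icc γ (t m).2.1 hle (mem_univ _)]
  have := key N
  rw [hN N le_rfl, γ.target] at this
  exact this.trans (by gcongr; exact eVariationOn.mono _ inter_subset_left)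

lemma edist_le_mul_geodesicDist {w : (𝔼 n) → ℝ} {a : ℝ≥0} (ha : a ≠ 0)
    (hw : ∀ z ∈ Ω, ∃ s > 0, LipschitzOnWith a w (Metric.ball z s)) (x y : 𝔼 n) :
    edist (w x) (w y) ≤ a * geodesicDist Ω x y := by
  have ha' : (a : ℝ≥0∞) ≠ 0 := by exact_mod_cast ha
  rw [mul_comm, ← ENNReal.div_le_iff ha' ENNReal.coe_ne_top]
  refine le_iInf₂ fun γ hγ => ?_
  rw [ENNReal.div_le_iff ha' ENNReal.coe_ne_top, mul_comm]
  exact edist_le_mul_eVariationOn hw γ hγ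

/-- The geodesic distance to `x₀`, truncated at `D`. -/
def truncDist (Ω : Set (𝔼 n)) (x₀ : 𝔼 n) (D : ℝ) (x : 𝔼 n) : ℝ :=
  (min (geodesicDist Ω x₀ x) (ENNReal.ofReal D)).toReal

lemma truncDist_nonneg (x₀ : 𝔼 n) (D : ℝ) (x : 𝔼 n) : 0 ≤ truncDist Ω x₀ D x :=
  ENNReal.toReal_nonneg

lemma truncDist_le {x₀ : 𝔼 n} {D : ℝ} (hD : 0 ≤ D) (x : 𝔼 n) : truncDist Ω x₀ D x ≤ D :=
  ENNReal.toReal_le_of_le_ofReal hD (min_le_right _ _)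

lemma truncDist_le_add {x₀ x y z : 𝔼 n} {s D : ℝ} (hz : Metric.ball z s ⊆ Ω)
    (hx : x ∈ Metric.ball z s) (hy : y ∈ Metric.ball z s) :
    truncDist Ω x₀ D y ≤ truncDist Ω x₀ D x + dist x y := by
  have h1 := geodesicDist_le_add_edist (x₀ := x₀) hz hx hy
  have h2 : min (geodesicDist Ω x₀ y) (ENNReal.ofReal D) ≤
      min (geodesicDist Ω x₀ x) (ENNReal.ofReal D) + edist x y := by
    rw [min_add]
    exact min_le_min h1 le_self_add
  have hfin : min (geodesicDist Ω x₀ x) (ENNReal.ofReal D) ≠ ⊤ :=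
    (min_le_right _ _).trans_lt ENNReal.ofReal_lt_top |>.ne
  have h3 := ENNReal.toReal_mono (ENNReal.add_ne_top.2 ⟨hfin, edist_ne_top x y⟩) h2
  rwa [ENNReal.toReal_add hfin (edist_ne_top x y), edist_dist,
    ENNReal.toReal_ofReal dist_nonneg] at h3

lemma lipschitzOnWith_truncDist {x₀ z : 𝔼 n} {s D : ℝ} (hz : Metric.ball z s ⊆ Ω) :
    LipschitzOnWith 1 (truncDist Ω x₀ D) (Metric.ball z s) := by
  refine LipschitzOnWith.of_le_add fun x hx y hy => ?_
  rw [dist_comm]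
  exact truncDist_le_add hz hy hx

lemma norm_gradient_truncDist_le (hΩ : IsOpen Ω) {x₀ x : 𝔼 n} {D : ℝ} (hx : x ∈ Ω) :
    ‖∇ (truncDist Ω x₀ D) x‖ ≤ 1 := by
  obtain ⟨s, hs, hsΩ⟩ := Metric.isOpen_iff.1 hΩ x hx
  rw [gradient, LinearIsometryEquiv.norm_map]
  exact_mod_cast norm_fderiv_le_of_lipschitzOn ℝ (Metric.ball_mem_nhds x hs)
    (lipschitzOnWith_truncDist hsΩ)

lemma measurable_gradient (f : (𝔼 n) → ℝ) : Measurable (∇ f) :=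
  (LinearIsometryEquiv.continuous _).measurable.comp (measurable_fderiv ℝ f)

lemma locallyLipschitzOn_truncDist (hΩ : IsOpen Ω) (x₀ : 𝔼 n) (D : ℝ) :
    LocallyLipschitzOn Ω (truncDist Ω x₀ D) := by
  intro x hx
  obtain ⟨s, hs, hsΩ⟩ := Metric.isOpen_iff.1 hΩ x hx
  exact ⟨1, Metric.ball x s, mem_nhdsWithin_of_mem_nhds (Metric.ball_mem_nhds x hs),
    lipschitzOnWith_truncDist hsΩ⟩

lemma isSobolevPair_truncDist (hΩ : IsOpen Ω) (hb : Bornology.IsBounded Ω) (x₀ : 𝔼 n) {D : ℝ}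
    (hD : 0 ≤ D) (p : ℝ) :
    IsSobolevPair Ω p (truncDist Ω x₀ D) (∇ (truncDist Ω x₀ D)) := by
  have := isFiniteMeasure_restrict hb
  have hl := locallyLipschitzOn_truncDist hΩ x₀ D
  have hm : AEStronglyMeasurable (truncDist Ω x₀ D) (volume.restrict Ω) :=
    hl.continuousOn.aestronglyMeasurable hΩ.measurableSet
  have hm' : AEStronglyMeasurable (∇ (truncDist Ω x₀ D)) (volume.restrict Ω) :=
    (measurable_gradient _).aestronglyMeasurable
  have hb1 : ∀ᵐ x ∂volume.restrict Ω, ‖truncDist Ω x₀ D x‖ ≤ D :=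
    Eventually.of_forall fun x => by
      rw [Real.norm_of_nonneg (truncDist_nonneg _ _ _)]; exact truncDist_le hD x
  have hb2 : ∀ᵐ x ∂volume.restrict Ω, ‖∇ (truncDist Ω x₀ D) x‖ ≤ 1 := by
    filter_upwards [ae_restrict_mem hΩ.measurableSet] with x hx
      using norm_gradient_truncDist_le hΩ hx
  exact ⟨MemLp.of_bound hm D hb1, MemLp.of_bound hm' 1 hb2,
    (hasWeakGrad_of_locallyLipschitzOn hΩ hl (Integrable.of_bound hm D hb1)
      (Integrable.of_bound hm' 1 hb2)).isWeakGradient⟩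

/-- Testing the Rayleigh quotient with the distance function. -/
lemma exists_rayleigh_bound (hΩ : IsOpen Ω) (hb : Bornology.IsBounded Ω) {x₀ y₀ : 𝔼 n}
    (hx₀ : x₀ ∈ Ω) (hy₀ : y₀ ∈ Ω) {D ε : ℝ} (hD : ENNReal.ofReal D ≤ geodesicDist Ω x₀ y₀)
    (hε : 0 < ε) (hεD : ε < D / 2) :
    ∃ κ > 0, ∀ p Λ u G, 2 < p → Minimizer Ω p Λ u G →
      Λ ^ p * (κ * (D / 2 - ε) ^ p) ≤ volume.real Ω := by
  have := isFiniteMeasure_restrict hb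
  have hD0 : 0 ≤ D := by linarith
  set v := truncDist Ω x₀ D with hv
  obtain ⟨r₁, hr₁, hr₁Ω⟩ := Metric.isOpen_iff.1 hΩ x₀ hx₀
  obtain ⟨r₂, hr₂, hr₂Ω⟩ := Metric.isOpen_iff.1 hΩ y₀ hy₀
  set r := min ε (min r₁ r₂) with hr
  have hr0 : 0 < r := by positivity
  have hrε : r ≤ ε := min_le_left _ _
  have hs₁ : Metric.ball x₀ r ⊆ Ω :=
    (Metric.ball_subset_ball ((min_le_right _ _).trans (min_le_left _ _))).trans hr₁Ω
  have hs₂ : Metric.ball y₀ r ⊆ Ω :=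
    (Metric.ball_subset_ball ((min_le_right _ _).trans (min_le_right _ _))).trans hr₂Ω
  have hvx : v x₀ = 0 := by simp [hv, truncDist, geodesicDist_self hx₀]
  have hvy : v y₀ = D := by
    rw [hv, truncDist, min_eq_right hD, ENNReal.toReal_ofReal hD0]
  have hb₁ : ∀ x ∈ Metric.ball x₀ r, v x ≤ ε := fun x hx => by
    have := truncDist_le_add (x₀ := x₀) (D := D) hs₁ (Metric.mem_ball_self hr0) hx
    rw [← hv, hvx, dist_comm] at this
    linarith [Metric.mem_ball.1 hx]
  have hb₂ : ∀ x ∈ Metric.ball y₀ r, D - ε ≤ v x := fun x hx => by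
    have := truncDist_le_add (x₀ := x₀) (D := D) hs₂ hx (Metric.mem_ball_self hr0)
    rw [← hv, hvy] at this
    linarith [Metric.mem_ball.1 hx]
  -- The constant `κ` is the volume of a ball of radius `r`, hence independent of `p`.
  refine ⟨r ^ n * unitVol n, by have := unitVol_pos n; positivity, fun p Λ u G hp h => ?_⟩
  have hbd : ∀ x ∈ Ω, |v x| ≤ D := fun x _ => by
    rw [abs_of_nonneg (truncDist_nonneg _ _ _)]; exact truncDist_le hD0 x
  have hS := isSobolevPair_truncDist hΩ hb x₀ hD0 p
  obtain ⟨c, hc⟩ := h.exists_le_integral hb hΩ hp hS hbd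
  have hi : IntegrableOn (fun x => |v x - c| ^ p) Ω :=
    integrableOn_comp_of_bounded hb hΩ hS.1.1 hbd (φ := fun s => |s - c| ^ p)
      ((continuous_abs_rpow (by linarith)).comp (continuous_id.sub continuous_const))
  have hgen : ∀ z : 𝔼 n, Metric.ball z r ⊆ Ω → (∀ x ∈ Metric.ball z r, D / 2 - ε ≤ |v x - c|) →
      r ^ n * unitVol n * (D / 2 - ε) ^ p ≤ ∫ x in Ω, |v x - c| ^ p := by
    intro z hz hzv
    refine le_trans ?_ (setIntegral_mono_set hi (Eventually.of_forall fun x => by positivity)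
      hz.eventuallyLE)
    rw [← volume_real_ball z hr0]
    have : ∫ x in Metric.ball z r, (D / 2 - ε) ^ p =
        volume.real (Metric.ball z r) * (D / 2 - ε) ^ p := by simp
    rw [← this]
    refine setIntegral_mono_on (integrableOn_const measure_ball_lt_top.ne) (hi.mono_set hz)
      measurableSet_ball fun x hx => ?_
    exact Real.rpow_le_rpow (by linarith) (hzv x hx) (by linarith)
  -- The function is at most `ε` near `x₀` and at least `D - ε` near `y₀`. On whichever side of `D /
  -- 2` the mean `c` lies, one of the two balls has `|v - c| ≥ D / 2 - ε`.
  have hlow : r ^ n * unitVol n * (D / 2 - ε) ^ p ≤ ∫ x in Ω, |v x - c| ^ p := by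
    rcases le_total (D / 2) c with h2 | h2
    · refine hgen x₀ hs₁ fun x hx => ?_
      rw [abs_sub_comm]
      exact le_trans (by linarith [hb₁ x hx]) (le_abs_self _)
    · exact hgen y₀ hs₂ fun x hx => le_trans (by linarith [hb₂ x hx]) (le_abs_self _)
  refine (mul_le_mul_of_nonneg_left hlow (Real.rpow_nonneg h.nonneg _)).trans (hc.trans ?_)
  have : ∫ x in Ω, (1 : ℝ) = volume.real Ω := by simp
  rw [← this]
  refine integral_mono_of_nonneg (Eventually.of_forall fun x => by positivity)
    (integrable_const _) ?_
  filter_upwards [ae_restrict_mem hΩ.measurableSet] with x hx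
  exact Real.rpow_le_one (norm_nonneg _) (norm_gradient_truncDist_le hΩ hx) (by linarith)

end Geodesic

/-! ### Convergence of the eigenvalues -/

section Convergence

variable {n : ℕ} {Ω : Set (𝔼 n)}

/-- Bernoulli's inequality. The factor `1 / p` makes the excess over 1 vanish as `p → ∞` when `t ^
p` is bounded in the mean. -/
lemma le_one_add_rpow_div {t p : ℝ} (ht : 0 ≤ t) (hp : 1 ≤ p) : t ≤ 1 + t ^ p / p := by
  have h := one_add_mul_self_le_rpow_one_add (s := t - 1) (p := p) (by linarith) hp
  rw [add_sub_cancel] at h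
  have hp0 : 0 < p := by linarith
  have : t - 1 ≤ t ^ p / p := by
    rw [le_div_iff₀ hp0]; linarith
  linarith

lemma eventually_lt_rpow {p : ℕ → ℝ} (hp : Tendsto p atTop atTop) {b : ℝ} (hb : 1 < b) (M : ℝ) :
    ∀ᶠ k in atTop, M < b ^ p k := by
  filter_upwards [hp.eventually_ge_atTop 1, hp.eventually_gt_atTop (M / (b - 1))] with k h1 h2
  have h := one_add_mul_self_le_rpow_one_add (s := b - 1) (p := p k) (by linarith) h1
  rw [add_sub_cancel] at h
  rw [div_lt_iff₀ (by linarith)] at h2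
  linarith

/-- Apply `t ≤ 1 + t ^ p / p` to `‖G‖ / a` under the mollification integral. At a fixed scale the
error is of order `1 / p`, so the bound `a` in the limit comes with the sharp constant. -/
lemma Minimizer.norm_mollify_grad_le {p Λ a : ℝ} {u : (𝔼 n) → ℝ} {G : (𝔼 n) → (𝔼 n)}
    (h : Minimizer Ω p Λ u G) (hΩ : IsOpen Ω) (hb : Bornology.IsBounded Ω) (hp : 1 ≤ p)
    (ha : 0 < a) (hΛ : Λ ≤ a) {j : ℕ} {R : ℝ} (hR : ∀ x : 𝔼 n, mol n j x ≤ R) (x : 𝔼 n) :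
    ‖mollify j (Ω.indicator G) x‖ ≤ a + a * R * volume.real Ω / p := by
  have hp0 : 0 < p := by linarith
  have hR0 : 0 ≤ R := (mol_nonneg j x).trans (hR x)
  have hGi : Integrable (Ω.indicator G) :=
    (h.sobolev.hasWeakGrad hb hp).2.1.integrable_indicator hΩ.measurableSet
  have hqi : Integrable (Ω.indicator fun y => (‖G y‖ / a) ^ p) :=
    (h.integrableOn_grad_div ha hp0).integrable_indicator hΩ.measurableSet
  have hpt : ∀ y, mol n j (x - y) * ‖Ω.indicator G y‖ ≤
      mol n j (x - y) * a + a * R / p * Ω.indicator (fun y => (‖G y‖ / a) ^ p) y := by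
    intro y
    have hm := mol_nonneg j (x - y)
    by_cases hy : y ∈ Ω
    · simp only [indicator_of_mem hy]
      have h1 := le_one_add_rpow_div (t := ‖G y‖ / a) (by positivity) hp
      have hq : 0 ≤ (‖G y‖ / a) ^ p / p := by positivity
      have h2 : ‖G y‖ ≤ a + a * ((‖G y‖ / a) ^ p / p) := by
        rw [div_le_iff₀ ha] at h1; linarith
      calc mol n j (x - y) * ‖G y‖ ≤ mol n j (x - y) * (a + a * ((‖G y‖ / a) ^ p / p)) := by gcongr
        _ = mol n j (x - y) * a + mol n j (x - y) * (a * ((‖G y‖ / a) ^ p / p)) := by ring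
        _ ≤ mol n j (x - y) * a + R * (a * ((‖G y‖ / a) ^ p / p)) := by
            gcongr; exact hR _
        _ = _ := by ring
    · simp only [indicator_of_notMem hy, norm_zero, mul_zero, add_zero]
      positivity
  have hi1 : Integrable fun y => mol n j (x - y) * a :=
    ((integrable_mol n j).comp_sub_left x).mul_const a
  have hi2 : Integrable fun y => mol n j (x - y) * ‖Ω.indicator G y‖ := by
    have := (integrable_mollify_integrand j hGi.locallyIntegrable x).norm
    simpa only [norm_smul, Real.norm_of_nonneg (mol_nonneg _ _)] using this
  rw [mollify_apply_swap]
  refine (norm_integral_le_integral_norm _).trans ?_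
  simp only [norm_smul, Real.norm_of_nonneg (mol_nonneg _ _)]
  refine (integral_mono hi2 (hi1.add (hqi.const_mul _)) hpt).trans ?_
  simp only [Pi.add_apply]
  rw [integral_add hi1 (hqi.const_mul _), integral_mul_const, integral_const_mul,
    integral_sub_left_eq_self (mol n j), integral_mol, one_mul,
    integral_indicator hΩ.measurableSet]
  have := h.integral_grad_div_le ha hΛ hp0
  calc a + a * R / p * ∫ x in Ω, (‖G x‖ / a) ^ p ≤ a + a * R / p * volume.real Ω := by gcongr
    _ = _ := by ring

/-- A uniform limit of minimizers is Lipschitz on small balls, with the limit of the eigenvalues as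
constant. -/
lemma abs_sub_le_of_uniform_limit (hΩ : IsOpen Ω) (hb : Bornology.IsBounded Ω) {p Λ : ℕ → ℝ}
    {W : ℕ → (𝔼 n) → ℝ} {G : ℕ → (𝔼 n) → (𝔼 n)} {W' : (𝔼 n) → ℝ}
    (hp : Tendsto p atTop atTop) (hmin : ∀ k, Minimizer Ω (p k) (Λ k) (W k) (G k)) {a : ℝ}
    (ha : 0 < a) (hΛ : ∀ᶠ k in atTop, Λ k ≤ a) (hunif : TendstoUniformlyOn W W' atTop Ω)
    (hc : ContinuousOn W' Ω) (hWi : IntegrableOn W' Ω) {z : 𝔼 n} {s : ℝ} (hs : 0 < s)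
    (hz : Metric.ball z (2 * s) ⊆ Ω) {x y : 𝔼 n} (hx : x ∈ Metric.ball z s)
    (hy : y ∈ Metric.ball z s) : |W' x - W' y| ≤ a * ‖x - y‖ := by
  have hsub : Metric.ball z s ⊆ Ω := (Metric.ball_subset_ball (by linarith)).trans hz
  have hW'l := (hWi.integrable_indicator hΩ.measurableSet).locallyIntegrable
  have hlimj : ∀ x ∈ Ω, Tendsto (fun j => mollify j (Ω.indicator W') x) atTop (𝓝 (W' x)) := by
    intro x hx
    rw [Metric.tendsto_atTop]
    intro ε hε
    have hcx : ContinuousAt W' x := hc.continuousAt (hΩ.mem_nhds hx)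
    obtain ⟨δ, hδ, hδW⟩ := Metric.continuousAt_iff.1 hcx (ε / 2) (by positivity)
    obtain ⟨r, hr, hrΩ⟩ := Metric.isOpen_iff.1 hΩ x hx
    obtain ⟨N, hN⟩ := eventually_atTop.1 (exists_mollify_radius_lt (lt_min hδ hr))
    refine ⟨N, fun j hj => ?_⟩
    have hjr := hN j hj
    have h1 := dist_mollify_le (j := j) (g := Ω.indicator W') (x := x) (ε := ε / 2)
      (hWi.integrable_indicator hΩ.measurableSet).aestronglyMeasurable fun y hy => by
        have hyd : dist y x < min δ r := (Metric.mem_ball.1 hy).trans hjr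
        rw [indicator_of_mem hx, indicator_of_mem (hrΩ (hyd.trans_le (min_le_right _ _)))]
        exact (hδW (hyd.trans_le (min_le_left _ _))).le
    rw [indicator_of_mem hx] at h1
    linarith
  -- The order of the limits matters: first `k → ∞` at a fixed scale `j`, where the gradient bound
  -- tends to `a`, and only then `j → ∞`.
  refine le_of_tendsto ((hlimj x (hsub hx)).sub (hlimj y (hsub hy))).abs ?_
  filter_upwards [exists_mollify_radius_lt hs] with j hj
  obtain ⟨R, hR⟩ := (hasCompactSupport_mol n j).exists_bound_of_continuous
    (contDiff_mol n j).continuous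
  have hlimk : ∀ x, Tendsto (fun k => mollify j (Ω.indicator (W k)) x) atTop
      (𝓝 (mollify j (Ω.indicator W') x)) := by
    intro x
    rw [Metric.tendsto_nhds]
    intro ε hε
    filter_upwards [Metric.tendstoUniformlyOn_iff.1 hunif (ε / 2) (by positivity),
      hp.eventually_ge_atTop 1] with k hk hpk
    have hWk := ((hmin k).sobolev.hasWeakGrad hb hpk).1.integrable_indicator hΩ.measurableSet
    rw [dist_eq_norm, ← mollify_sub j hWk.locallyIntegrable hW'l]
    refine (norm_mollify_le_const (M := ε / 2) (fun y => ?_) j x).trans_lt (by linarith)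
    by_cases hy : y ∈ Ω
    · rw [Pi.sub_apply, indicator_of_mem hy, indicator_of_mem hy, ← dist_eq_norm, dist_comm]
      exact (hk y hy).le
    · simp only [Pi.sub_apply, indicator_of_notMem hy, sub_zero, norm_zero]
      positivity
  have hbound : Tendsto (fun k => (a + a * R * volume.real Ω / p k) * ‖x - y‖) atTop
      (𝓝 ((a + 0) * ‖x - y‖)) :=
    (tendsto_const_nhds.add (hp.const_div_atTop _)).mul_const _
  rw [add_zero] at hbound
  refine le_of_tendsto_of_tendsto ((hlimk x).sub (hlimk y)).abs hbound ?_
  filter_upwards [hp.eventually_ge_atTop 1, hΛ] with k hpk hΛk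
  have hwg := (hmin k).sobolev.hasWeakGrad hb hpk
  have hWk := hwg.1.integrable_indicator hΩ.measurableSet
  refine Convex.norm_image_sub_le_of_norm_fderiv_le (𝕜 := ℝ) (s := Metric.ball z s)
    (fun w _ => (contDiff_mollify j hWk.locallyIntegrable).differentiable (by simp) w)
    (fun w hw => ?_) (convex_ball z s) hy hx
  refine (norm_fderiv_mollify_le hΩ.measurableSet hwg fun w' hw' => hz ?_).trans
    ((hmin k).norm_mollify_grad_le hΩ hb hpk ha hΛk
      (fun x => (le_abs_self _).trans (hR x)) w)
  have h1 := Metric.mem_ball.1 hw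
  have h2 := Metric.mem_closedBall.1 hw'
  have := dist_triangle w' w z
  rw [Metric.mem_ball]
  linarith

/-- The set `S` contributes at most `-|S| β ^ (p - 1)` to the mean, the rest at most `|Ω| α ^ (p -
1)`. For large `p` the first dominates, since `α < β`, and the mean cannot vanish. -/
lemma oddPow_mean_contradiction (hΩ : IsOpen Ω) (hb : Bornology.IsBounded Ω) {p Λ : ℕ → ℝ}
    {W : ℕ → (𝔼 n) → ℝ} {G : ℕ → (𝔼 n) → (𝔼 n)} (hp : Tendsto p atTop atTop)
    (hmin : ∀ k, Minimizer Ω (p k) (Λ k) (W k) (G k)) {B : ℝ} (hB : ∀ k, ∀ x ∈ Ω, |W k x| ≤ B)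
    {α β : ℝ} (hα : 0 < α) (hαβ : α < β) (h1 : ∀ᶠ k in atTop, ∀ x ∈ Ω, W k x ≤ α)
    {S : Set (𝔼 n)} (hS : IsOpen S) (hSΩ : S ⊆ Ω) (hSne : S.Nonempty)
    (h2 : ∀ᶠ k in atTop, ∀ x ∈ S, W k x ≤ -β) : False := by
  have := isFiniteMeasure_restrict hb
  have hκ := volume_real_pos hS (hb.subset hSΩ) hSne
  have hba : 1 < β / α := by rwa [one_lt_div hα]
  have hp' : Tendsto (fun k => p k - 1) atTop atTop := tendsto_atTop_add_const_right _ (-1) hp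
  obtain ⟨k, hk1, hk2, hkp, hk3⟩ := (h1.and (h2.and ((hp.eventually_gt_atTop 2).and
    (eventually_lt_rpow hp' hba (volume.real Ω / volume.real S))))).exists
  have hi : IntegrableOn (fun x => oddPow (p k) (W k x)) Ω :=
    integrableOn_comp_of_bounded hb hΩ (hmin k).sobolev.1.1 (hB k) (continuous_oddPow hkp)
  have h0 := (hmin k).integral_oddPow
  rw [← integral_inter_add_sdiff (t := S) hS.measurableSet hi, inter_eq_self_of_subset_right hSΩ]
    at h0
  have hbn : 0 ≤ β := by linarith
  have e1 : ∫ x in S, oddPow (p k) (W k x) ≤ -(volume.real S * β ^ (p k - 1)) := by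
    have : ∫ x in S, -β ^ (p k - 1) = -(volume.real S * β ^ (p k - 1)) := by simp
    rw [← this]
    refine setIntegral_mono_on (hi.mono_set hSΩ)
      (integrableOn_const (hb.subset hSΩ).measure_lt_top.ne) hS.measurableSet fun x hx => ?_
    rw [← oddPow_of_nonneg hkp hbn, ← oddPow_neg]
    exact monotone_oddPow hkp (hk2 x hx)
  have e2 : ∫ x in Ω \ S, oddPow (p k) (W k x) ≤ volume.real Ω * α ^ (p k - 1) := by
    have hm : MeasurableSet (Ω \ S) := hΩ.measurableSet.diff hS.measurableSet
    have : ∫ x in Ω \ S, α ^ (p k - 1) = volume.real (Ω \ S) * α ^ (p k - 1) := by simp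
    refine (setIntegral_mono_on (hi.mono_set sdiff_subset)
      (integrableOn_const (hb.subset sdiff_subset).measure_lt_top.ne) hm fun x hx => ?_).trans
      (this.trans_le ?_)
    · rw [← oddPow_of_nonneg hkp hα.le]
      exact monotone_oddPow hkp (hk1 x hx.1)
    · gcongr
      · exact hb.measure_lt_top.ne
      · exact sdiff_subset
  rw [Real.div_rpow hbn hα.le, div_lt_div_iff₀ hκ (by positivity)] at hk3
  nlinarith

/-- The limit oscillates by at least `2`. -/
lemma exists_oscillation (hΩ : IsOpen Ω) (hb : Bornology.IsBounded Ω) (hne : Ω.Nonempty)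
    {p Λ : ℕ → ℝ} {W : ℕ → (𝔼 n) → ℝ} {G : ℕ → (𝔼 n) → (𝔼 n)} {W' : (𝔼 n) → ℝ}
    (hp1 : ∀ k, 1 ≤ p k) (hp : Tendsto p atTop atTop)
    (hmin : ∀ k, Minimizer Ω (p k) (Λ k) (W k) (G k)) {B : ℝ} (hB : ∀ k, ∀ x ∈ Ω, |W k x| ≤ B)
    (hunif : TendstoUniformlyOn W W' atTop Ω) (hc : ContinuousOn W' Ω) {ε : ℝ} (hε : 0 < ε)
    (hε1 : ε ≤ 1) : ∃ x ∈ Ω, ∃ y ∈ Ω, 2 - ε ≤ W' x - W' y := by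
  have hvol := volume_real_pos hΩ hb hne
  have := isFiniteMeasure_restrict hb
  by_contra hcon
  push Not at hcon
  have hu : ∀ᶠ k in atTop, ∀ x ∈ Ω, |W' x - W k x| < ε / 8 :=
    Metric.tendstoUniformlyOn_iff.1 hunif (ε / 8) (by positivity)
  -- Otherwise `|W k| ≤ 1 - ε / 8` for large `k`, and the normalized integral of `|W k| ^ p` would
  -- tend to zero instead of being 1.
  obtain ⟨x₁, hx₁, hlarge⟩ : ∃ x ∈ Ω, 1 - ε / 4 < |W' x| := by
    by_contra hsmall
    push Not at hsmall
    have hb1 : 0 < 1 - ε / 8 := by linarith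
    have hb2 : (1 : ℝ) < (1 - ε / 8)⁻¹ := by rw [one_lt_inv₀ hb1]; linarith
    obtain ⟨k, hk, hkp, hk1⟩ := (hu.and ((eventually_lt_rpow hp hb2 1).and
      (hp.eventually_gt_atTop 1))).exists
    have hle : ∫ x in Ω, |W k x| ^ p k ≤ ∫ x in Ω, (1 - ε / 8) ^ p k := by
      refine integral_mono_of_nonneg (Eventually.of_forall fun x => by positivity)
        (integrable_const _) ?_
      filter_upwards [ae_restrict_mem hΩ.measurableSet] with x hx
      refine Real.rpow_le_rpow (abs_nonneg _) ?_ (by linarith)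
      have h1 := hk x hx
      have h2 := hsmall x hx
      rw [abs_sub_comm] at h1
      have h3 := abs_sub_abs_le_abs_sub (W k x) (W' x)
      linarith
    rw [(hmin k).integral_rpow] at hle
    simp only [integral_const, MeasurableSet.univ, measureReal_restrict_apply, univ_inter,
      smul_eq_mul] at hle
    rw [Real.inv_rpow hb1.le, one_lt_inv₀ (by positivity)] at hkp
    nlinarith
  -- If the limit is below `-(1 - ε / 4)` at `x₁` and oscillates by less than `2 - ε`, it is below
  -- `1 - 3 * ε / 4` everywhere. The uniform error `ε / 8` turns these two levels into `β` and `α`,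
  -- still with `α < β`. The statement is made for a general sequence so as to apply to `W` and to
  -- `-W`.
  have key : ∀ (V : ℕ → (𝔼 n) → ℝ) (V' : (𝔼 n) → ℝ) (H : ℕ → (𝔼 n) → (𝔼 n)),
      (∀ k, Minimizer Ω (p k) (Λ k) (V k) (H k)) → (∀ k, ∀ x ∈ Ω, |V k x| ≤ B) →
      ContinuousOn V' Ω → (∀ᶠ k in atTop, ∀ x ∈ Ω, |V' x - V k x| < ε / 8) →
      (∀ x ∈ Ω, ∀ y ∈ Ω, V' x - V' y < 2 - ε) → V' x₁ < -(1 - ε / 4) → False := by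
    intro V V' H hV hVB hVc hVu hosc hx
    refine oddPow_mean_contradiction hΩ hb hp hV hVB (α := 1 - 5 * ε / 8) (β := 1 - 3 * ε / 8)
      (S := Ω ∩ V' ⁻¹' Iio (-(1 - ε / 4))) (by linarith) (by linarith) ?_
      (hVc.isOpen_inter_preimage hΩ isOpen_Iio) inter_subset_left ⟨x₁, hx₁, hx⟩ ?_
    · filter_upwards [hVu] with k hk x hxΩ
      have h1 := abs_lt.1 (hk x hxΩ)
      have h2 := hosc x hxΩ x₁ hx₁
      linarith
    · filter_upwards [hVu] with k hk x hxS
      have h1 := abs_lt.1 (hk x hxS.1)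
      have h2 : V' x < -(1 - ε / 4) := hxS.2
      linarith
  rcases lt_abs.1 hlarge with h | h
  · refine key (fun k x => -W k x) (fun x => -W' x) (fun k x => -G k x)
      (fun k => (hmin k).neg hb (hp1 k)) (fun k x hx => by rw [abs_neg]; exact hB k x hx) hc.neg
      ?_ (fun x hx y hy => by linarith [hcon y hy x hx]) (by linarith)
    filter_upwards [hu] with k hk x hx
    rw [neg_sub_neg, abs_sub_comm]
    exact hk x hx
  · exact key W W' G hmin hB hc hu hcon (by linarith)

end Convergence

/-! ### Compactness of minimizers and the two eigenvalue bounds -/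

section Eigenvalues

variable {n : ℕ} {Ω : Set (𝔼 n)}

/-- `W'` is the uniform limit of the continuous minimizers `W k` with weak gradients `G k`, for
exponents `p k → ∞`. -/
structure IsMinimizerLimit (Ω : Set (𝔼 n)) (p Λ : ℕ → ℝ) (W : ℕ → (𝔼 n) → ℝ)
    (G : ℕ → (𝔼 n) → (𝔼 n)) (W' : (𝔼 n) → ℝ) : Prop where
  four_lt : ∀ k, 4 < p k
  tendsto_p : Tendsto p atTop atTop
  minimizer : ∀ k, Minimizer Ω (p k) (Λ k) (W k) (G k)
  continuousOn : ∀ k, ContinuousOn (W k) (closure Ω)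
  tendsto : TendstoUniformlyOn W W' atTop (closure Ω)
  continuousOn_limit : ContinuousOn W' (closure Ω)
  bounded : ∃ B, ∀ k, ∀ x ∈ Ω, |W k x| ≤ B

/-- A bound on the eigenvalues is all that compactness needs; it is used once along a subsequence
where the eigenvalues are assumed small, and once after their convergence is known. Discarding
finitely many indices secures the bounds on `Λ` and `p` for all indices. -/
lemma exists_isMinimizerLimit (hn : 0 < n) (hΩ : IsOpen Ω) (hb : Bornology.IsBounded Ω)
    (hlip : HasLipschitzBoundary Ω) {p Λ : ℕ → ℝ} {u : ℕ → (𝔼 n) → ℝ}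
    (hp : Tendsto p atTop atTop) (hmin : ∀ k, ∃ G, Minimizer Ω (p k) (Λ k) (u k) G) {a : ℝ}
    (ha : 0 < a) (hΛ : ∀ᶠ k in atTop, Λ k ≤ a) :
    ∃ (σ : ℕ → ℕ) (W : ℕ → (𝔼 n) → ℝ) (G : ℕ → (𝔼 n) → (𝔼 n)) (W' : (𝔼 n) → ℝ),
      StrictMono σ ∧ (∀ k, u (σ k) =ᵐ[volume.restrict Ω] W k) ∧
      IsMinimizerLimit Ω (fun k => p (σ k)) (fun k => Λ (σ k)) W G W' := by
  choose G hG using hmin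
  obtain ⟨N, hN⟩ := eventually_atTop.1 (hΛ.and ((hp.eventually_gt_atTop 4).and
    (hp.eventually_ge_atTop (2 * n : ℝ))))
  have hN' : ∀ k, Λ (k + N) ≤ a ∧ 4 < p (k + N) ∧ (2 * n : ℝ) ≤ p (k + N) :=
    fun k => hN _ (Nat.le_add_left _ _)
  choose w hw hwu using fun k =>
    (hG (k + N)).exists_representative hn hb hΩ ha (hN' k).1 (hN' k).2.2
  have hC : 0 ≤ 8 * (unitVol n + a ^ (2 * n) * (2 * volume.real Ω)) / unitVol n := by
    have := unitVol_pos n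
    positivity
  have hwmin : ∀ k, Minimizer Ω (p (k + N)) (Λ (k + N)) (w k) (G (k + N)) := fun k =>
    (hG (k + N)).congr (hwu k) hb (by linarith [(hN' k).2.1])
  obtain ⟨B, hB⟩ := exists_uniform_bound hΩ hb hlip hC
  have hwB : ∀ k, ∀ x ∈ Ω, |w k x| ≤ B := fun k => by
    have h4 := (hN' k).2.1
    refine hB _ (p (k + N)) (by linarith) (hw k) ?_ (hwmin k).integral_rpow
    have := (hwmin k).sobolev.1.integrable_norm_rpow (by simp; linarith) (by simp)
    simpa only [IntegrableOn, ENNReal.toReal_ofReal (by linarith : 0 ≤ p (k + N)),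
      Real.norm_eq_abs] using this
  obtain ⟨σ, W, W', hσ, hWc, hWw, hWu, hW'⟩ := exists_uniform_limit hΩ hb hlip hC hw hwB
  have hσ' : StrictMono fun k => σ k + N := fun i j h => Nat.add_lt_add_right (hσ h) N
  have hwW : ∀ k, w (σ k) =ᵐ[volume.restrict Ω] W k := fun k => by
    filter_upwards [ae_restrict_mem hΩ.measurableSet] with x hx using (hWw k hx).symm
  refine ⟨fun k => σ k + N, W, fun k => G (σ k + N), W', hσ',
    fun k => (hwu (σ k)).trans (hwW k), ⟨fun k => (hN' _).2.1, hp.comp hσ'.tendsto_atTop,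
    fun k => (hwmin (σ k)).congr (hwW k) hb (by linarith [(hN' (σ k)).2.1]), hWc, hWu, hW',
    B, fun k x hx => by rw [hWw k hx]; exact hwB _ x hx⟩⟩

lemma intrinsicDiam_pos (hn : 0 < n) (hΩ : IsOpen Ω) (hne : Ω.Nonempty) :
    0 < intrinsicDiam Ω := by
  have : Nonempty (Fin n) := ⟨⟨0, hn⟩⟩
  have : Nontrivial (𝔼 n) := inferInstance
  obtain ⟨x, hx⟩ := hne
  obtain ⟨y, hyx, hy⟩ : ∃ y, y ≠ x ∧ y ∈ Ω := by
    have h := (hΩ.mem_nhds hx)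
    have := (mem_closure_iff_nhds.1 ((dense_compl_singleton x) x)) Ω h
    obtain ⟨y, hy1, hy2⟩ := this
    exact ⟨y, hy2, hy1⟩
  refine (edist_pos.2 hyx.symm).trans_le ((edist_le_geodesicDist (Ω := Ω) x y).trans ?_)
  exact le_iSup₂_of_le x hx (le_iSup₂_of_le y hy le_rfl)

/-- Two points of `Ω` have geodesic distance at least some `D > 2 / a`. If `Λ k ≥ a`, the bound from
the truncated distance would keep `(a * t) ^ p` bounded for some `t > 1 / a`, which fails for large
`p`. An infinite diameter is not excluded. -/
lemma eventually_eigenvalue_lt (hn : 0 < n) (hΩ : IsOpen Ω) (hb : Bornology.IsBounded Ω)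
    (hne : Ω.Nonempty) {p Λ : ℕ → ℝ} {u : ℕ → (𝔼 n) → ℝ}
    (hp : Tendsto p atTop atTop) (hmin : ∀ k, ∃ G, Minimizer Ω (p k) (Λ k) (u k) G) {a : ℝ}
    (ha : lambdaInfty Ω < a) : ∀ᶠ k in atTop, Λ k < a := by
  have hd := intrinsicDiam_pos hn hΩ hne
  have ha0 : 0 < a := ENNReal.toReal_nonneg.trans_lt ha
  have hlt : ENNReal.ofReal (2 / a) < intrinsicDiam Ω := by
    have h1 : 2 / intrinsicDiam Ω < ENNReal.ofReal a :=
      (ENNReal.lt_ofReal_iff_toReal_lt (ENNReal.div_ne_top (by simp) hd.ne')).2 ha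
    rw [ENNReal.ofReal_div_of_pos ha0, ENNReal.div_lt_iff (by simp [ha0]) (by simp)]
    rw [ENNReal.div_lt_iff (by simp [hd.ne']) (by simp)] at h1
    rw [mul_comm]
    simpa using h1
  obtain ⟨D, hD1, hD2⟩ := ENNReal.lt_iff_exists_real_btwn.1 hlt |>.imp fun D h => h.2
  rw [ENNReal.ofReal_lt_ofReal_iff'] at hD1
  obtain ⟨hD1, hD0⟩ := hD1
  simp only [intrinsicDiam, lt_iSup_iff] at hD2
  obtain ⟨x, hx, y, hy, hxy⟩ := hD2
  have hai : 1 / a < D / 2 := by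
    have : 1 / a = (2 / a) / 2 := by ring
    linarith
  have hap : 0 < 1 / a := by positivity
  -- Giving away half of the slack `D / 2 - 1 / a` leaves a level `t` still above `1 / a`.
  obtain ⟨κ, hκ, h⟩ := exists_rayleigh_bound hΩ hb hx hy hxy.le
    (ε := (D / 2 - 1 / a) / 2) (by linarith) (by linarith)
  set t := D / 2 - (D / 2 - 1 / a) / 2 with ht
  have ht1 : 1 / a < t := by linarith
  have hat : 1 < a * t := by
    rw [div_lt_iff₀ ha0] at ht1; linarith
  filter_upwards [eventually_lt_rpow hp hat (volume.real Ω / κ), hp.eventually_gt_atTop 2]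
    with k hk hpk
  obtain ⟨G, hG⟩ := hmin k
  by_contra hcon
  push Not at hcon
  have h1 := h _ _ _ _ hpk hG
  have ht0 : 0 < t := hap.trans ht1
  have h2 : a ^ p k ≤ Λ k ^ p k := Real.rpow_le_rpow ha0.le hcon (by linarith)
  rw [div_lt_iff₀ hκ, Real.mul_rpow ha0.le ht0.le] at hk
  have h3 : a ^ p k * (κ * t ^ p k) ≤ Λ k ^ p k * (κ * t ^ p k) := by gcongr
  linarith

/-- If the bound failed infinitely often, a limit of those minimizers would be `a'`-Lipschitz along
curves, for some `a'` below `lambdaInfty Ω`. Its oscillation would then be at most `a'` times the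
diameter, which is less than 2, against `exists_oscillation`. -/
lemma eventually_lt_eigenvalue (hn : 0 < n) (hΩ : IsOpen Ω) (hb : Bornology.IsBounded Ω)
    (hne : Ω.Nonempty) (hlip : HasLipschitzBoundary Ω) {p Λ : ℕ → ℝ} {u : ℕ → (𝔼 n) → ℝ}
    (hp : Tendsto p atTop atTop) (hmin : ∀ k, ∃ G, Minimizer Ω (p k) (Λ k) (u k) G) {a : ℝ}
    (ha : a < lambdaInfty Ω) : ∀ᶠ k in atTop, a < Λ k := by
  by_contra hcon
  rw [not_eventually] at hcon
  have hd := intrinsicDiam_pos hn hΩ hne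
  obtain ⟨σ, hσ, hσa⟩ := extraction_of_frequently_atTop hcon
  have hΛ0 : ∀ k, 0 ≤ Λ k := fun k => (hmin k).choose_spec.nonneg
  have ha0 : 0 ≤ a := (hΛ0 (σ 0)).trans (not_lt.1 (hσa 0))
  -- The number `a` may be zero, whereas the Lipschitz estimate needs a positive bound.
  obtain ⟨a', haa', ha'⟩ := exists_between ha
  have ha'0 : 0 < a' := ha0.trans_lt haa'
  obtain ⟨τ, W, G, W', hτ, -, hlim⟩ := exists_isMinimizerLimit hn hΩ hb hlip
    (hp.comp hσ.tendsto_atTop) (fun k => hmin (σ k)) ha'0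
    (Eventually.of_forall fun k => (not_lt.1 (hσa k)).trans haa'.le)
  obtain ⟨B, hB⟩ := hlim.bounded
  have hcΩ : ContinuousOn W' Ω := hlim.continuousOn_limit.mono subset_closure
  have hunif : TendstoUniformlyOn W W' atTop Ω := hlim.tendsto.mono subset_closure
  have hWi : IntegrableOn W' Ω :=
    (hlim.continuousOn_limit.integrableOn_compact hb.isCompact_closure).mono_set subset_closure
  have hloc : ∀ z ∈ Ω, ∃ s > 0, LipschitzOnWith a'.toNNReal W' (Metric.ball z s) := by
    intro z hz
    obtain ⟨r, hr, hrΩ⟩ := Metric.isOpen_iff.1 hΩ z hz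
    refine ⟨r / 2, by positivity, LipschitzOnWith.of_dist_le_mul fun x hx y hy => ?_⟩
    rw [Real.coe_toNNReal _ ha'0.le, Real.dist_eq, dist_eq_norm]
    exact abs_sub_le_of_uniform_limit hΩ hb hlim.tendsto_p hlim.minimizer ha'0
      (Eventually.of_forall fun k => (not_lt.1 (hσa _)).trans haa'.le) hunif hcΩ hWi
      (half_pos hr) (by rwa [mul_div_cancel₀ _ two_ne_zero]) hx hy
  have hgeo := edist_le_mul_geodesicDist (by simpa using ha'0) hloc
  have hlt : ENNReal.ofReal a' * intrinsicDiam Ω < 2 := by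
    have h1 : ENNReal.ofReal a' < 2 / intrinsicDiam Ω :=
      (ENNReal.ofReal_lt_iff_lt_toReal ha'0.le (ENNReal.div_ne_top (by simp) hd.ne')).2 ha'
    exact (ENNReal.lt_div_iff_mul_lt (by simp [hd.ne']) (by simp [ha'0])).1 h1
  obtain ⟨b, hb1, hb2⟩ := ENNReal.lt_iff_exists_real_btwn.1 hlt |>.imp fun D h => h.2
  have hb2' : b < 2 := by
    by_contra hcon
    exact hb2.not_ge (by simpa using ENNReal.ofReal_le_ofReal (not_lt.1 hcon))
  obtain ⟨x, hx, y, hy, hxy⟩ := exists_oscillation hΩ hb hne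
    (fun k => by linarith [hlim.four_lt k]) hlim.tendsto_p hlim.minimizer hB hunif hcΩ
    (ε := min (2 - b) 1) (lt_min (by linarith) one_pos) (min_le_right _ _)
  have h1 : ENNReal.ofReal b ≤ edist (W' x) (W' y) := by
    rw [edist_dist, Real.dist_eq]
    refine ENNReal.ofReal_le_ofReal (le_trans ?_ (le_abs_self _))
    linarith [min_le_left (2 - b) 1]
  have h2 : geodesicDist Ω x y ≤ intrinsicDiam Ω :=
    le_iSup₂_of_le x hx (le_iSup₂_of_le y hy le_rfl)
  refine (h1.trans (hgeo x y)).not_gt (lt_of_le_of_lt ?_ hb1)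
  exact mul_le_mul_right h2 _

lemma tendsto_eigenvalue (hn : 0 < n) (hΩ : IsOpen Ω) (hb : Bornology.IsBounded Ω)
    (hne : Ω.Nonempty) (hlip : HasLipschitzBoundary Ω) {p Λ : ℕ → ℝ} {u : ℕ → (𝔼 n) → ℝ}
    (hp : Tendsto p atTop atTop) (hmin : ∀ k, ∃ G, Minimizer Ω (p k) (Λ k) (u k) G) :
    Tendsto Λ atTop (𝓝 (lambdaInfty Ω)) :=
  tendsto_order.2 ⟨fun _ ha => eventually_lt_eigenvalue hn hΩ hb hne hlip hp hmin ha,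
    fun _ ha => eventually_eigenvalue_lt hn hΩ hb hne hp hmin ha⟩

end Eigenvalues

/-! ### The `p`-Laplacian of a test function -/

section PLaplacian

variable {n : ℕ} {φ : (𝔼 n) → ℝ}

/-- The field `|∇φ|^(p-2) ∇φ`. -/
def pField (p : ℝ) (φ : (𝔼 n) → ℝ) (x : 𝔼 n) : 𝔼 n := ‖∇ φ x‖ ^ (p - 2) • ∇ φ x

/-- The trace of the derivative of a vector field. -/
def divergence (X : (𝔼 n) → (𝔼 n)) (x : 𝔼 n) : ℝ :=
  ∑ i, ⟪fderiv ℝ X x (EuclideanSpace.basisFun (Fin n) ℝ i), EuclideanSpace.basisFun (Fin n) ℝ i⟫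

/-- The trace of the Hessian. -/
def hessianTrace (φ : (𝔼 n) → ℝ) (x : 𝔼 n) : ℝ :=
  ∑ i, fderiv ℝ (fderiv ℝ φ) x (EuclideanSpace.basisFun (Fin n) ℝ i)
    (EuclideanSpace.basisFun (Fin n) ℝ i)

lemma contDiff_gradient (hφ : ContDiff ℝ 2 φ) : ContDiff ℝ 1 (∇ φ) :=
  (LinearIsometryEquiv.contDiff _).comp (hφ.fderiv_right (m := 1) (by norm_num))

lemma fderiv_gradient_inner (hφ : ContDiff ℝ 2 φ) (x v w : 𝔼 n) :
    ⟪fderiv ℝ (∇ φ) x v, w⟫ = fderiv ℝ (fderiv ℝ φ) x v w := by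
  have hd : HasFDerivAt (fderiv ℝ φ) (fderiv ℝ (fderiv ℝ φ) x) x :=
    ((hφ.fderiv_right (m := 1) (by norm_num)).differentiable one_ne_zero x).hasFDerivAt
  have hg : HasFDerivAt (∇ φ) (fderiv ℝ (∇ φ) x) x :=
    ((contDiff_gradient hφ).differentiable one_ne_zero x).hasFDerivAt
  have h1 : HasFDerivAt (fun y => ⟪∇ φ y, w⟫)
      ((fderivInnerCLM ℝ (∇ φ x, w)).comp ((fderiv ℝ (∇ φ) x).prod 0)) x :=
    hg.inner ℝ (hasFDerivAt_const w x)
  have h2 : HasFDerivAt (fun y => fderiv ℝ φ y w) ((fderiv ℝ (fderiv ℝ φ) x).flip w) x := by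
    simpa using hd.clm_apply (hasFDerivAt_const w x)
  have h3 : (fun y => ⟪∇ φ y, w⟫) = fun y => fderiv ℝ φ y w := by
    funext y
    simp [gradient]
  rw [h3] at h1
  have := congrArg (fun T => T v) (h1.unique h2)
  simpa [fderivInnerCLM_apply] using this

lemma contDiff_pField {p : ℝ} (hp : 3 < p) (hφ : ContDiff ℝ 2 φ) : ContDiff ℝ 1 (pField p φ) :=
  ((contDiff_gradient hφ).norm_rpow (by linarith)).smul (contDiff_gradient hφ)

/-- The familiar expansion of the `p`-Laplacian. For `p > 4` it also holds at critical points of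
`φ`, since all the powers of the gradient norm are then regular enough. -/
lemma divergence_pField {p : ℝ} (hp : 4 < p) (hφ : ContDiff ℝ 2 φ) (x : 𝔼 n) :
    divergence (pField p φ) x = ‖∇ φ x‖ ^ (p - 4) *
      (‖∇ φ x‖ ^ 2 * hessianTrace φ x + (p - 2) * infLaplacian φ x) := by
  set b := EuclideanSpace.basisFun (Fin n) ℝ
  have hg : HasFDerivAt (∇ φ) (fderiv ℝ (∇ φ) x) x :=
    ((contDiff_gradient hφ).differentiable one_ne_zero x).hasFDerivAt
  have h1 := (hasFDerivAt_norm_rpow (∇ φ x) (p := p - 2) (by linarith)).comp x hg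
  have h2 := h1.smul hg
  have h3 : fderiv ℝ (pField p φ) x = _ := h2.fderiv
  have hpow : ‖∇ φ x‖ ^ (p - 2) = ‖∇ φ x‖ ^ (p - 4) * ‖∇ φ x‖ ^ 2 := by
    rw [← Real.rpow_natCast, ← Real.rpow_add' (norm_nonneg _) (by push_cast; linarith)]
    congr 1; push_cast; ring
  have h4 : ∀ i, ⟪fderiv ℝ (pField p φ) x (b i), b i⟫ = ‖∇ φ x‖ ^ (p - 4) * (‖∇ φ x‖ ^ 2 *
      fderiv ℝ (fderiv ℝ φ) x (b i) (b i) + (p - 2) *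
      (⟪∇ φ x, b i⟫ * fderiv ℝ (fderiv ℝ φ) x (b i) (∇ φ x))) := by
    intro i
    rw [h3]
    simp only [Function.comp_apply, FunLike.coe_add, Pi.add_apply, FunLike.coe_smul,
      Pi.smul_apply, ContinuousLinearMap.smulRight_apply, ContinuousLinearMap.comp_apply,
      innerSL_apply_apply, inner_add_left, inner_smul_left, smul_eq_mul, RCLike.conj_to_real]
    rw [real_inner_comm (fderiv ℝ (∇ φ) x (b i)) (∇ φ x), fderiv_gradient_inner hφ,
      fderiv_gradient_inner hφ, hpow,
      show p - 2 - 2 = p - 4 by ring]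
    ring
  have h5 : ∑ i, ⟪∇ φ x, b i⟫ * fderiv ℝ (fderiv ℝ φ) x (b i) (∇ φ x) = infLaplacian φ x := by
    have h6 := b.sum_repr (∇ φ x)
    have : infLaplacian φ x =
        fderiv ℝ (fderiv ℝ φ) x (∑ i, b.repr (∇ φ x) i • b i) (∇ φ x) := by rw [h6]; rfl
    rw [this, map_sum, sum_apply]
    refine Finset.sum_congr rfl fun i _ => ?_
    rw [map_smul, smul_apply, b.repr_apply_apply, real_inner_comm, smul_eq_mul]
  rw [divergence, Finset.sum_congr rfl fun i _ => h4 i, ← Finset.mul_sum, Finset.sum_add_distrib,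
    ← Finset.mul_sum, ← Finset.mul_sum, h5, hessianTrace]

lemma continuous_hessianTrace (hφ : ContDiff ℝ 2 φ) : Continuous (hessianTrace φ) := by
  have h : Continuous (fderiv ℝ (fderiv ℝ φ)) :=
    (hφ.fderiv_right (m := 1) (by norm_num)).continuous_fderiv one_ne_zero
  exact continuous_finsetSum _ fun i _ => (h.clm_apply continuous_const).clm_apply continuous_const

lemma continuous_infLaplacian (hφ : ContDiff ℝ 2 φ) : Continuous (infLaplacian φ) := by
  have h : Continuous (fderiv ℝ (fderiv ℝ φ)) :=
    (hφ.fderiv_right (m := 1) (by norm_num)).continuous_fderiv one_ne_zero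
  have hg := (contDiff_gradient hφ).continuous
  exact (h.clm_apply hg).clm_apply hg

lemma continuous_divergence {X : (𝔼 n) → (𝔼 n)} (hX : ContDiff ℝ 1 X) :
    Continuous (divergence X) :=
  continuous_finsetSum _ fun _ _ =>
    (((hX.continuous_fderiv one_ne_zero).clm_apply continuous_const).inner continuous_const)

/-- Write `b ^ p` as the square of `√b ^ p`: one factor exceeds any constant, the other exceeds a
multiple of `p` by Bernoulli. -/
lemma eventually_add_mul_lt_rpow {p : ℕ → ℝ} (hp : Tendsto p atTop atTop) {b : ℝ} (hb : 1 < b)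
    (A C : ℝ) : ∀ᶠ k in atTop, A + C * p k < b ^ p k := by
  have hb0 : 0 ≤ b := by linarith
  have hs : 1 < √b := by rw [Real.lt_sqrt zero_le_one]; simpa
  filter_upwards [hp.eventually_ge_atTop 1,
    eventually_lt_rpow hp hs ((|A| + |C|) / (√b - 1))] with k h1 h2
  have h := one_add_mul_self_le_rpow_one_add (s := √b - 1) (p := p k) (by linarith) h1
  rw [add_sub_cancel] at h
  have hbb : b ^ p k = √b ^ p k * √b ^ p k := by
    rw [← Real.mul_rpow (Real.sqrt_nonneg _) (Real.sqrt_nonneg _), Real.mul_self_sqrt hb0]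
  have hpos : 0 < √b ^ p k := by positivity
  rw [div_lt_iff₀ (by linarith)] at h2
  calc A + C * p k ≤ |A| * p k + |C| * p k := by
        refine add_le_add ((le_abs_self A).trans ?_) ?_
        · exact le_mul_of_one_le_right (abs_nonneg _) h1
        · exact mul_le_mul_of_nonneg_right (le_abs_self _) (by linarith)
    _ = (|A| + |C|) * p k := by ring
    _ ≤ √b ^ p k * (√b - 1) * p k := by gcongr
    _ = √b ^ p k * (p k * (√b - 1)) := by ring
    _ < √b ^ p k * √b ^ p k := by gcongr; linarith
    _ = _ := hbb.symm

end PLaplacian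

/-! ### From a strict violation of the limit equation to strict subsolutions for large exponents -/

section StrictTest

variable {n : ℕ} {φ : (𝔼 n) → ℝ} {x₀ : 𝔼 n} {p Λ : ℕ → ℝ} {L : ℝ}

/-- Near `x₀` and for large `k`, the function `φ - m` is a strict subsolution of the equation with
exponent `p k`. -/
def IsStrictNear (φ : (𝔼 n) → ℝ) (x₀ : 𝔼 n) (p Λ : ℕ → ℝ) : Prop :=
  ∃ m > 0, ∃ ρ > 0, ∀ᶠ k in atTop, ∀ x ∈ Metric.ball x₀ ρ,
    -divergence (pField (p k) φ) x < Λ k ^ p k * oddPow (p k) (φ x - m)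

/-- In the `p`-Laplacian the term `(p - 2) Δ_∞ φ` eventually dominates the trace term, so `-Δ_p φ`
is negative, while the right-hand side is nonnegative because `φ - m` stays positive near `x₀`. -/
lemma isStrictNear_of_infLaplacian_pos (hφ : ContDiff ℝ 2 φ) (hp : Tendsto p atTop atTop)
    (hΛ0 : ∀ k, 0 ≤ Λ k) (hs : 0 < φ x₀) (hI : 0 < infLaplacian φ x₀) :
    IsStrictNear φ x₀ p Λ := by
  have hN0 : 0 < ‖∇ φ x₀‖ := by
    rw [norm_pos_iff]
    intro h
    simp [infLaplacian, h] at hI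
  have hgc := (contDiff_gradient hφ).continuous
  have e1 : ∀ᶠ x in 𝓝 x₀, φ x₀ / 2 < φ x :=
    hφ.continuous.continuousAt.eventually_const_lt (by linarith)
  have e2 : ∀ᶠ x in 𝓝 x₀, infLaplacian φ x₀ / 2 < infLaplacian φ x :=
    (continuous_infLaplacian hφ).continuousAt.eventually_const_lt (by linarith)
  have e3 : ∀ᶠ x in 𝓝 x₀, 0 < ‖∇ φ x‖ := hgc.norm.continuousAt.eventually_const_lt hN0
  set M := |‖∇ φ x₀‖ ^ 2 * hessianTrace φ x₀| + 1 with hM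
  have e4 : ∀ᶠ x in 𝓝 x₀, |‖∇ φ x‖ ^ 2 * hessianTrace φ x| < M :=
    (((hgc.norm.pow 2).mul (continuous_hessianTrace hφ)).abs.continuousAt.eventually_lt_const
      (lt_add_one _))
  obtain ⟨ρ, hρ, h⟩ := Metric.eventually_nhds_iff_ball.1 (e1.and (e2.and (e3.and e4)))
  refine ⟨φ x₀ / 2, by linarith, ρ, hρ, ?_⟩
  filter_upwards [hp.eventually_gt_atTop 4,
    hp.eventually_gt_atTop (2 + M / (infLaplacian φ x₀ / 2))] with k hk4 hk x hx
  obtain ⟨h1, h2, h3, h4⟩ := h x hx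
  have hr : 0 ≤ Λ k ^ p k * oddPow (p k) (φ x - φ x₀ / 2) := by
    rw [oddPow_of_nonneg (by linarith) (by linarith)]
    exact mul_nonneg (Real.rpow_nonneg (hΛ0 k) _) (Real.rpow_nonneg (by linarith) _)
  refine lt_of_lt_of_le (neg_lt_zero.2 ?_) hr
  rw [divergence_pField hk4 hφ]
  refine mul_pos (by positivity) ?_
  have h5 : M < (p k - 2) * (infLaplacian φ x₀ / 2) := by
    rw [← div_lt_iff₀ (by linarith)]; linarith
  have h6 : (p k - 2) * (infLaplacian φ x₀ / 2) ≤ (p k - 2) * infLaplacian φ x :=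
    mul_le_mul_of_nonneg_left h2.le (by linarith)
  have := (abs_lt.1 h4).1
  linarith

/-- The left-hand side is of size at most `p α ^ p` with `α` just above the gradient norm, the
right-hand side at least `β ^ p / τ` with `β > α`. The exponential gap absorbs the factor `p`,
whatever the sign of `Δ_∞ φ`. -/
lemma isStrictNear_of_norm_gradient_lt (hφ : ContDiff ℝ 2 φ) (hp : Tendsto p atTop atTop)
    (hΛ : Tendsto Λ atTop (𝓝 L)) (hL : 0 ≤ L) (hN : ‖∇ φ x₀‖ < L * φ x₀) :
    IsStrictNear φ x₀ p Λ := by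
  have hgc := (contDiff_gradient hφ).continuous
  obtain ⟨α, hα, hα'⟩ := exists_between hN
  obtain ⟨β, hβ, hβ'⟩ := exists_between hα'
  have hα0 : 0 < α := (norm_nonneg _).trans_lt hα
  have hL0 : 0 < L := by
    rcases hL.eq_or_lt with h | h
    · rw [← h, zero_mul] at hN
      exact absurd hN (norm_nonneg _).not_gt
    · exact h
  -- The level `τ` lies below `φ x₀` with `β < L * τ`. The shift `m = (φ x₀ - τ) / 2` is chosen so
  -- that `φ - m` stays above `τ` near `x₀`.
  obtain ⟨τ, hτ, hτ'⟩ := exists_between ((div_lt_iff₀' hL0).2 hβ')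
  have hτ0 : 0 < τ := lt_trans (div_pos (hα0.trans hβ) hL0) hτ
  rw [div_lt_iff₀' hL0] at hτ
  have e1 : ∀ᶠ x in 𝓝 x₀, (φ x₀ + τ) / 2 < φ x :=
    hφ.continuous.continuousAt.eventually_const_lt (by linarith)
  have e2 : ∀ᶠ x in 𝓝 x₀, ‖∇ φ x‖ < α := hgc.norm.continuousAt.eventually_lt_const hα
  set M := |hessianTrace φ x₀| + 1 with hM
  have e3 : ∀ᶠ x in 𝓝 x₀, |hessianTrace φ x| < M :=
    (continuous_hessianTrace hφ).abs.continuousAt.eventually_lt_const (by simp only [hM]; linarith)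
  set K := |infLaplacian φ x₀| + 1 with hK
  have e4 : ∀ᶠ x in 𝓝 x₀, |infLaplacian φ x| < K :=
    (continuous_infLaplacian hφ).abs.continuousAt.eventually_lt_const (by simp only [hK]; linarith)
  have hM0 : 0 < M := by positivity
  have hK0 : 0 < K := by positivity
  obtain ⟨ρ, hρ, h⟩ := Metric.eventually_nhds_iff_ball.1 (e1.and (e2.and (e3.and e4)))
  refine ⟨(φ x₀ - τ) / 2, by linarith, ρ, hρ, ?_⟩
  have e5 : ∀ᶠ k in atTop, β < Λ k * τ := (hΛ.mul_const τ).eventually_const_lt hτ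
  filter_upwards [hp.eventually_gt_atTop 4, e5, eventually_add_mul_lt_rpow hp
    ((one_lt_div hα0).2 hβ) (τ / α ^ 4 * (α ^ 2 * M)) (τ / α ^ 4 * K)] with k hk4 hk5 hk6 x hx
  obtain ⟨h1, h2, h3, h4⟩ := h x hx
  have hΛk : 0 < Λ k := by
    by_contra hcon
    have := mul_nonpos_of_nonpos_of_nonneg (not_lt.1 hcon) hτ0.le
    linarith
  have hle : -divergence (pField (p k) φ) x ≤ α ^ (p k - 4) * (α ^ 2 * M + p k * K) := by
    rw [divergence_pField hk4 hφ, ← mul_neg]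
    have h5 : -(‖∇ φ x‖ ^ 2 * hessianTrace φ x + (p k - 2) * infLaplacian φ x) ≤
        α ^ 2 * M + p k * K := by
      have i1 : ‖∇ φ x‖ ^ 2 * -hessianTrace φ x ≤ α ^ 2 * M := by
        refine (mul_le_mul_of_nonneg_left (by linarith [(abs_lt.1 h3).1]) (by positivity)).trans
          (mul_le_mul_of_nonneg_right (pow_le_pow_left₀ (norm_nonneg _) h2.le 2) hM0.le)
      have i2 : (p k - 2) * -infLaplacian φ x ≤ p k * K :=
        (mul_le_mul_of_nonneg_left (by linarith [(abs_lt.1 h4).1]) (by linarith)).trans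
          (mul_le_mul_of_nonneg_right (by linarith) hK0.le)
      linarith
    have h7 : ‖∇ φ x‖ ^ (p k - 4) ≤ α ^ (p k - 4) :=
      Real.rpow_le_rpow (norm_nonneg _) h2.le (by linarith)
    exact (mul_le_mul_of_nonneg_left h5 (by positivity)).trans
      (mul_le_mul_of_nonneg_right h7 (by positivity))
  have hge : β ^ p k / τ ≤ Λ k ^ p k * oddPow (p k) (φ x - (φ x₀ - τ) / 2) := by
    have h8 : oddPow (p k) τ ≤ oddPow (p k) (φ x - (φ x₀ - τ) / 2) :=
      monotone_oddPow (by linarith) (by linarith)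
    refine le_trans ?_ (mul_le_mul_of_nonneg_left h8 (by positivity))
    rw [oddPow_of_nonneg (by linarith) hτ0.le, Real.rpow_sub_one hτ0.ne', ← mul_div_assoc,
      ← Real.mul_rpow hΛk.le hτ0.le]
    gcongr
    exact (hα0.trans hβ).le
  refine hle.trans_lt (lt_of_lt_of_le ?_ hge)
  have h9 : α ^ (p k - 4) = α ^ p k / α ^ 4 := by
    rw [Real.rpow_sub hα0]; norm_cast
  rw [Real.div_rpow (hα0.trans hβ).le hα0.le, lt_div_iff₀ (by positivity)] at hk6
  rw [h9, lt_div_iff₀ hτ0]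
  refine lt_of_eq_of_lt ?_ hk6
  field_simp

/-- Here the right-hand side may be negative, but it is at least `-α ^ p / T`, whereas `Δ_p φ ≥ β ^
(p - 4)` with `α < β` below the gradient norm. No sign of `φ x₀` is assumed, so the case of the
value zero is covered too. -/
lemma isStrictNear_of_lt_norm_gradient (hφ : ContDiff ℝ 2 φ) (hp : Tendsto p atTop atTop)
    (hΛ : Tendsto Λ atTop (𝓝 L)) (hL : 0 ≤ L) (hΛ0 : ∀ k, 0 ≤ Λ k)
    (hI : 0 < infLaplacian φ x₀)
    (hN : L * |φ x₀| < ‖∇ φ x₀‖) : IsStrictNear φ x₀ p Λ := by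
  have hgc := (contDiff_gradient hφ).continuous
  obtain ⟨α, hα, hα'⟩ := exists_between hN
  obtain ⟨β, hβ, hβ'⟩ := exists_between hα'
  have hα0 : 0 < α := lt_of_le_of_lt (by positivity) hα
  -- The room between `|φ x₀|` and `T` is shared between the variation of `φ` near `x₀` and the
  -- shift `m`, so that `φ - m ≥ -T`.
  obtain ⟨T, hT, hTα⟩ : ∃ T, |φ x₀| < T ∧ L * T < α := by
    have : ∀ᶠ T in 𝓝[>] |φ x₀|, L * T < α :=
      ((continuous_const.mul continuous_id).continuousAt.eventually_lt_const hα).filter_mono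
        nhdsWithin_le_nhds
    exact ((eventually_mem_nhdsWithin (s := Ioi |φ x₀|)).and this).exists
  have hT0 : 0 < T := (abs_nonneg _).trans_lt hT
  have e1 : ∀ᶠ x in 𝓝 x₀, |φ x| < (|φ x₀| + T) / 2 :=
    hφ.continuous.abs.continuousAt.eventually_lt_const (by linarith)
  have e2 : ∀ᶠ x in 𝓝 x₀, β < ‖∇ φ x‖ := hgc.norm.continuousAt.eventually_const_lt hβ'
  set M := |‖∇ φ x₀‖ ^ 2 * hessianTrace φ x₀| + 1 with hM
  have e3 : ∀ᶠ x in 𝓝 x₀, |‖∇ φ x‖ ^ 2 * hessianTrace φ x| < M :=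
    (((hgc.norm.pow 2).mul (continuous_hessianTrace hφ)).abs.continuousAt.eventually_lt_const
      (lt_add_one _))
  have e4 : ∀ᶠ x in 𝓝 x₀, infLaplacian φ x₀ / 2 < infLaplacian φ x :=
    (continuous_infLaplacian hφ).continuousAt.eventually_const_lt (by linarith)
  obtain ⟨ρ, hρ, h⟩ := Metric.eventually_nhds_iff_ball.1 (e1.and (e2.and (e3.and e4)))
  refine ⟨(T - |φ x₀|) / 2, by linarith, ρ, hρ, ?_⟩
  have e5 : ∀ᶠ k in atTop, Λ k * T < α := (hΛ.mul_const T).eventually_lt_const hTα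
  filter_upwards [hp.eventually_gt_atTop 4, e5, eventually_lt_rpow hp
    ((one_lt_div hα0).2 hβ) (β ^ 4 / T), hp.eventually_gt_atTop
    (2 + (M + 1) / (infLaplacian φ x₀ / 2))] with k hk4 hk5 hk6 hk7 x hx
  obtain ⟨h1, h2, h3, h4⟩ := h x hx
  have hβ0 : 0 < β := hα0.trans hβ
  have hle : β ^ (p k - 4) ≤ divergence (pField (p k) φ) x := by
    rw [divergence_pField hk4 hφ]
    have h5 : M + 1 < (p k - 2) * (infLaplacian φ x₀ / 2) := by
      rw [← div_lt_iff₀ (by linarith)]; linarith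
    have h6 : (p k - 2) * (infLaplacian φ x₀ / 2) ≤ (p k - 2) * infLaplacian φ x :=
      mul_le_mul_of_nonneg_left h4.le (by linarith)
    have h7 : 1 ≤ ‖∇ φ x‖ ^ 2 * hessianTrace φ x + (p k - 2) * infLaplacian φ x := by
      linarith [(abs_lt.1 h3).1]
    have h8 : β ^ (p k - 4) ≤ ‖∇ φ x‖ ^ (p k - 4) :=
      Real.rpow_le_rpow hβ0.le h2.le (by linarith)
    exact h8.trans (le_mul_of_one_le_right (by positivity) h7)
  have hge : -(α ^ p k / T) ≤ Λ k ^ p k * oddPow (p k) (φ x - (T - |φ x₀|) / 2) := by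
    have h8 : oddPow (p k) (-T) ≤ oddPow (p k) (φ x - (T - |φ x₀|) / 2) :=
      monotone_oddPow (by linarith) (by linarith [(abs_lt.1 h1).1])
    refine le_trans ?_ (mul_le_mul_of_nonneg_left h8 (Real.rpow_nonneg (hΛ0 k) _))
    rw [oddPow_neg, oddPow_of_nonneg (by linarith) hT0.le, Real.rpow_sub_one hT0.ne', mul_neg,
      ← mul_div_assoc, ← Real.mul_rpow (hΛ0 k) hT0.le, neg_le_neg_iff]
    gcongr
    exact mul_nonneg (hΛ0 k) hT0.le
  refine lt_of_lt_of_le ?_ hge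
  rw [neg_lt_neg_iff]
  refine lt_of_lt_of_le ?_ hle
  have h9 : β ^ (p k - 4) = β ^ p k / β ^ 4 := by
    rw [Real.rpow_sub hβ0]; norm_cast
  rw [Real.div_rpow hβ0.le hα0.le, div_lt_div_iff₀ hT0 (by positivity)] at hk6
  rw [h9, div_lt_div_iff₀ hT0 (by positivity)]
  linarith

/-- For a positive value the minimum is negative if either entry is; for a negative value both
entries of the maximum are. At the value zero, `Δ_∞ φ > 0` already forces a nonzero gradient, which
is the second inequality needed. -/
lemma isStrictNear_of_eigenOp_neg (hφ : ContDiff ℝ 2 φ) (hp : Tendsto p atTop atTop)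
    (hΛ : Tendsto Λ atTop (𝓝 L)) (hΛ0 : ∀ k, 0 ≤ Λ k) (h : eigenOp L (φ x₀) φ x₀ < 0) :
    IsStrictNear φ x₀ p Λ := by
  have hL : 0 ≤ L := ge_of_tendsto' hΛ hΛ0
  rw [eigenOp] at h
  split_ifs at h with h1 h2
  · rw [abs_of_pos h1] at h
    rcases min_lt_iff.1 h with h | h
    · exact isStrictNear_of_norm_gradient_lt hφ hp hΛ hL (by linarith)
    · exact isStrictNear_of_infLaplacian_pos hφ hp hΛ0 h1 (by linarith)
  · rw [max_lt_iff] at h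
    exact isStrictNear_of_lt_norm_gradient hφ hp hΛ hL hΛ0 (by linarith) (by linarith)
  · have h0 : φ x₀ = 0 := le_antisymm (not_lt.1 h1) (not_lt.1 h2)
    have hI : 0 < infLaplacian φ x₀ := by linarith
    refine isStrictNear_of_lt_norm_gradient hφ hp hΛ hL hΛ0 hI ?_
    rw [h0, abs_zero, mul_zero, norm_pos_iff]
    intro hg
    simp [infLaplacian, hg] at hI

end StrictTest

/-! ### Testing minimality near a contact point -/

section Cutoff

variable {n : ℕ} {Ω S : Set (𝔼 n)} {φ : (𝔼 n) → ℝ}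

lemma lipschitzWith_mul_of_bounded {f g : (𝔼 n) → ℝ} {A B a b : ℝ≥0} (hf : LipschitzWith A f)
    (hg : LipschitzWith B g) (hfa : ∀ x, |f x| ≤ a) (hgb : ∀ x, |g x| ≤ b) :
    LipschitzWith (a * B + b * A) fun x => f x * g x := by
  refine LipschitzWith.of_dist_le_mul fun x y => ?_
  have h1 := hf.dist_le_mul x y
  have h2 := hg.dist_le_mul x y
  rw [Real.dist_eq] at h1 h2 ⊢
  have h3 : f x * g x - f y * g y = f x * (g x - g y) + g y * (f x - f y) := by ring
  rw [h3]
  refine (abs_add_le _ _).trans ?_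
  rw [abs_mul, abs_mul]
  push_cast
  calc |f x| * |g x - g y| + |g y| * |f x - f y| ≤ a * (B * dist x y) + b * (A * dist x y) := by
        gcongr
        exacts [hfa x, hgb y]
    _ = _ := by ring

/-- Multiplying `Y` by a bump equal to 1 on the support of `χ` does not change the product and makes
both factors bounded and Lipschitz. -/
lemma exists_lipschitzWith_mul_contDiff {χ Y : (𝔼 n) → ℝ} {A : ℝ≥0} (hχ : LipschitzWith A χ)
    (hc : HasCompactSupport χ) (hY : ContDiff ℝ 1 Y) :
    ∃ C, LipschitzWith C fun x => χ x * Y x := by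
  obtain ⟨R, hR⟩ := hc.isCompact.isBounded.subset_closedBall (0 : 𝔼 n)
  let θ : ContDiffBump (0 : 𝔼 n) := ⟨max R 1, max R 1 + 1, by positivity, by linarith⟩
  have hZ : ContDiff ℝ 1 fun x => θ x * Y x := θ.contDiff.mul hY
  have hZc : HasCompactSupport fun x => θ x * Y x := θ.hasCompactSupport.mul_right
  obtain ⟨B, hB⟩ := hZ.lipschitzWith_of_hasCompactSupport hZc one_ne_zero
  obtain ⟨b, hb⟩ := hZc.exists_bound_of_continuous hZ.continuous
  obtain ⟨a, ha⟩ := hc.exists_bound_of_continuous hχ.continuous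
  have heq : (fun x => χ x * Y x) = fun x => χ x * (θ x * Y x) := by
    funext x
    by_cases hx : x ∈ tsupport χ
    · rw [θ.one_of_mem_closedBall (Metric.closedBall_subset_closedBall (le_max_left _ _) (hR hx)),
        one_mul]
    · rw [image_eq_zero_of_notMem_tsupport hx, zero_mul, zero_mul]
  rw [heq]
  exact ⟨_, lipschitzWith_mul_of_bounded hχ hB
    (fun x => (ha x).trans (Real.le_coe_toNNReal a)) fun x => (hb x).trans (Real.le_coe_toNNReal b)⟩

/-- A cutoff function with compact support in `Ω`, which on `S` increases in the direction of the
gradient of `φ`. -/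
structure IsCutoff (Ω S : Set (𝔼 n)) (φ χ : (𝔼 n) → ℝ) : Prop where
  lipschitz : ∃ C, LipschitzWith C χ
  hasCompactSupport : HasCompactSupport χ
  tsupport_subset : tsupport χ ⊆ Ω
  nonneg : ∀ x, 0 ≤ χ x
  le_one : ∀ x, χ x ≤ 1
  fderiv_nonneg : ∀ᵐ x, x ∈ Ω ∩ S → 0 ≤ fderiv ℝ χ x (∇ φ x)

/-- There are cutoff functions which tend to `1` on `Ω ∩ S`. -/
def HasCutoffs (Ω S : Set (𝔼 n)) (φ : (𝔼 n) → ℝ) : Prop :=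
  ∃ χ : ℕ → (𝔼 n) → ℝ, (∀ j, IsCutoff Ω S φ (χ j)) ∧
    ∀ x ∈ Ω ∩ S, Tendsto (fun j => χ j x) atTop (𝓝 1)

lemma HasCutoffs.mono {S' : Set (𝔼 n)} (h : HasCutoffs Ω S φ) (hS : S' ⊆ S) :
    HasCutoffs Ω S' φ := by
  obtain ⟨χ, h1, h2⟩ := h
  exact ⟨χ, fun j => ⟨(h1 j).1, (h1 j).2, (h1 j).3, (h1 j).4, (h1 j).5,
    (h1 j).6.mono fun x hx hxS => hx ⟨hxS.1, hS hxS.2⟩⟩, fun x hx => h2 x ⟨hx.1, hS hx.2⟩⟩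

lemma sum_inner_basisFun (v w : 𝔼 n) :
    ∑ i, ⟪v, EuclideanSpace.basisFun (Fin n) ℝ i⟫ * ⟪w, EuclideanSpace.basisFun (Fin n) ℝ i⟫ =
      ⟪v, w⟫ := by
  rw [← (EuclideanSpace.basisFun (Fin n) ℝ).sum_inner_mul_inner v w]
  exact Finset.sum_congr rfl fun i _ => by rw [real_inner_comm w]

variable {η : (𝔼 n) → ℝ} {H X : (𝔼 n) → (𝔼 n)}

lemma integrableOn_mul_of_continuous (hΩ : IsOpen Ω) (hb : Bornology.IsBounded Ω)
    {f g : (𝔼 n) → ℝ} (hf : IntegrableOn f Ω) (hg : Continuous g) :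
    IntegrableOn (fun x => f x * g x) Ω :=
  hf.mul_continuousOn_of_subset hg.continuousOn hΩ.measurableSet hb.isCompact_closure subset_closure

lemma integrableOn_inner_of_continuous (hΩ : IsOpen Ω) (hb : Bornology.IsBounded Ω)
    (hX : Continuous X) (hH : IntegrableOn H Ω) : IntegrableOn (fun x => ⟪X x, H x⟫) Ω := by
  have : (fun x => ⟪X x, H x⟫) = fun x => ∑ i, ⟪H x, EuclideanSpace.basisFun (Fin n) ℝ i⟫ *
      ⟪X x, EuclideanSpace.basisFun (Fin n) ℝ i⟫ := by
    funext x
    rw [sum_inner_basisFun, real_inner_comm]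
  rw [this]
  exact integrable_finsetSum _ fun i _ =>
    integrableOn_mul_of_continuous hΩ hb (hH.inner_const _) (hX.inner continuous_const)

/-- Test the weak gradient of `η` against the components of `χ X`, which have compact support in
`Ω`. The product rule leaves the extra term `η ∇χ · X`, which is nonnegative because `X` points
along `∇φ`, where `χ` increases on `S`, and `η` vanishes off `S`. -/
lemma HasWeakGrad.integral_cutoff_le (hη : HasWeakGrad Ω η H) (hΩ : IsOpen Ω)
    (hb : Bornology.IsBounded Ω) (hX : ContDiff ℝ 1 X) {c : (𝔼 n) → ℝ} (hc : ∀ x, 0 ≤ c x)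
    (hXφ : ∀ x, X x = c x • ∇ φ x) {χ : (𝔼 n) → ℝ} (hχ : IsCutoff Ω S φ χ)
    (hη0 : ∀ x ∈ Ω, 0 ≤ η x) (hηS : ∀ x ∈ Ω, x ∉ S → η x = 0) :
    ∫ x in Ω, χ x * (η x * divergence X x + ⟪X x, H x⟫) ≤ 0 := by
  set b := EuclideanSpace.basisFun (Fin n) ℝ with hbdef
  obtain ⟨A, hA⟩ := hχ.lipschitz
  have hXi : ∀ i, ContDiff ℝ 1 fun x => ⟪X x, b i⟫ := fun i => hX.inner ℝ contDiff_const
  choose C hC using fun i => exists_lipschitzWith_mul_contDiff hA hχ.hasCompactSupport (hXi i)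
  have hid : ∀ i, ∫ x in Ω, η x * lineDeriv ℝ (fun x => χ x * ⟪X x, b i⟫) x (b i) =
      -∫ x in Ω, χ x * ⟪X x, b i⟫ * ⟪H x, b i⟫ := fun i =>
    hη.integral_mul_lineDeriv hΩ (hC i) hχ.hasCompactSupport.mul_right
      ((tsupport_mul_subset_left).trans hχ.tsupport_subset) (b i)
  have hi1 : ∀ i, IntegrableOn
      (fun x => η x * lineDeriv ℝ (fun x => χ x * ⟪X x, b i⟫) x (b i)) Ω := fun i =>
    hη.1.mul_of_top_left ((hC i).memLp_lineDeriv (b i))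
  have hi2 : ∀ i, IntegrableOn (fun x => χ x * ⟪X x, b i⟫ * ⟪H x, b i⟫) Ω := fun i => by
    have := integrableOn_mul_of_continuous hΩ hb (hη.2.1.inner_const (𝕜 := ℝ) (b i))
      (hC i).continuous
    simpa only [mul_comm] using this
  have hi3 : ∀ i, IntegrableOn (fun x => η x * lineDeriv ℝ (fun x => χ x * ⟪X x, b i⟫) x (b i) +
      χ x * ⟪X x, b i⟫ * ⟪H x, b i⟫) Ω := fun i => (hi1 i).add (hi2 i)
  have hsum : ∫ x in Ω, ∑ i, (η x * lineDeriv ℝ (fun x => χ x * ⟪X x, b i⟫) x (b i) +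
      χ x * ⟪X x, b i⟫ * ⟪H x, b i⟫) = 0 := by
    rw [integral_finsetSum _ fun i _ => hi3 i]
    refine Finset.sum_eq_zero fun i _ => ?_
    rw [integral_add (hi1 i) (hi2 i), hid i, neg_add_cancel]
  have hinteg : IntegrableOn (fun x => χ x * (η x * divergence X x + ⟪X x, H x⟫)) Ω := by
    have := integrableOn_mul_of_continuous hΩ hb ((integrableOn_mul_of_continuous hΩ hb hη.1
      (continuous_divergence hX)).add (integrableOn_inner_of_continuous hΩ hb hX.continuous hη.2.1))
      hA.continuous
    simpa only [Pi.add_apply, mul_comm (χ _)] using this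
  rw [← hsum]
  refine integral_mono_ae hinteg (integrable_finsetSum _ fun i _ => hi3 i) ?_
  filter_upwards [ae_restrict_mem hΩ.measurableSet, ae_restrict_of_ae hχ.fderiv_nonneg,
    ae_restrict_of_ae (hA.ae_differentiableAt (μ := volume))] with x hx hfd hdiff
  have hXd : HasFDerivAt X (fderiv ℝ X x) x := (hX.differentiable one_ne_zero x).hasFDerivAt
  have hline : ∀ i, lineDeriv ℝ (fun x => χ x * ⟪X x, b i⟫) x (b i) =
      χ x * ⟪fderiv ℝ X x (b i), b i⟫ + fderiv ℝ χ x (b i) * ⟪X x, b i⟫ := by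
    intro i
    have h1 := hdiff.hasFDerivAt.mul (hXd.inner ℝ (hasFDerivAt_const (b i) x))
    have h2 := (h1.hasLineDerivAt (b i)).lineDeriv
    refine h2.trans ?_
    simp [fderivInnerCLM_apply]
    ring
  have hfX : ∑ i, fderiv ℝ χ x (b i) * ⟪X x, b i⟫ = fderiv ℝ χ x (X x) := by
    conv_rhs => rw [← b.sum_repr (X x), map_sum]
    refine Finset.sum_congr rfl fun i _ => ?_
    rw [map_smul, b.repr_apply_apply, real_inner_comm, smul_eq_mul, mul_comm]
  have hfX0 : 0 ≤ η x * fderiv ℝ χ x (X x) := by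
    by_cases hxS : x ∈ S
    · rw [hXφ, map_smul, smul_eq_mul]
      exact mul_nonneg (hη0 x hx) (mul_nonneg (hc x) (hfd ⟨hx, hxS⟩))
    · rw [hηS x hx hxS, zero_mul]
  have hexp : ∑ i, (η x * lineDeriv ℝ (fun x => χ x * ⟪X x, b i⟫) x (b i) +
      χ x * ⟪X x, b i⟫ * ⟪H x, b i⟫) =
      χ x * (η x * divergence X x + ⟪X x, H x⟫) + η x * fderiv ℝ χ x (X x) := by
    rw [← hfX, ← sum_inner_basisFun (X x) (H x), divergence, Finset.mul_sum,
      ← Finset.sum_add_distrib,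
      Finset.mul_sum, Finset.mul_sum, ← Finset.sum_add_distrib]
    refine Finset.sum_congr rfl fun i _ => ?_
    rw [hline i]
    ring
  rw [hexp]
  linarith

/-- A one-sided Green formula, obtained by letting the cutoffs tend to 1. It expresses that the flux
of `η X` through the boundary is nonpositive, without using traces. -/
lemma HasWeakGrad.integral_divergence_le (hη : HasWeakGrad Ω η H) (hΩ : IsOpen Ω)
    (hb : Bornology.IsBounded Ω) (hX : ContDiff ℝ 1 X) {c : (𝔼 n) → ℝ} (hc : ∀ x, 0 ≤ c x)
    (hXφ : ∀ x, X x = c x • ∇ φ x) (hcut : HasCutoffs Ω S φ)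
    (hη0 : ∀ x ∈ Ω, 0 ≤ η x) (hηS : ∀ x ∈ Ω, x ∉ S → η x = 0) (hHS : ∀ x ∈ Ω, x ∉ S → H x = 0) :
    (∫ x in Ω, η x * divergence X x) + ∫ x in Ω, ⟪X x, H x⟫ ≤ 0 := by
  obtain ⟨χ, hχ, hlim⟩ := hcut
  have hi1 := integrableOn_mul_of_continuous hΩ hb hη.1 (continuous_divergence hX)
  have hi2 := integrableOn_inner_of_continuous hΩ hb hX.continuous hη.2.1
  have hi := hi1.add hi2
  rw [← integral_add hi1 hi2]
  refine le_of_tendsto' (tendsto_integral_of_dominated_convergence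
    (F := fun j x => χ j x * (η x * divergence X x + ⟪X x, H x⟫))
    (fun x => ‖η x * divergence X x + ⟪X x, H x⟫‖) (fun j => ?_) hi.norm (fun j => ?_) ?_)
    fun j => hη.integral_cutoff_le hΩ hb hX hc hXφ (hχ j) hη0 hηS
  · obtain ⟨A, hA⟩ := (hχ j).lipschitz
    exact hA.continuous.aestronglyMeasurable.mul hi.aestronglyMeasurable
  · refine Eventually.of_forall fun x => ?_
    rw [norm_mul, Real.norm_of_nonneg ((hχ j).nonneg x)]
    exact mul_le_of_le_one_left (norm_nonneg _) ((hχ j).le_one x)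
  · filter_upwards [ae_restrict_mem hΩ.measurableSet] with x hx
    by_cases hxS : x ∈ S
    · simpa using (hlim x ⟨hx, hxS⟩).mul_const (η x * divergence X x + ⟪X x, H x⟫)
    · simp [hηS x hx hxS, hHS x hx hxS]

end Cutoff

/-! ### Comparison of minimizers with strict subsolutions -/

section Contact

variable {n : ℕ} {Ω S : Set (𝔼 n)} {φ ψ u : (𝔼 n) → ℝ} {G : (𝔼 n) → (𝔼 n)} {x₀ : 𝔼 n}

/-- Testing minimality with `max ψ u`. -/
lemma Minimizer.integral_test_nonpos {p Λ B : ℝ} (h : Minimizer Ω p Λ u G) (hΩ : IsOpen Ω)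
    (hb : Bornology.IsBounded Ω) (hp : 4 < p) (hψ : ContDiff ℝ 2 ψ) (hcut : HasCutoffs Ω S ψ)
    (hu : ∀ x ∈ Ω, |u x| ≤ B) (hS : ∀ x ∈ Ω, x ∉ S → ψ x ≤ u x) :
    IntegrableOn (fun x => max (ψ x + -u x) 0 *
      (Λ ^ p * oddPow p (u x) + divergence (pField p ψ) x)) Ω ∧
    ∫ x in Ω, max (ψ x + -u x) 0 * (Λ ^ p * oddPow p (u x) + divergence (pField p ψ) x) ≤ 0 := by
  have := isFiniteMeasure_restrict hb
  have hψ1 : ContDiff ℝ 1 ψ := hψ.of_le (by norm_num)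
  have hX := contDiff_pField (p := p) (by linarith) hψ
  have hw := (hasWeakGrad_of_contDiff hΩ hb hψ1).add (h.sobolev.hasWeakGrad hb (by linarith)).neg
  have hη := hw.posPart hΩ
  set η : (𝔼 n) → ℝ := fun x => max (ψ x + -u x) 0 with hηdef
  set D : Set (𝔼 n) := {x | 0 < ψ x + -u x} with hD
  set H : (𝔼 n) → (𝔼 n) := D.indicator fun x => ∇ ψ x + -G x with hH
  obtain ⟨K, hK⟩ := hb.isCompact_closure.exists_bound_of_continuousOn hψ.continuous.continuousOn
  have hη0 : ∀ x, 0 ≤ η x := fun x => le_max_right _ _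
  have hηK : ∀ x ∈ Ω, |η x| ≤ K + B := fun x hx => by
    rw [abs_of_nonneg (hη0 x)]
    have h1 := (abs_le.1 (hK x (subset_closure hx))).2
    have h2 := abs_le.1 (hu x hx)
    have h3 := (abs_nonneg (ψ x)).trans (hK x (subset_closure hx))
    have h4 := (abs_nonneg (u x)).trans (hu x hx)
    exact max_le (by linarith) (by linarith)
  have hHp : MemLp H (ENNReal.ofReal p) (volume.restrict Ω) := by
    obtain ⟨K', hK'⟩ := hb.isCompact_closure.exists_bound_of_continuousOn
      (continuous_gradient hψ1).continuousOn
    have h1 : MemLp (∇ ψ) (ENNReal.ofReal p) (volume.restrict Ω) := by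
      refine MemLp.of_bound (continuous_gradient hψ1).aestronglyMeasurable K' ?_
      filter_upwards [ae_restrict_mem hΩ.measurableSet] with x hx using hK' x (subset_closure hx)
    exact (h1.add h.sobolev.2.1.neg).mono hη.2.1.aestronglyMeasurable
      (Eventually.of_forall fun x => norm_indicator_le_norm_self _ _)
  have hηp : MemLp η (ENNReal.ofReal p) (volume.restrict Ω) := by
    refine MemLp.of_bound hη.1.aestronglyMeasurable (K + B) ?_
    filter_upwards [ae_restrict_mem hΩ.measurableSet] with x hx using hηK x hx
  have hv : IsSobolevPair Ω p (fun x => u x + η x) (fun x => G x + H x) :=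
    ⟨h.sobolev.1.add hηp, h.sobolev.2.1.add hHp,
      ((h.sobolev.hasWeakGrad hb (by linarith)).add hη).isWeakGradient⟩
  have hKB : ∀ x ∈ Ω, 0 ≤ K + B := fun x hx => (abs_nonneg _).trans (hηK x hx)
  -- The competitor is `u + η = max ψ u`.
  have hmin := h.add_integral_le hb hΩ (by linarith) hv (B := B + (K + B))
    (fun x hx => (hu x hx).trans (by linarith [hKB x hx]))
    fun x hx => (abs_add_le _ _).trans (add_le_add (hu x hx) (hηK x hx))
  simp only [add_sub_cancel_left] at hmin
  have hHS : ∀ x ∈ Ω, x ∉ S → H x = 0 := fun x hx hxS =>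
    indicator_of_notMem (show x ∉ D from (show ψ x + -u x ≤ 0 by linarith [hS x hx hxS]).not_gt) _
  have hηS : ∀ x ∈ Ω, x ∉ S → η x = 0 := fun x hx hxS =>
    max_eq_right (by linarith [hS x hx hxS])
  have hdiv := hη.integral_divergence_le hΩ hb hX
    (c := fun x => ‖∇ ψ x‖ ^ (p - 2)) (fun x => by positivity) (fun x => rfl) hcut
    (fun x _ => hη0 x) hηS hHS
  -- Convexity is used at `∇ψ`, not at `G`: on `D` the new gradient is `∇ψ`. The field that appears
  -- is then the `C¹` field of `ψ`, to which the Green formula applies.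
  have hconv : ∫ x in Ω, ‖G x + H x‖ ^ p ≤
      ∫ x in Ω, (‖G x‖ ^ p + p * ⟪pField p ψ x, H x⟫) := by
    refine integral_mono_ae ?_ ?_ (Eventually.of_forall fun x => ?_)
    · have := hv.2.1.integrable_norm_rpow (by simp; linarith) (by simp)
      simpa only [ENNReal.toReal_ofReal (by linarith : 0 ≤ p)] using this
    · exact (h.integrableOn_grad (by linarith)).add
        ((integrableOn_inner_of_continuous hΩ hb hX.continuous hη.2.1).const_mul p)
    · by_cases hx : x ∈ D
      · simp only [hH, indicator_of_mem hx, pField, inner_smul_left, RCLike.conj_to_real]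
        have h1 := norm_rpow_add_le (p := p) (by linarith) (∇ ψ x) (G x)
        rw [← sub_eq_add_neg, add_sub_cancel, ← neg_sub (G x) (∇ ψ x), inner_neg_right]
        linarith
      · simp [hH, indicator_of_notMem hx]
  rw [integral_add (h.integrableOn_grad (by linarith))
    ((integrableOn_inner_of_continuous hΩ hb hX.continuous hη.2.1).const_mul p),
    integral_const_mul] at hconv
  have hi1 := integrableOn_mul_of_continuous hΩ hb hη.1 (continuous_divergence hX)
  have hio : IntegrableOn (fun x => oddPow p (u x)) Ω :=
    integrableOn_comp_of_bounded hb hΩ h.sobolev.1.1 hu (continuous_oddPow (by linarith))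
  have hi2 : IntegrableOn (fun x => oddPow p (u x) * η x) Ω := by
    have h2 : IntegrableOn (fun x => η x * oddPow p (u x)) Ω := by
      refine hio.bdd_mul (c := K + B) hη.1.aestronglyMeasurable ?_
      filter_upwards [ae_restrict_mem hΩ.measurableSet] with x hx using hηK x hx
    simpa only [mul_comm] using h2
  have heq : (fun x => η x * (Λ ^ p * oddPow p (u x) + divergence (pField p ψ) x)) =
      fun x => Λ ^ p * (oddPow p (u x) * η x) + η x * divergence (pField p ψ) x := by
    funext x; ring
  refine ⟨by rw [heq]; exact (hi2.const_mul _).add hi1, ?_⟩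
  rw [heq, integral_add (hi2.const_mul _) hi1, integral_const_mul]
  have hp0 : 0 < p := by linarith
  have h1 : p * (Λ ^ p * ∫ x in Ω, oddPow p (u x) * η x) ≤
      p * ∫ x in Ω, ⟪pField p ψ x, H x⟫ := by linarith
  have h2 := le_of_mul_le_mul_left h1 hp0
  linarith

lemma gradient_add_const (φ : (𝔼 n) → ℝ) (m : ℝ) : ∇ (fun x => φ x + m) = ∇ φ := by
  funext x
  rw [gradient, gradient, fderiv_add_const]

lemma HasCutoffs.add_const (h : HasCutoffs Ω S φ) (m : ℝ) : HasCutoffs Ω S fun x => φ x + m := by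
  obtain ⟨χ, h1, h2⟩ := h
  refine ⟨χ, fun j => ⟨(h1 j).1, (h1 j).2, (h1 j).3, (h1 j).4, (h1 j).5, ?_⟩, h2⟩
  rw [gradient_add_const]
  exact (h1 j).6

variable {p Λ : ℕ → ℝ} {W : ℕ → (𝔼 n) → ℝ} {F : ℕ → (𝔼 n) → (𝔼 n)} {W' : (𝔼 n) → ℝ}

/-- A strict subsolution cannot touch the limit from below at a point near which cutoff functions
exist. -/
lemma IsMinimizerLimit.not_isStrictNear (h : IsMinimizerLimit Ω p Λ W F W') (hΩ : IsOpen Ω)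
    (hb : Bornology.IsBounded Ω) (hφ : ContDiff ℝ 2 φ) (hx₀ : x₀ ∈ closure Ω)
    (heq : W' x₀ = φ x₀) (hlt : ∀ x ∈ closure Ω, x ≠ x₀ → φ x < W' x) {r : ℝ} (hr : 0 < r)
    (hcut : HasCutoffs Ω (Metric.ball x₀ r) φ) : ¬IsStrictNear φ x₀ p Λ := by
  rintro ⟨m₀, hm₀, ρ₀, hρ₀, hev⟩
  set ρ := min r ρ₀ with hρ
  have hρ0 : 0 < ρ := lt_min hr hρ₀
  obtain ⟨m₁, hm₁, hm₁'⟩ : ∃ m > 0, ∀ x ∈ closure Ω \ Metric.ball x₀ ρ, m ≤ W' x - φ x := by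
    have hcp : IsCompact (closure Ω \ Metric.ball x₀ ρ) :=
      hb.isCompact_closure.diff Metric.isOpen_ball
    rcases (closure Ω \ Metric.ball x₀ ρ).eq_empty_or_nonempty with he | hne
    · exact ⟨1, one_pos, fun x hx => absurd hx (he ▸ notMem_empty x)⟩
    · obtain ⟨z, hz, hzm⟩ := hcp.exists_isMinOn hne ((h.continuousOn_limit.sub
        hφ.continuous.continuousOn).mono sdiff_subset)
      refine ⟨W' z - φ z, sub_pos.2 (hlt z hz.1 ?_), fun x hx => hzm hx⟩
      rintro rfl
      exact hz.2 (Metric.mem_ball_self hρ0)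
  -- The gap `m₁` off the ball must exceed the raise of `φ` and the uniform error together, each at
  -- most `m₁ / 3`.
  set m := min m₀ (m₁ / 3) with hm
  have hm0 : 0 < m := lt_min hm₀ (by linarith)
  have hunif : ∀ᶠ k in atTop, ∀ x ∈ closure Ω, |W' x - W k x| < m :=
    Metric.tendstoUniformlyOn_iff.1 h.tendsto m hm0
  obtain ⟨k, hk, hku⟩ := (hev.and hunif).exists
  obtain ⟨B, hB⟩ := h.bounded
  have hpk := h.four_lt k
  have hψ : ContDiff ℝ 2 fun x => φ x + m := hφ.add contDiff_const
  have hcut' := (hcut.mono (Metric.ball_subset_ball (min_le_left r ρ₀))).add_const m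
  obtain ⟨hinteg, hle⟩ := (h.minimizer k).integral_test_nonpos hΩ hb hpk hψ hcut' (hB k)
    fun x hx hxS => by
      have h1 := hm₁' x ⟨subset_closure hx, hxS⟩
      have h2 := (abs_lt.1 (hku x (subset_closure hx))).2
      have h3 := min_le_right m₀ (m₁ / 3)
      linarith
  have hfield : pField (p k) (fun x => φ x + m) = pField (p k) φ := by
    funext x
    rw [pField, pField, gradient_add_const]
  rw [hfield] at hinteg hle
  -- Where the raised `φ` exceeds `W k`, the point is near `x₀`, and uniform convergence gives `W k
  -- ≥ φ - m₀`. Monotonicity of `oddPow` then transfers strictness from `φ - m₀` to `W k`.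
  have hpos : ∀ x ∈ Ω, 0 < φ x + m + -W k x →
      0 < Λ k ^ p k * oddPow (p k) (W k x) + divergence (pField (p k) φ) x := by
    intro x hx hxm
    have h2 := abs_lt.1 (hku x (subset_closure hx))
    have hxρ : x ∈ Metric.ball x₀ ρ := by
      by_contra hxS
      have h1 := hm₁' x ⟨subset_closure hx, hxS⟩
      have h3 := min_le_right m₀ (m₁ / 3)
      linarith
    have h4 := hk x (Metric.ball_subset_ball (min_le_right r ρ₀) hxρ)
    have h5 : φ x ≤ W' x := by
      rcases eq_or_ne x x₀ with rfl | hne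
      · exact heq.ge
      · exact (hlt x (subset_closure hx) hne).le
    have h6 : oddPow (p k) (φ x - m₀) ≤ oddPow (p k) (W k x) :=
      monotone_oddPow (by linarith) (by linarith [min_le_left m₀ (m₁ / 3)])
    have h7 := mul_le_mul_of_nonneg_left h6 (Real.rpow_nonneg (h.minimizer k).nonneg (p k))
    linarith
  have hc : ContinuousOn (fun x => φ x + m + -W k x) (closure Ω) :=
    (hψ.continuous.continuousOn).add (h.continuousOn k).neg
  have hT : IsOpen (Ω ∩ (fun x => φ x + m + -W k x) ⁻¹' Ioi 0) :=
    (hc.mono subset_closure).isOpen_inter_preimage hΩ isOpen_Ioi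
  -- If `x₀` is a boundary point it is not in `Ω`, but continuity on the closure gives nearby points
  -- of `Ω`.
  have hTne : (Ω ∩ (fun x => φ x + m + -W k x) ⁻¹' Ioi 0).Nonempty := by
    have h0 : 0 < φ x₀ + m + -W k x₀ := by
      have := abs_lt.1 (hku x₀ hx₀)
      linarith
    have h1 : ∀ᶠ x in 𝓝[closure Ω] x₀, 0 < φ x + m + -W k x :=
      (hc x₀ hx₀).eventually_const_lt h0
    have h2 : ∀ᶠ x in 𝓝[Ω] x₀, 0 < φ x + m + -W k x :=
      h1.filter_mono (nhdsWithin_mono _ subset_closure)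
    have : (𝓝[Ω] x₀).NeBot := mem_closure_iff_nhdsWithin_neBot.1 hx₀
    obtain ⟨x, hx1, hx2⟩ := ((eventually_mem_nhdsWithin (s := Ω)).and h2).exists
    exact ⟨x, hx1, hx2⟩
  refine hle.not_gt ((setIntegral_pos_iff_support_of_nonneg_ae ?_ hinteg).2
    ((hT.measure_pos volume hTne).trans_le (measure_mono ?_)))
  · filter_upwards [ae_restrict_mem hΩ.measurableSet] with x hx
    rcases le_or_gt (φ x + m + -W k x) 0 with hx0 | hx0
    · simp [max_eq_right hx0]
    · exact mul_nonneg (le_max_right _ _) (hpos x hx hx0).le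
  · rintro x ⟨hx, hx0⟩
    exact ⟨(mul_pos (lt_max_of_lt_left hx0) (hpos x hx hx0)).ne', hx⟩

end Contact

/-! ### Cutoff functions near interior points and near boundary points -/

section Normals

variable {n : ℕ} {Ω : Set (𝔼 n)} {φ : (𝔼 n) → ℝ} {x₀ : 𝔼 n}

/-- A single bump equal to 1 near `x₀` serves for every `j`: its derivative vanishes there, so no
condition on `φ` is needed. -/
lemma hasCutoffs_of_mem (hΩ : IsOpen Ω) (hx₀ : x₀ ∈ Ω) (φ : (𝔼 n) → ℝ) :
    ∃ r > 0, HasCutoffs Ω (Metric.ball x₀ r) φ := by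
  obtain ⟨s, hs, hsΩ⟩ := Metric.isOpen_iff.1 hΩ x₀ hx₀
  let θ : ContDiffBump x₀ := ⟨s / 3, s / 2, by positivity, by linarith⟩
  refine ⟨s / 3, by positivity, fun _ => θ, fun _ => ⟨?_, θ.hasCompactSupport, ?_,
    fun x => θ.nonneg, fun x => θ.le_one, Eventually.of_forall fun x hx => ?_⟩, fun x hx => ?_⟩
  · exact ContDiff.lipschitzWith_of_hasCompactSupport (n := 1) θ.hasCompactSupport θ.contDiff
      one_ne_zero
  · rw [θ.tsupport_eq]
    exact (Metric.closedBall_subset_ball (by change s / 2 < s; linarith)).trans hsΩ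
  · have h1 : (θ : (𝔼 n) → ℝ) =ᶠ[𝓝 x] fun _ => 1 := θ.eventuallyEq_one_of_mem_ball hx.2
    rw [h1.fderiv_eq]
    simp
  · have h1 : θ x = 1 := θ.one_of_mem_closedBall (Metric.ball_subset_closedBall hx.2)
    simp only [h1]
    exact tendsto_const_nhds

lemma inner_gradient (f : (𝔼 n) → ℝ) (x v : 𝔼 n) : ⟪∇ f x, v⟫ = fderiv ℝ f x v := by
  simp [gradient]

lemma exists_mem_normals {y η : ℕ → 𝔼 n} (h : ∀ k, IsExteriorNormal Ω (y k) (η k))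
    (hy : Tendsto y atTop (𝓝 x₀)) : ∃ ν ∈ normals Ω x₀, ∃ σ : ℕ → ℕ, StrictMono σ ∧
      Tendsto (fun k => η (σ k)) atTop (𝓝 ν) := by
  obtain ⟨ν, -, σ, hσ, hν⟩ := (isCompact_sphere (0 : 𝔼 n) 1).tendsto_subseq
    (x := η) fun k => by simpa using (h k).2.1
  exact ⟨ν, ⟨fun k => y (σ k), fun k => η (σ k), fun k => h _, hy.comp hσ.tendsto_atTop, hν⟩,
    σ, hσ, hν⟩

/-- By compactness of the unit sphere. The definition of exterior normals as limits makes the strict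
sign at `x₀` persist for the classical normals at nearby boundary points and for the gradients at
nearby points. -/
lemma exists_ball_inner_normal_neg (hφ : ContDiff ℝ 2 φ)
    (hneg : ∀ ν ∈ normals Ω x₀, ⟪∇ φ x₀, ν⟫ < 0) :
    ∃ ρ > 0, ∀ y ∈ Metric.ball x₀ ρ, ∀ η, IsExteriorNormal Ω y η →
      ∀ z ∈ Metric.ball x₀ ρ, ⟪∇ φ z, η⟫ < 0 := by
  by_contra! hcon
  choose y hy η hη z hz hyz using fun k : ℕ => hcon (1 / ((k : ℝ) + 1)) (by positivity)
  have hlim : ∀ w : ℕ → 𝔼 n, (∀ k : ℕ, w k ∈ Metric.ball x₀ (1 / ((k : ℝ) + 1))) →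
      Tendsto w atTop (𝓝 x₀) := fun w hw =>
    tendsto_iff_dist_tendsto_zero.2 (squeeze_zero (fun _ => dist_nonneg) (fun k => (hw k).le)
      tendsto_one_div_add_atTop_nhds_zero_nat)
  obtain ⟨ν, hν, σ, hσ, hlimν⟩ := exists_mem_normals hη (hlim y hy)
  have h1 : Tendsto (fun k => ⟪∇ φ (z (σ k)), η (σ k)⟫) atTop (𝓝 ⟪∇ φ x₀, ν⟫) :=
    (((contDiff_gradient hφ).continuous.tendsto x₀).comp
      ((hlim z hz).comp hσ.tendsto_atTop)).inner hlimν
  exact (ge_of_tendsto' h1 fun k => hyz (σ k)).not_gt (hneg ν hν)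

namespace Chart

variable (c : Chart Ω x₀)

/-- The boundary point below `y`. -/
def foot (y : 𝔼 n) : 𝔼 n := y - c.g y • c.e

lemma g_foot (y : 𝔼 n) : c.g (c.foot y) = 0 := by
  have := c.g_add y (-c.g y)
  rw [foot, sub_eq_add_neg, ← neg_smul, this, add_neg_cancel]

lemma dist_foot_le (hΩ : IsOpen Ω) (hx₀ : x₀ ∈ frontier Ω) (y : 𝔼 n) :
    dist (c.foot y) x₀ ≤ (1 + c.L) * dist y x₀ := by
  have h1 := c.abs_g_sub_le y x₀
  rw [c.g_center hΩ hx₀, sub_zero] at h1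
  have h2 : c.foot y - x₀ = (y - x₀) - c.g y • c.e := by rw [foot]; abel
  rw [dist_eq_norm, dist_eq_norm, h2]
  refine (norm_sub_le _ _).trans ?_
  rw [norm_smul, c.norm_e, mul_one, Real.norm_eq_abs]
  linarith

/-- Along `e` the function `g` changes only by an additive constant, so differentiability is shared
by all points of a line parallel to `e`. -/
lemma hasFDerivAt_foot {y : 𝔼 n} (hd : DifferentiableAt ℝ c.g y) :
    HasFDerivAt c.g (fderiv ℝ c.g y) (c.foot y) := by
  have h1 : c.g = fun z => c.g (z + c.g y • c.e) - c.g y := by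
    funext z
    rw [c.g_add]; ring
  have h2 : HasFDerivAt c.g (fderiv ℝ c.g y) (c.foot y + c.g y • c.e) := by
    rw [foot, sub_add_cancel]; exact hd.hasFDerivAt
  have h3 := (h2.comp (c.foot y) ((hasFDerivAt_id _).add_const (c.g y • c.e))).sub_const (c.g y)
  rw [ContinuousLinearMap.comp_id] at h3
  refine h3.congr_of_eventuallyEq (Eventually.of_forall fun z => ?_)
  exact congrFun h1 z

lemma gradient_ne_zero {y : 𝔼 n} (hd : DifferentiableAt ℝ c.g y) : ∇ c.g y ≠ 0 := by
  have h1 : HasDerivAt (fun t : ℝ => c.g (y + t • c.e)) (fderiv ℝ c.g y c.e) 0 :=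
    hd.hasFDerivAt.hasLineDerivAt c.e
  have h2 : HasDerivAt (fun t : ℝ => c.g (y + t • c.e)) 1 0 := by
    simp only [c.g_add]
    simpa using (hasDerivAt_id (0 : ℝ)).const_add (c.g y)
  intro h
  have h3 := h1.unique h2
  rw [← inner_gradient, h, inner_zero_left] at h3
  exact zero_ne_one h3

/-- Near the foot, `Ω` is the set where `g` is positive and `g` vanishes at the foot, so the
first-order expansion of `g` compares `Ω` with a half-space; the exterior direction is minus the
gradient. -/
lemma isExteriorNormal_foot (hΩ : IsOpen Ω) {y : 𝔼 n} (hd : DifferentiableAt ℝ c.g y)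
    (hy : c.foot y ∈ Metric.ball x₀ c.r) :
    IsExteriorNormal Ω (c.foot y) (-(‖∇ c.g y‖⁻¹ • ∇ c.g y)) := by
  have hN : 0 < ‖∇ c.g y‖ := norm_pos_iff.2 (c.gradient_ne_zero hd)
  have h0 := c.g_foot y
  refine ⟨⟨Metric.mem_closure_iff.2 fun ε hε => ?_, ?_⟩, ?_, fun ε hε => ?_⟩
  · rw [Metric.mem_ball] at hy
    set δ := min ε (c.r - dist (c.foot y) x₀) / 2 with hδ
    have hm : 0 < min ε (c.r - dist (c.foot y) x₀) := lt_min hε (by linarith)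
    have hδ0 : 0 < δ := by positivity
    have hdist : dist (c.foot y + δ • c.e) (c.foot y) = δ := by
      rw [dist_eq_norm, add_sub_cancel_left, norm_smul, c.norm_e, mul_one,
        Real.norm_of_nonneg hδ0.le]
    refine ⟨c.foot y + δ • c.e, (c.mem_iff _ ?_).2 ?_, ?_⟩
    · rw [Metric.mem_ball]
      have := dist_triangle (c.foot y + δ • c.e) (c.foot y) x₀
      linarith [min_le_right ε (c.r - dist (c.foot y) x₀)]
    · rw [c.g_add, h0]; linarith
    · rw [dist_comm, hdist]
      linarith [min_le_left ε (c.r - dist (c.foot y) x₀)]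
  · rw [hΩ.interior_eq, c.mem_iff _ hy, h0]
    exact lt_irrefl 0
  · rw [norm_neg, norm_smul, norm_inv, norm_norm, inv_mul_cancel₀ hN.ne']
  · have h1 := (c.hasFDerivAt_foot hd).isLittleO.def (mul_pos hε hN)
    have h2 : ∀ᶠ z in 𝓝 (c.foot y), z ∈ Metric.ball x₀ c.r := Metric.isOpen_ball.mem_nhds hy
    obtain ⟨r, hr, h3⟩ := Metric.eventually_nhds_iff_ball.1 (h1.and h2)
    refine ⟨r, hr, fun z hz => ?_⟩
    obtain ⟨h4, h5⟩ := h3 z hz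
    rw [h0, sub_zero, Real.norm_eq_abs, abs_le] at h4
    have h6 : ⟪z - c.foot y, -(‖∇ c.g y‖⁻¹ • ∇ c.g y)⟫ =
        -(fderiv ℝ c.g y (z - c.foot y) / ‖∇ c.g y‖) := by
      rw [inner_neg_right, inner_smul_right, real_inner_comm, inner_gradient]
      ring
    rw [h6]
    refine ⟨fun hzΩ => ?_, fun hzΩ => ?_⟩
    · have h7 := (c.mem_iff z h5).1 hzΩ
      rw [neg_le, le_div_iff₀ hN]
      linarith
    · have h7 := not_lt.1 (mt (c.mem_iff z h5).2 hzΩ)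
      rw [neg_le_neg_iff, div_le_iff₀ hN]
      linarith

/-- Rademacher's theorem gives differentiability points of `g` arbitrarily near `x₀`; their feet
carry classical normals, which subconverge. Existence matters since the boundary condition asks for
some normal. -/
lemma normals_nonempty (c : Chart Ω x₀) (hΩ : IsOpen Ω) (hx₀ : x₀ ∈ frontier Ω) :
    (normals Ω x₀).Nonempty := by
  have hdense : Dense {x | DifferentiableAt ℝ c.g x} :=
    Measure.dense_of_ae (c.lip.ae_differentiableAt (μ := volume))
  have hL : (0 : ℝ) < 1 + c.L := by positivity
  have hr := c.r_pos
  choose x hxd hx using fun k : ℕ => Metric.dense_iff.1 hdense x₀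
    (c.r / (1 + c.L) * (1 / ((k : ℝ) + 1))) (by positivity) |>.imp fun _ h => And.symm h
  have hd : ∀ k, dist (c.foot (x k)) x₀ < c.r * (1 / ((k : ℝ) + 1)) := fun k => by
    refine (c.dist_foot_le hΩ hx₀ (x k)).trans_lt ?_
    have h1 := mul_lt_mul_of_pos_left (Metric.mem_ball.1 (hx k)) hL
    refine h1.trans_eq ?_
    field_simp
  have hball : ∀ k, c.foot (x k) ∈ Metric.ball x₀ c.r := fun k => by
    refine (hd k).trans_le (mul_le_of_le_one_right hr.le ?_)
    rw [div_le_one (by positivity)]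
    linarith [(Nat.cast_nonneg k : (0 : ℝ) ≤ k)]
  have hlim : Tendsto (fun k => c.foot (x k)) atTop (𝓝 x₀) := by
    refine tendsto_iff_dist_tendsto_zero.2 (squeeze_zero (fun _ => dist_nonneg)
      (fun k => (hd k).le) ?_)
    simpa using tendsto_one_div_add_atTop_nhds_zero_nat.const_mul c.r
  obtain ⟨ν, hν, -⟩ := exists_mem_normals
    (fun k => c.isExteriorNormal_foot hΩ (hxd k) (hball k)) hlim
  exact ⟨ν, hν⟩

/-- A monotone function of `c.g` increases in the directions in which `c.g` does. -/
lemma fderiv_nonneg_of_comp {χ : (𝔼 n) → ℝ} {κ : ℝ → ℝ} (hκ : Monotone κ) {x v : 𝔼 n}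
    (hχ : χ =ᶠ[𝓝 x] fun y => κ (c.g y)) (hd : DifferentiableAt ℝ χ x)
    (hg : DifferentiableAt ℝ c.g x) (hv : 0 < fderiv ℝ c.g x v) : 0 ≤ fderiv ℝ χ x v := by
  have h1 := (hd.hasFDerivAt.hasLineDerivAt v).tendsto_slope_zero_right
  have h2 := (hg.hasFDerivAt.hasLineDerivAt v).tendsto_slope_zero_right
  have h3 : ∀ᶠ t : ℝ in 𝓝[>] 0, χ (x + t • v) = κ (c.g (x + t • v)) := by
    have : Tendsto (fun t : ℝ => x + t • v) (𝓝[>] 0) (𝓝 x) := by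
      have h : Continuous fun t : ℝ => x + t • v := by fun_prop
      simpa using (h.tendsto 0).mono_left nhdsWithin_le_nhds
    exact this.eventually hχ
  refine ge_of_tendsto h1 ?_
  filter_upwards [h3, h2.eventually_const_lt hv, eventually_mem_nhdsWithin (s := Ioi (0 : ℝ))]
    with t ht hgt ht0
  have ht0' : (0 : ℝ) < t⁻¹ := inv_pos.2 ht0
  rw [smul_eq_mul] at hgt ⊢
  refine mul_nonneg ht0'.le (sub_nonneg.2 ?_)
  have h4 : c.g x ≤ c.g (x + t • v) := (sub_pos.1 (pos_of_mul_pos_right hgt ht0'.le)).le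
  rw [ht, hχ.self_of_nhds]
  exact hκ h4

/-- The cutoffs are increasing functions of `g`. At almost every point the gradient of `g` is a
negative multiple of the exterior normal at the foot, so `∂φ/∂ν < 0` means that `g`, and with it the
cutoff, increases along `∇φ`. -/
lemma hasCutoffs (c : Chart Ω x₀) (hΩ : IsOpen Ω) (hx₀ : x₀ ∈ frontier Ω) (hφ : ContDiff ℝ 2 φ)
    (hneg : ∀ ν ∈ normals Ω x₀, ⟪∇ φ x₀, ν⟫ < 0) :
    ∃ r > 0, HasCutoffs Ω (Metric.ball x₀ r) φ := by
  obtain ⟨ρ, hρ, hρn⟩ := exists_ball_inner_normal_neg hφ hneg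
  have hL := c.one_le_L
  have hr := c.r_pos
  -- Passing to the foot enlarges the distance to `x₀` by a factor at most `1 + L`; this `s` keeps
  -- the feet in the chart and in the region where the normals are controlled.
  set s := min ρ c.r / (2 * (1 + c.L)) with hs
  have hm : 0 < min ρ c.r := lt_min hρ hr
  have hs0 : 0 < s := by positivity
  have hsm : 2 * ((1 + c.L) * s) = min ρ c.r := by rw [hs]; field_simp
  have hs2 : 2 * s ≤ (1 + c.L) * s := by nlinarith
  let θ : ContDiffBump x₀ := ⟨s, 2 * s, hs0, by linarith⟩
  -- For `j ≥ 1` the ramp is 0 up to `1 / j` and 1 from `2 / j` on, so the support stays in `{1 ≤ j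
  -- * g}`, away from the boundary. For `j = 0` the cutoff vanishes.
  let κ : ℕ → ℝ → ℝ := fun j t => min 1 (max 0 (j * t - 1))
  have hκm : ∀ j, Monotone (κ j) := fun j a b hab => by
    simp only [κ]
    gcongr
  have hκ0 : ∀ j t, 0 ≤ κ j t := fun j t => le_min zero_le_one (le_max_left _ _)
  have hκ1 : ∀ j t, κ j t ≤ 1 := fun j t => min_le_left _ _
  have hlip : ∀ j : ℕ, LipschitzWith (j * c.L) fun y => κ j (c.g y) := fun j => by
    refine LipschitzWith.const_min (LipschitzWith.const_max (LipschitzWith.of_dist_le_mul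
      fun y z => ?_) 0) 1
    rw [Real.dist_eq, dist_eq_norm, sub_sub_sub_cancel_right, ← mul_sub, abs_mul, Nat.abs_cast]
    push_cast
    rw [mul_assoc]
    gcongr
    exact c.abs_g_sub_le y z
  obtain ⟨A, hA⟩ : ∃ A, LipschitzWith A θ := ContDiff.lipschitzWith_of_hasCompactSupport (n := 1)
    θ.hasCompactSupport θ.contDiff one_ne_zero
  have hχl : ∀ j : ℕ, LipschitzWith (1 * (j * c.L) + 1 * A) fun y => θ y * κ j (c.g y) := fun j =>
    lipschitzWith_mul_of_bounded hA (hlip j)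
      (fun x => by rw [abs_of_nonneg θ.nonneg]; exact θ.le_one)
      (fun x => by rw [abs_of_nonneg (hκ0 j _)]; exact hκ1 j _)
  refine ⟨s, hs0, fun j y => θ y * κ j (c.g y), fun j => ⟨⟨_, hχl j⟩,
    θ.hasCompactSupport.mul_right, ?_, fun x => mul_nonneg θ.nonneg (hκ0 j _),
    fun x => mul_le_one₀ θ.le_one (hκ0 j _) (hκ1 j _), ?_⟩, fun x hx => ?_⟩
  · have hclosed : IsClosed (Metric.closedBall x₀ (2 * s) ∩ {y | 1 ≤ j * c.g y}) :=
      Metric.isClosed_closedBall.inter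
        (isClosed_le continuous_const (continuous_const.mul c.lip.continuous))
    refine (closure_minimal (fun y hy => ?_) hclosed).trans fun y hy => ?_
    · have h1 : θ y ≠ 0 := left_ne_zero_of_mul hy
      have h2 : κ j (c.g y) ≠ 0 := right_ne_zero_of_mul hy
      refine ⟨?_, ?_⟩
      · have : y ∈ Function.support θ := h1
        rw [θ.support_eq] at this
        exact Metric.ball_subset_closedBall this
      · by_contra hcon
        have hcon' : (j : ℝ) * c.g y < 1 := not_le.1 hcon
        exact h2 (by simp only [κ]; rw [max_eq_left (by linarith), min_eq_right zero_le_one])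
    · refine (c.mem_iff y ?_).2 ?_
      · have := Metric.mem_closedBall.1 hy.1
        rw [Metric.mem_ball]
        linarith [min_le_right ρ c.r]
      · have h1 : (1 : ℝ) ≤ j * c.g y := hy.2
        exact pos_of_mul_pos_right (by linarith) (Nat.cast_nonneg j)
  · filter_upwards [c.lip.ae_differentiableAt (μ := volume),
      (hχl j).ae_differentiableAt (μ := volume)] with x hgd hχd hx
    have hxs := Metric.mem_ball.1 hx.2
    have hfoot : dist (c.foot x) x₀ < min ρ c.r := by
      refine (c.dist_foot_le hΩ hx₀ x).trans_lt ?_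
      have := mul_lt_mul_of_pos_left hxs (by positivity : (0 : ℝ) < 1 + c.L)
      linarith
    have hN : 0 < ‖∇ c.g x‖ := norm_pos_iff.2 (c.gradient_ne_zero hgd)
    have h1 := hρn _ (hfoot.trans_le (min_le_left _ _)) _
      (c.isExteriorNormal_foot hΩ hgd (hfoot.trans_le (min_le_right _ _))) x
      (by rw [Metric.mem_ball]; linarith [min_le_left ρ c.r])
    rw [inner_neg_right, inner_smul_right, real_inner_comm, inner_gradient, neg_lt_zero] at h1
    refine c.fderiv_nonneg_of_comp (hκm j) ?_ hχd hgd (pos_of_mul_pos_right h1 (by positivity))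
    have h2 : (θ : (𝔼 n) → ℝ) =ᶠ[𝓝 x] fun _ => 1 := θ.eventuallyEq_one_of_mem_ball hx.2
    filter_upwards [h2] with y hy
    rw [hy, one_mul]
  · have hxs : x ∈ Metric.closedBall x₀ s := Metric.ball_subset_closedBall hx.2
    have hg : 0 < c.g x := (c.mem_iff x (by
      have := Metric.mem_ball.1 hx.2
      rw [Metric.mem_ball]
      linarith [min_le_right ρ c.r])).1 hx.1
    refine tendsto_const_nhds.congr' ?_
    filter_upwards [(tendsto_natCast_atTop_atTop (R := ℝ)).eventually_ge_atTop (2 / c.g x)]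
      with j hj
    rw [div_le_iff₀ hg] at hj
    rw [θ.one_of_mem_closedBall hxs, one_mul]
    simp only [κ]
    rw [min_eq_left]
    exact le_max_of_le_right (by linarith)

end Chart

end Normals

/-! ### The limit is a viscosity solution -/

section Viscosity

variable {n : ℕ} {Ω : Set (𝔼 n)} {φ : (𝔼 n) → ℝ} {x₀ : 𝔼 n} {L : ℝ}

lemma eigenOp_congr {φ' : (𝔼 n) → ℝ} (h : φ =ᶠ[𝓝 x₀] φ') (s : ℝ) :
    eigenOp L s φ x₀ = eigenOp L s φ' x₀ := by
  have h1 : ∇ φ x₀ = ∇ φ' x₀ := by rw [gradient, gradient, h.fderiv_eq]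
  simp only [eigenOp, infLaplacian, h1, h.fderiv.fderiv_eq, h.self_of_nhds]

lemma gradient_neg (φ : (𝔼 n) → ℝ) (x : 𝔼 n) : ∇ (fun y => -φ y) x = -∇ φ x := by
  rw [gradient, gradient, fderiv_fun_neg, map_neg]

lemma infLaplacian_neg (φ : (𝔼 n) → ℝ) (x : 𝔼 n) :
    infLaplacian (fun y => -φ y) x = -infLaplacian φ x := by
  have h : fderiv ℝ (fun y => -φ y) = fun y => -fderiv ℝ φ y := by
    funext y
    rw [fderiv_fun_neg]
  rw [infLaplacian, infLaplacian, gradient_neg, h, fderiv_fun_neg]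
  simp

/-- The cases of positive and negative values are exchanged, and so are minimum and maximum. By this
oddness only supersolutions need to be treated. -/
lemma eigenOp_neg (s : ℝ) (φ : (𝔼 n) → ℝ) (x : 𝔼 n) :
    eigenOp L (-s) (fun y => -φ y) x = -eigenOp L s φ x := by
  simp only [eigenOp, gradient_neg, infLaplacian_neg, norm_neg, abs_neg, neg_pos, neg_lt_zero,
    neg_neg]
  rcases lt_trichotomy s 0 with h | h | h
  · rw [if_pos h, if_neg h.not_gt, if_pos h, ← min_neg_neg, neg_sub, neg_neg]
  · simp [h]
  · rw [if_neg h.not_gt, if_pos h, if_pos h, ← max_neg_neg, neg_sub, neg_neg]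

lemma IsViscositySupersolution.neg {u : (𝔼 n) → ℝ}
    (h : IsViscositySupersolution Ω L fun x => -u x) : IsViscositySubsolution Ω L u := by
  obtain ⟨h1, h2, h3⟩ := h
  refine ⟨fun x hx y hy => ?_, fun x₀ hx₀ φ hφ heq hlt => ?_, fun x₀ hx₀ φ hφ heq hlt => ?_⟩
  · filter_upwards [h1 x hx (-y) (neg_lt_neg hy)] with z hz using neg_lt_neg_iff.1 hz
  · have := h2 x₀ hx₀ (fun x => -φ x) hφ.neg (congrArg Neg.neg heq)
      fun x hx hne => neg_lt_neg (hlt x hx hne)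
    rw [eigenOp_neg] at this
    linarith
  · obtain ⟨ν, hν, h4⟩ := h3 x₀ hx₀ (fun x => -φ x) hφ.neg (congrArg Neg.neg heq)
      fun x hx hne => neg_lt_neg (hlt x hx hne)
    rw [eigenOp_neg, gradient_neg, inner_neg_left, max_neg_neg] at h4
    exact ⟨ν, hν, by linarith⟩

/-- A test function near an interior point extends to the whole space. -/
lemma exists_global_test (hΩ : IsOpen Ω) (hx₀ : x₀ ∈ Ω) {u : (𝔼 n) → ℝ}
    (hb : Bornology.IsBounded Ω) (hu : ContinuousOn u (closure Ω)) (hφ : ContDiffOn ℝ 2 φ Ω)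
    (hlt : ∀ x ∈ Ω, x ≠ x₀ → φ x < u x) :
    ∃ ψ : (𝔼 n) → ℝ, ContDiff ℝ 2 ψ ∧ ψ =ᶠ[𝓝 x₀] φ ∧ ∀ x ∈ closure Ω, x ≠ x₀ → ψ x < u x := by
  obtain ⟨K, hK⟩ := hb.isCompact_closure.exists_bound_of_continuousOn hu
  obtain ⟨s, hs, hsΩ⟩ := Metric.isOpen_iff.1 hΩ x₀ hx₀
  let θ : ContDiffBump x₀ := ⟨s / 3, s / 2, by positivity, by linarith⟩
  have hθΩ : tsupport θ ⊆ Ω := by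
    rw [θ.tsupport_eq]
    exact (Metric.closedBall_subset_ball (by change s / 2 < s; linarith)).trans hsΩ
  -- Away from `x₀` the test function is blended into a constant strictly below `u`; a convex
  -- combination of two functions below `u` remains below it.
  refine ⟨fun x => θ x * φ x + (1 - θ x) * -(K + 1), ?_, ?_, fun x hx hne => ?_⟩
  · refine ContDiff.add ?_ ((contDiff_const.sub θ.contDiff).mul contDiff_const)
    rw [contDiff_iff_contDiffAt]
    intro x
    by_cases hx : x ∈ tsupport θ
    · exact θ.contDiff.contDiffAt.mul (hφ.contDiffAt (hΩ.mem_nhds (hθΩ hx)))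
    · have h0 : (fun x => θ x * φ x) =ᶠ[𝓝 x] fun _ => 0 := by
        filter_upwards [notMem_tsupport_iff_eventuallyEq.1 hx] with y hy
        simp [hy]
      exact contDiffAt_const.congr_of_eventuallyEq h0
  · filter_upwards [θ.eventuallyEq_one] with x hx
    simp [hx]
  · have hux : -(K + 1) < u x := by
      have := abs_le.1 (hK x hx)
      linarith
    rcases θ.nonneg.eq_or_lt (a := 0) (b := θ x) with h | h
    · simpa [← h] using hux
    · have hxΩ : x ∈ Ω := hθΩ (subset_tsupport _ h.ne')
      have h1 := mul_lt_mul_of_pos_left (hlt x hxΩ hne) h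
      have h2 := mul_le_mul_of_nonneg_left hux.le (sub_nonneg.2 (θ.le_one (x := x)))
      linarith

variable {p Λ : ℕ → ℝ} {W : ℕ → (𝔼 n) → ℝ} {F : ℕ → (𝔼 n) → (𝔼 n)} {W' : (𝔼 n) → ℝ}

lemma IsMinimizerLimit.neg (h : IsMinimizerLimit Ω p Λ W F W') (hb : Bornology.IsBounded Ω) :
    IsMinimizerLimit Ω p Λ (fun k x => -W k x) (fun k x => -F k x) fun x => -W' x := by
  refine ⟨h.four_lt, h.tendsto_p, fun k => (h.minimizer k).neg hb (by linarith [h.four_lt k]),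
    fun k => (h.continuousOn k).neg, ?_, h.continuousOn_limit.neg, ?_⟩
  · rw [Metric.tendstoUniformlyOn_iff]
    intro ε hε
    filter_upwards [Metric.tendstoUniformlyOn_iff.1 h.tendsto ε hε] with k hk x hx
    rw [dist_neg_neg]
    exact hk x hx
  · obtain ⟨B, hB⟩ := h.bounded
    exact ⟨B, fun k x hx => by rw [abs_neg]; exact hB k x hx⟩

/-- A failure of the condition yields both ingredients of `not_isStrictNear`: the negative operator
gives the strict subsolution and, on the boundary, the negative normal derivatives give the cutoffs.
-/
lemma IsMinimizerLimit.isViscositySupersolution (h : IsMinimizerLimit Ω p Λ W F W')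
    (hΩ : IsOpen Ω) (hb : Bornology.IsBounded Ω) (hlip : HasLipschitzBoundary Ω)
    (hΛ : Tendsto Λ atTop (𝓝 L)) : IsViscositySupersolution Ω L W' := by
  have hΛ0 : ∀ k, 0 ≤ Λ k := fun k => (h.minimizer k).nonneg
  refine ⟨h.continuousOn_limit.lowerSemicontinuousOn, fun x₀ hx₀ φ hφ heq hlt => ?_,
    fun x₀ hx₀ φ hφ heq hlt => ?_⟩
  · by_contra hcon
    obtain ⟨ψ, hψ, hψφ, hψlt⟩ := exists_global_test hΩ hx₀ hb h.continuousOn_limit hφ hlt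
    obtain ⟨r, hr, hcut⟩ := hasCutoffs_of_mem hΩ hx₀ ψ
    have heq' : W' x₀ = ψ x₀ := heq.trans hψφ.self_of_nhds.symm
    refine h.not_isStrictNear hΩ hb hψ (subset_closure hx₀) heq' hψlt hr hcut
      (isStrictNear_of_eigenOp_neg hψ h.tendsto_p hΛ hΛ0 ?_)
    rw [← heq', eigenOp_congr hψφ]
    exact not_le.1 hcon
  · obtain ⟨c⟩ := hlip.nonempty_chart hx₀
    by_contra! hcon
    -- The negated condition speaks about all normals; one of them is needed to extract the sign of
    -- the operator.
    obtain ⟨ν, hν⟩ := c.normals_nonempty hΩ hx₀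
    obtain ⟨r, hr, hcut⟩ := c.hasCutoffs hΩ hx₀ hφ fun ν hν => (max_lt_iff.1 (hcon ν hν)).2
    refine h.not_isStrictNear hΩ hb hφ (frontier_subset_closure hx₀) heq hlt hr hcut
      (isStrictNear_of_eigenOp_neg hφ h.tendsto_p hΛ hΛ0 ?_)
    rw [← heq]
    exact (max_lt_iff.1 (hcon ν hν)).1

lemma IsMinimizerLimit.isViscositySolution (h : IsMinimizerLimit Ω p Λ W F W')
    (hΩ : IsOpen Ω) (hb : Bornology.IsBounded Ω) (hlip : HasLipschitzBoundary Ω)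
    (hΛ : Tendsto Λ atTop (𝓝 L)) : IsViscositySolution Ω L W' :=
  ⟨h.continuousOn_limit, ((h.neg hb).isViscositySupersolution hΩ hb hlip hΛ).neg,
    h.isViscositySupersolution hΩ hb hlip hΛ⟩

end Viscosity

end

end NeumannInfty

theorem mainTheorem2 {n : ℕ} (hn : 0 < n) (Ω : Set (EuclideanSpace ℝ (Fin n)))
    (hopen : IsOpen Ω) (hbdd : Bornology.IsBounded Ω) (hconn : IsConnected Ω)
    (hlip : NeumannInfty.HasLipschitzBoundary Ω)
    (p : ℕ → ℝ) (hp1 : ∀ k, 1 < p k) (hp : Tendsto p atTop atTop)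
    (u : ℕ → EuclideanSpace ℝ (Fin n) → ℝ)
    (hu : ∀ k, NeumannInfty.IsNormalizedMinimizer Ω (p k) (u k)) :
    Tendsto (fun k => NeumannInfty.lambdaP Ω (p k)) atTop (𝓝 (NeumannInfty.lambdaInfty Ω)) ∧
    ∃ (σ : ℕ → ℕ) (w : ℕ → EuclideanSpace ℝ (Fin n) → ℝ) (uInf : EuclideanSpace ℝ (Fin n) → ℝ),
      StrictMono σ ∧
      (∀ k, ContinuousOn (w k) (closure Ω) ∧ u (σ k) =ᵐ[volume.restrict Ω] w k) ∧
      TendstoUniformlyOn w uInf atTop (closure Ω) ∧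
      NeumannInfty.IsViscositySolution Ω (NeumannInfty.lambdaInfty Ω) uInf := by
  have hvol := NeumannInfty.volume_real_pos hopen hbdd hconn.nonempty
  have hmin : ∀ k, ∃ G, NeumannInfty.Minimizer Ω (p k) (NeumannInfty.lambdaP Ω (p k)) (u k) G :=
    fun k => (hu k).exists_minimizer hvol (hp1 k)
  have hΛ := NeumannInfty.tendsto_eigenvalue hn hopen hbdd hconn.nonempty hlip hp hmin
  have hnonneg : 0 ≤ NeumannInfty.lambdaInfty Ω := ENNReal.toReal_nonneg
  -- The eigenvalues converge, so any positive number above their limit bounds them eventually;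
  -- `lambdaInfty Ω + 1` is one.
  obtain ⟨σ, W, G, W', hσ, hW, hlim⟩ := NeumannInfty.exists_isMinimizerLimit hn hopen hbdd hlip hp
    hmin (a := NeumannInfty.lambdaInfty Ω + 1) (by linarith)
    ((hΛ.eventually_lt_const (lt_add_one _)).mono fun _ h => h.le)
  exact ⟨hΛ, σ, W, W', hσ, fun k => ⟨hlim.continuousOn k, hW k⟩, hlim.tendsto,
    hlim.isViscositySolution hopen hbdd hlip (hΛ.comp hσ.tendsto_atTop)⟩
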